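/- **Ordinal diagrams.** *Expressions* are built from symbols $0,\Omega,\pi$ by $a+b$, $\varphi ab$, $a\mapsto a^{+}$ and $(\sigma,a,q)\mapsto d^{q}_{\sigma}a$, where $q$ is a finite (possibly empty) sequence of quadruples $(j_m,\kappa_m,\tau_m,\nu_m)_{m\le l}$, $j_m\in\mathbb N$ and $\kappa_m,\tau_m,\nu_m$ expressions; $d_\sigma a$ is $d^q_\sigma a$ with $q$ empty. A set-valued function on expressions is applied to a sequence $q$, or to a set, by taking the union over its entries. A sum $a_1+\dots+a_n$ is read as $a_1+(a_2+\cdots)$. Put $SR=\{\Omega\}\cup\{a^{+}\}$; $\mathcal D^Q=\{d^q_\sigma a: q\ne\emptyset\}$; $R=\{\pi\}\cup\mathcal D^Q\cup SR$; $\mathcal D_\sigma=\{d^q_\sigma a\}$; $b(d^q_\sigma a)=a$; strongly critical expressions are $\Omega,\pi,a^+,d^q_\sigma a$; additive principal ones are these and the $\varphi ab$. Let $\prec$ be the transitive closure of $\{(\alpha,\beta):\alpha\in\mathcal D_\beta\}$ and $\preceq$ its reflexive closure. The relation $<$ and the sets $K_\sigma\alpha$ are defined simultaneously. $K_\sigma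 0=K_\sigma\Omega=K_\sigma\pi=\emptyset$, $K_\sigma(a+b)=K_\sigma(\varphi ab)=K_\sigma a\cup K_\sigma b$, $K_\sigma(a^+)=K_\sigma a$, and $K_\sigma(d^q_\tau a)$ is $K_\sigma(\{\tau,a\}\cup q)$ if $\sigma<\tau$; $K_\sigma\tau$ if $\tau<\sigma$ and $\tau\not\preceq\sigma$; $\{d^q_\tau a\}$ if $d^q_\tau a\prec\sigma$. The relation $\alpha<\beta$ holds in exactly the following cases. (1) $0<\beta$ for $\beta\neq0$; $a+b<c+d$ iff $a<c$, or $a=c$ and $b<d$; $a+b<\beta$ iff $a<\beta$ for $\beta\ne0$ not a sum; $\alpha<c+d$ iff $\alpha\le c$ for $\alpha$ not a sum. (2) $\varphi ab<\varphi cd$ iff ($a<c$ and $b<\varphi cd$) or ($a=c$ and $b<d$) or ($c<a$ and $\varphi ab<d$); for strongly critical $\gamma$: $\varphi ab<\gamma$ iff $a,b<\gamma$, and $\gamma<\varphi cd$ iff $\gamma\le c$ or $\gamma\le d$. (3) Every strongly critical $\gamma\ne\pi$ is $<\pi$; $\Omega<a^+$; $\Omega<d^p_\tau b$ iff $\tau\neq\Omega$;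 $d^q_\sigma a<\Omega$ iff $\sigma=\Omega$; $a^+<b^+$ iff $a<b$; $a^+<d^p_\tau b$ iff $a^+<\tau$ and $a<d^p_\tau b$; $d^q_\sigma a<b^+$ iff $\sigma\le b^+$ or $d^q_\sigma a\le b$. (4) $\alpha=d^q_\sigma a<d^p_\tau b=\beta$ iff one of: (i) $\sigma=\tau$ and either $\alpha\le k$ for some $k\in K_\sigma(\{b\}\cup p)$, or $K_\sigma(\{a\}\cup q)<\beta$ and ($a<b$, or $a=b$ and $q<p$); (ii) $\sigma<\tau$ and either $\sigma\le\beta$ or $\alpha\le k$ for some $k\in K_\sigma(\{\tau,b\}\cup p)$; (iii) $\tau<\sigma$, $\alpha<\tau$ and $K_\tau(\{\sigma,a\}\cup q)<\beta$. Here $q<p$ means that $q$ is shorter, or of the same length and lexicographically smaller in the arrangement $(j_l,\kappa_l,\tau_l,\nu_l,\dots,j_0,\kappa_0,\tau_0,\nu_0)$. For a set $A$, $A<\beta$ means $x<\beta$ for all $x\in A$. $\mathcal B_\sigma$ commutes with $+,\varphi,{}^+$ as $K_\sigma$ does, is empty on $0,\Omega,\pi$, and $\mathcal B_\sigma(d^q_\tau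 a)$ is $\{a\}\cup\mathcal B_\sigma(\{\tau,a\}\cup q)$ if $\sigma\le\tau$, and $\mathcal B_\sigma(\tau)$ if $\tau<\sigma$. $\mathcal B_{>\sigma}(\alpha)$ is the union of $\mathcal B_\tau(\alpha)$ over the $\tau\in R$, $\tau>\sigma$, that are subdiagrams of $\alpha$ ($\alpha$ included). A system of *ordinal diagrams* (o.d.'s) is generated by: $0,\Omega,\pi$; sums $a_1+\cdots+a_n$, $n\ge2$, of additive principal o.d.'s $a_1\ge\cdots\ge a_n$; $\varphi ab$ with $a,b<\pi$ or ($a=0$ and $b>\pi$), where it is not the case that $b=\varphi cd$ with $a<c$, nor that $b$ is strongly critical and $a<b$, nor that $a$ is strongly critical and $b=0$; $\kappa^{+k}$ for $\kappa\in\mathcal D^Q$, $k>0$; $d_\sigma a$ for $\sigma\in SR$ with $\mathcal B_{>\sigma}(\{\sigma,a\})<a$; and $d^q_\sigma a$ for $\sigma\in\{\pi\}\cup\mathcal D^Q$, $q\ne\emptyset$ a sequence of quadruples of o.d.'s with $\mathcal B_{>\sigma}(\{\sigma,a\}\cup q)<a$, subject to a further restriction which determines the system. For $\rho=d^q_\sigma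 a$ with $q=(j_m,\kappa_m,\tau_m,\nu_m)_{m\le l}$ put $In(\rho)=\{j_m:m\le l\}$; $pd_i(\rho)=\tau_m$ for the least $m$ with $i\le j_m$; if $i=j_m$ then $st_i(\rho)=\nu_m$, $rg_i(\rho)=\kappa_m$; otherwise $st_i(\rho)=st_i(pd_i(\rho))$ and $rg_i(\rho)=rg_i(pd_i(\rho))$ (possibly undefined); $in_i(\rho)=(st_i(\rho),rg_i(\rho))$. Let $\prec_i$ be the transitive closure of $pd_i(\alpha)=\beta$ and $\preceq_i$ its reflexive closure. By convention $\nu<\pi^+$ for all $\nu$. *$Od(M_3^2)$*: $q$ is a single quadruple $(2,\kappa,\sigma,\nu)$ and, for $\rho=d^q_\sigma a$ and $M_3=\{\pi\}\cup\{\alpha\in\mathcal D^Q: rg_2(\alpha)=\pi\}$: $\sigma\preceq\kappa\in M_3$; $\nu\le a$ if $\sigma=\pi$; $\nu<\kappa^+$; if $\kappa=\pi$ then $st_2(\rho)<st_2(\eta)$ for all $\eta\in M_3$, $\eta<\pi$, with $\rho\prec\eta$; if $\kappa\neq\pi$ then $\kappa=\min\{\kappa'<\pi:\rho\prec\kappa'\in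 M_3\}$ and $st_2(\rho)<st_2(\tau)$ whenever $\rho\prec\tau\prec\kappa$; and $K_\tau\nu<\rho$ for all $\tau\le\kappa$. *$Od(\Pi_N)$*: $2\le j_0<\dots<j_l=N-1$; $\kappa_l=\pi$; $\sigma\preceq\kappa_m$; $\tau_0=\sigma$; $\sigma\preceq\tau_m\in\{\pi\}\cup\mathcal D^Q$; $\nu_m<\kappa_m^+$ for $m<l$; $\nu_l\le a$ if $\sigma=\pi$; $\sigma=\pi$ if $\tau_l=\pi$; and for $\rho=d_\sigma^qa$ and every $i\in In(\rho)$, with $\kappa=rg_i(\rho)$, $p=pd_i(\rho)$, $\nu=st_i(\rho)$: if $i<N-1$ then $in_i(\kappa)=in_i(pd_{i+1}(\rho))$, $\kappa\preceq_i pd_{i+1}(\rho)$, $p\ne pd_{i+1}(\rho)$; $p\preceq_i\kappa$; $K_\tau\nu<\rho$ for all $\tau\le\kappa$; and one of: (a) $\kappa=p$ and $\mathcal B_{>\kappa}(\nu)<b(\alpha_1)$ where $\rho\preceq\alpha_1\in\mathcal D_\kappa$; (b) $\kappa=rg_i(p)$ and $\nu<st_i(p)$; (c) $rg_i(p)\prec_i\kappa$,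 $rg_i(\tau)\preceq_i\kappa$ for all $\tau$ with $rg_i(p)\preceq_i\tau\prec_i\kappa$, and $\sigma_1=\min\{x: rg_i(x)=\kappa,\ p\prec_ix\prec_i\kappa\}$ exists and $\nu<st_i(\sigma_1)$. **Operators.** Let $S$ be one of these systems, $X\subseteq S$, $X|\alpha=\{x\in X:x<\alpha\}$; $\gamma\le X|\alpha$ means $\gamma\le\delta$ for some $\delta\in X|\alpha$. $\mathcal C^\alpha(X)$ is the closure of $\{0,\Omega,\pi\}\cup(X|\alpha)$ in $S$ under $+$, $\varphi$, ${}^+$ and $(\sigma,a,q)\mapsto d^q_\sigma a$ for $\sigma>\alpha$. $\mathcal G(X)=\{\alpha\in S:\alpha\in\mathcal C^\alpha(X),\ \mathcal C^\alpha(X)|\alpha\subseteq X\}$. For an operator $\Gamma$ on subsets of $S$ put $\Gamma^x=\bigcup_{y<x}\Gamma(\Gamma^y)$ for ordinals $x$, $\mathcal W=\bigcup_x\Gamma^x$, and $|\alpha|=\min\{x:\alpha\in\Gamma^{x+1}\}$ for $\alpha\in\mathcal W$. *$\Gamma_{32}$* (on $Od(M_3^2)$). $\alpha\lhd\beta$ iff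 $\alpha,\beta\in\mathcal D^Q$ and $\alpha\prec\beta\prec rg_2(\alpha)$; $V(X)=\{\alpha:\forall\gamma\lhd\alpha\,(\gamma\in\mathcal G(X)\to\gamma\in X)\}$. $\alpha\in\Gamma_{30}(X)$ iff $\pi>\alpha\notin M_3$, $\alpha\in\mathcal G(X)\cap V(X)$ and, if $\alpha\in SR$, $\forall\gamma\in\mathcal D_\alpha(\gamma\in\mathcal G(X)\to\gamma\in X)$. $\alpha\in\Gamma_{32}(X)$ iff $\alpha\in\Gamma_{30}(X)$, or $\Gamma_{30}(X)\subseteq X$, $\pi>\alpha\in M_3$ and $\alpha\in\mathcal G(X)\cap V(X)$. *$\Gamma_N$* (on $Od(\Pi_N)$, $N\ge4$). For $\eta\in\mathcal D^Q$ let $\eta_\pi$ be the diagram with $\eta\preceq\eta_\pi\in\mathcal D_\pi$. For $2\le i<N-1$ define $\eta_i^n$ ($n<lh_i(\eta)$): $\eta_i^0$ is the minimal $\delta$ with $\eta\preceq_i\delta$ and $i\in In(\delta)$; if there is none, $\eta_i^0=\eta_\pi$ and $lh_i(\eta)=1$. If $i\in In(\eta_i^n)$, then $\eta_i^{n+1}$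 is the minimal $\delta$ with $rg_i(\eta_i^n)\preceq_i\delta$ and $i\in In(\delta)$; if there is none, $\eta_i^{n+1}=\eta_\pi$ and $lh_i(\eta)=n+2$. $\alpha\lhd_i\beta$ iff $\alpha,\beta\in\mathcal D^Q$, $i\in In(\alpha)$ and $\alpha\prec_i\beta\prec_irg_i(\alpha)$. $\gamma\prec_i^p\alpha$ iff $\gamma\prec_i\alpha$ and there is no $n<lh_i(\gamma)$ with $\gamma_i^n\lhd_i\alpha$; $\preceq^p_i$ is its reflexive closure. Let $I_N$ be the set of functions $s:[i,k)\to\{0,1\}$, $2\le i\le k\le N-2$ (empty functions for different $i$ being distinguished), $d(s)=i$, $\ell(s)=k$, $\#s=\#\{j:s(j)=1\}$; $s|j$ is the restriction of $s$ to $[d(s),j)$, and $t\subseteq_es$ means $t=s|j$ for some $j\in[d(s),\ell(s)]$. Define $\alpha(s)$ for $\alpha\in\mathcal D^Q$ as follows. If $s$ is constantly $0$ then $\alpha(s)=\alpha$. If $s$ takes the value $1$ exactly at $p=\ell(s)-1$, then: if $\alpha_p^0<\alpha_i^0$ and $rg_p(\alpha)\le\alpha_i^0$ for all $i\in[d(s),p)$,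 and if $\alpha_p^1$ exists, put $\alpha'=\min(\{\alpha_i^0:i\in[d(s),p)\}\cup\{\alpha_p^1\})$ and $\alpha(s)=\max\{\delta:\alpha_p^0\preceq_{p+1}^p\delta<\alpha'(s)\}$; otherwise $\alpha(s)=\alpha_\pi$. In general split the domain of $s$ after each $j$ with $s(j)=1$, so that $s=s_0*\cdots*s_m$, and put $\alpha(s)=(\cdots(\alpha(s_0))\cdots)(s_m)$. For $\alpha,\beta\in\mathcal D^Q$ and $2\le k\leq N-2$ define $s[k;\alpha,\beta]:[k,N-2)\to\{0,1\}$ recursively: with $s=s[k;\alpha,\beta]|i$, its value at $i$ is $1$ iff there is $\gamma$ with $\alpha(s)\preceq_i\gamma\prec_i\beta(s)$ and $i\in In(\gamma)$. Write $s\subseteq s[\alpha,\beta]$ if $s\subseteq_es[d(s);\alpha,\beta]$. For $\alpha,\beta\in\mathcal D^Q$: $\alpha\prec_s\beta$ iff $s\subseteq s[\alpha,\beta]$ and $\alpha(t)\prec^p_{\ell(t)}\beta(t)$ for all $t\subseteq_es$; $\alpha\lhd_s\beta$ iff $s\subseteq s[\alpha,\beta]$, $\alpha\prec_{s|(\ell(s)-1)}\beta$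 if $\ell(s)>d(s)$, and $\alpha(s)\lhd_{\ell(s)}\beta(s)$; $\alpha\lhd_s^+\beta$ iff $\alpha\lhd_s\beta$ and for each $i\in[d(s),\ell(s))$ with $s(i)=1$ and $i\notin In(\alpha(s|i))$ there are $K$, diagrams $\alpha_0,\dots,\alpha_K$ and $v_0,\dots,v_{K-1}\in I_N$ with $d(v_k)=i$ such that $\alpha_K=\alpha(s|i)$, $\alpha_0=(\alpha_K)_i^0$ and $\alpha_{k+1}\lhd_{v_k}\alpha_k$ for all $k<K$. Put $\mathcal G_1=\mathcal G$, $\mathcal G_{<i}(X)=\bigcap_{1\le j<i}\mathcal G_j(X)$, and for $2\le i<N-1$ let $\alpha\in\mathcal G_i(X)$ iff for all $s\in I_N$ with $d(s)=2$ and $2+\#s=i$ and all $\gamma\lhd_s^+\alpha$: $\gamma\in\mathcal G_{<i}(X)\to\gamma\le X|\alpha$. Finally $\alpha\in\Gamma_N(X)$ iff $\alpha<\pi$; $\alpha\in\mathcal G_{<N-1}(X)$; if $\alpha\in SR$ then $\forall\gamma\in\mathcal D_\alpha(\gamma\in\mathcal G(X)\to\gamma\in X)$; and $\gamma\le X|\alpha$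 for every $\gamma\in\mathcal G_{<N-1}(X)$ with $\gamma\prec_{s[2;\gamma,\alpha]}\alpha$. **Theorem.** Let $\Gamma$ be $\Gamma_{32}$, or $\Gamma_N$ for any $N\ge4$, and let $\mathcal W$ and $|\cdot|$ be formed from $\Gamma$. If $\alpha,\beta\in\mathcal W$ and $\alpha<\beta$, then $|\alpha|<|\beta|$. -/

import Mathlib

/-! ## Expressions

`Dg` is the type of raw expressions.  An ordinal diagram (o.d.) is an expression satisfying `IsOd`
below; the expressions `nil`, `cons j κ τ ν q` are the finite sequences of quadruples that occur as
the superscript `q` of `d_σ^q a` (entry of lowest index first).  The number `j` of a quadruple is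
kept as a natural number; as an o.d. it is a numeral, which belongs to every closure and has empty
`K_σ` and `ℬ_σ`, so it is omitted from the entries below. -/

inductive Dg : Type where
  | zero : Dg
  | omega : Dg
  | pi : Dg
  | add (a b : Dg) : Dg
  | phi (a b : Dg) : Dg
  | next (a : Dg) : Dg
  | col (s a q : Dg) : Dg
  | nil : Dg
  | cons (j : ℕ) (k t n q : Dg) : Dg

namespace Dg

/-- Number of symbols. -/
def size : Dg → ℕ
  | zero => 1
  | omega => 1
  | pi => 1
  | add a b => size a + size b + 1
  | phi a b => size a + size b + 1
  | next a => size a + 1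
  | col s a q => size s + size a + size q + 1
  | nil => 1
  | cons _ k t n q => size k + size t + size n + size q + 1

/-- The subexpressions of an expression, including itself. -/
def sub : Dg → Set Dg
  | zero => {zero}
  | omega => {omega}
  | pi => {pi}
  | add a b => {add a b} ∪ sub a ∪ sub b
  | phi a b => {phi a b} ∪ sub a ∪ sub b
  | next a => {next a} ∪ sub a
  | col s a q => {col s a q} ∪ sub s ∪ sub a ∪ sub q
  | nil => {nil}
  | cons j k t n q => {cons j k t n q} ∪ sub k ∪ sub t ∪ sub n ∪ sub q

/-- The list of quadruples `(j_m, κ_m, τ_m, ν_m)`, `m = 0, …, l`, of a sequence. -/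
def quads : Dg → List (ℕ × Dg × Dg × Dg)
  | cons j k t n q => (j, k, t, n) :: quads q
  | _ => []

/-- Proper (possibly empty) sequences of quadruples. -/
def IsSeq : Dg → Prop
  | nil => True
  | cons _ _ _ _ q => IsSeq q
  | _ => False

/-- `x` occurs in one of the quadruples of `q`. -/
def InQ (x q : Dg) : Prop :=
  ∃ e ∈ quads q, x = e.2.1 ∨ x = e.2.2.1 ∨ x = e.2.2.2

/-- `SC`, the strongly critical diagrams. -/
def IsSC : Dg → Prop
  | omega => True
  | pi => True
  | next _ => True
  | col _ _ _ => True
  | _ => False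

/-- `P`, the additive principal diagrams. -/
def IsPrin : Dg → Prop
  | phi _ _ => True
  | x => IsSC x

/-- `SR = {Ω} ∪ {κ^{+k}}`. -/
def IsSR : Dg → Prop
  | omega => True
  | next _ => True
  | _ => False

/-- `𝒟^Q`: the diagrams `d_σ^q a` with nonempty `q`. -/
def IsDQ : Dg → Prop
  | col _ _ (cons _ _ _ _ _) => True
  | _ => False

/-- `R = {π} ∪ 𝒟^Q ∪ SR`. -/
def IsR (x : Dg) : Prop := x = pi ∨ IsDQ x ∨ IsSR x

/-- `a ∈ 𝒟_b`. -/
def DMem (a b : Dg) : Prop := ∃ c q, a = col b c q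

/-- `a ≺ b`: the transitive closure of `a ∈ 𝒟_b`. -/
def Prec (a b : Dg) : Prop := Relation.TransGen DMem a b

/-- `a ≼ b`. -/
def PrecEq (a b : Dg) : Prop := Relation.ReflTransGen DMem a b

/-- `b(d_σ^q a) = a`. -/
def bOf : Dg → Dg
  | col _ a _ => a
  | _ => zero

/-! ## The ordering -/

/-- The set `K_σ x`, formed with the order relation `r`. -/
def KWith (r : Dg → Dg → Prop) (σ : Dg) : Dg → Set Dg
  | zero => ∅
  | omega => ∅
  | pi => ∅
  | add a b => KWith r σ a ∪ KWith r σ b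
  | phi a b => KWith r σ a ∪ KWith r σ b
  | next a => KWith r σ a
  | col τ a q =>
      {x | (r σ τ ∧ (x ∈ KWith r σ τ ∨ x ∈ KWith r σ a ∨ x ∈ KWith r σ q)) ∨
        (r τ σ ∧ ¬ PrecEq τ σ ∧ x ∈ KWith r σ τ) ∨
        (Prec (col τ a q) σ ∧ x = col τ a q)}
  | nil => ∅
  | cons _ k t n q => KWith r σ k ∪ KWith r σ t ∪ KWith r σ n ∪ KWith r σ q

/-- The ordering of sequences of quadruples: shorter sequences are smaller, and sequences of the
same length are compared lexicographically in the arrangement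
`(j_l, κ_l, τ_l, ν_l, …, j_0, κ_0, τ_0, ν_0)`. -/
def SeqLt (r : Dg → Dg → Prop) : Dg → Dg → Prop
  | nil, cons _ _ _ _ _ => True
  | cons j k t n q, cons j' k' t' n' q' =>
      SeqLt r q q' ∨ (q = q' ∧ (j < j' ∨ (j = j' ∧ (r k k' ∨ (k = k' ∧
        (r t t' ∨ (t = t' ∧ r n n')))))))
  | _, _ => False

/-- One unfolding of `x < y`, where `r` is used for comparisons of smaller expressions. -/
def Step (r : Dg → Dg → Prop) : Dg → Dg → Prop
  -- sums and zero
  | zero, y => y ≠ zero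
  | _, zero => False
  | add a b, add c d => r a c ∨ (a = c ∧ r b d)
  | add a _, y => r a y
  | x, add c _ => r x c ∨ x = c
  -- the binary Veblen function
  | phi a b, phi c d =>
      (r a c ∧ r b (phi c d)) ∨ (a = c ∧ r b d) ∨ (r c a ∧ r (phi a b) d)
  | phi a b, y => r a y ∧ r b y
  | x, phi c d => (r x c ∨ x = c) ∨ (r x d ∨ x = d)
  -- strongly critical diagrams
  | pi, _ => False
  | _, pi => True
  | omega, omega => False
  | omega, next _ => True
  | omega, col τ _ _ => τ ≠ omega
  | next _, omega => False
  | col σ _ _, omega => σ = omega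
  | next a, next b => r a b
  | next a, col τ b p => r (next a) τ ∧ r a (col τ b p)
  | col σ a q, next b =>
      (r σ (next b) ∨ σ = next b) ∨ (r (col σ a q) b ∨ col σ a q = b)
  | col σ a q, col τ b p =>
      (σ = τ ∧
        ((∃ k, (k ∈ KWith r σ b ∨ k ∈ KWith r σ p) ∧ (r (col σ a q) k ∨ col σ a q = k)) ∨
         ((∀ k, (k ∈ KWith r σ a ∨ k ∈ KWith r σ q) → r k (col τ b p)) ∧
          (r a b ∨ (a = b ∧ SeqLt r q p))))) ∨
      (r σ τ ∧
        ((r σ (col τ b p) ∨ σ = col τ b p) ∨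
         (∃ k, (k ∈ KWith r σ τ ∨ k ∈ KWith r σ b ∨ k ∈ KWith r σ p) ∧
            (r (col σ a q) k ∨ col σ a q = k)))) ∨
      (r τ σ ∧ r (col σ a q) τ ∧
        (∀ k, (k ∈ KWith r τ σ ∨ k ∈ KWith r τ a ∨ k ∈ KWith r τ q) → r k (col τ b p)))
  | _, _ => False

/-- The comparison unfolded `n` times. -/
def ltN : ℕ → Dg → Dg → Prop
  | 0 => fun _ _ => False
  | n + 1 => Step (ltN n)

/-- The ordering of ordinal diagrams.  Every comparison that `Step` makes is between expressions of
smaller total size, so `size x + size y` unfoldings suffice: see `lt_iff_step`. -/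
def lt (x y : Dg) : Prop := ltN (size x + size y) x y

theorem size_pos (x : Dg) : 0 < size x := by
  cases x <;> simp [size]

theorem size_of_mem_KWith {r : Dg → Dg → Prop} {σ k : Dg} :
    ∀ {x : Dg}, k ∈ KWith r σ x → size k ≤ size x := by
  intro x
  induction x with
  | col τ a q h1 h2 h3 =>
    rintro (⟨_, h | h | h⟩ | ⟨_, _, h⟩ | ⟨_, rfl⟩)
    · have := h1 h; simp only [size]; omega
    · have := h2 h; simp only [size]; omega
    · have := h3 h; simp only [size]; omega
    · have := h1 h; simp only [size]; omega
    · exact le_refl _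
  | _ => simp only [KWith, size, Set.mem_union, Set.mem_empty_iff_false, false_imp_iff] <;> grind

theorem KWith_congr {r r' : Dg → Dg → Prop} (σ : Dg) : ∀ x : Dg,
    (∀ a b, size a + size b ≤ size σ + size x → (r a b ↔ r' a b)) →
      KWith r σ x = KWith r' σ x := by
  intro x
  induction x with
  | col τ a q h1 h2 h3 =>
    intro h
    simp only [size] at h
    simp only [KWith]
    rw [h1 fun c d hc => h c d (by omega), h2 fun c d hc => h c d (by omega),
      h3 fun c d hc => h c d (by omega), h σ τ (by omega), h τ σ (by omega)]
  | next a h1 =>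
    intro h
    simp only [size] at h
    simp only [KWith]
    rw [h1 fun c d hc => h c d (by omega)]
  | add a b h1 h2 =>
    intro h
    simp only [size] at h
    simp only [KWith]
    rw [h1 fun c d hc => h c d (by omega), h2 fun c d hc => h c d (by omega)]
  | phi a b h1 h2 =>
    intro h
    simp only [size] at h
    simp only [KWith]
    rw [h1 fun c d hc => h c d (by omega), h2 fun c d hc => h c d (by omega)]
  | cons j k t n q h1 h2 h3 h4 =>
    intro h
    simp only [size] at h
    simp only [KWith]
    rw [h1 fun c d hc => h c d (by omega), h2 fun c d hc => h c d (by omega),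
      h3 fun c d hc => h c d (by omega), h4 fun c d hc => h c d (by omega)]
  | _ => intro _; rfl

theorem SeqLt_congr {r r' : Dg → Dg → Prop} : ∀ q p : Dg,
    (∀ a b, size a + size b ≤ size q + size p → (r a b ↔ r' a b)) →
      (SeqLt r q p ↔ SeqLt r' q p) := by
  intro q
  induction q with
  | cons j k t n q _ _ _ h4 =>
    intro p h
    cases p with
    | cons j' k' t' n' q' =>
      simp only [size] at h
      simp only [SeqLt]
      rw [h4 q' fun c d hc => h c d (by omega), h k k' (by omega), h t t' (by omega),
        h n n' (by omega)]
    | _ => simp only [SeqLt]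
  | _ => intro p _; cases p <;> simp only [SeqLt]

theorem Step_congr {r r' : Dg → Dg → Prop} (x y : Dg)
    (h : ∀ a b, size a + size b < size x + size y → (r a b ↔ r' a b)) :
    Step r x y ↔ Step r' x y := by
  cases x with
  | col σ a q =>
    cases y with
    | col τ b p =>
      simp only [size] at h
      have e1 : KWith r σ b = KWith r' σ b := KWith_congr _ _ fun c d hc => h c d (by omega)
      have e2 : KWith r σ p = KWith r' σ p := KWith_congr _ _ fun c d hc => h c d (by omega)
      have e5 : KWith r σ τ = KWith r' σ τ := KWith_congr _ _ fun c d hc => h c d (by omega)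
      have e6 : KWith r τ σ = KWith r' τ σ := KWith_congr _ _ fun c d hc => h c d (by omega)
      have e7 : KWith r τ a = KWith r' τ a := KWith_congr _ _ fun c d hc => h c d (by omega)
      have e8 : KWith r τ q = KWith r' τ q := KWith_congr _ _ fun c d hc => h c d (by omega)
      have e9 : SeqLt r q p ↔ SeqLt r' q p := SeqLt_congr _ _ fun c d hc => h c d (by omega)
      have f1 : ∀ k, (k ∈ KWith r' σ τ ∨ k ∈ KWith r' σ b ∨ k ∈ KWith r' σ p) →
          (r (col σ a q) k ↔ r' (col σ a q) k) := by
        intro k hk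
        apply h
        simp only [size]
        rcases hk with hk | hk | hk <;> have := size_of_mem_KWith hk <;> omega
      have f2 : ∀ k, (k ∈ KWith r' τ σ ∨ k ∈ KWith r' τ a ∨ k ∈ KWith r' τ q) →
          (r k (col τ b p) ↔ r' k (col τ b p)) := by
        intro k hk
        apply h
        simp only [size]
        rcases hk with hk | hk | hk <;> have := size_of_mem_KWith hk <;> omega
      have g1 := h a b (by omega)
      have g2 := h σ τ (by omega)
      have g3 := h τ σ (by omega)
      have g4 := h σ (col τ b p) (by simp only [size]; omega)
      have g5 := h (col σ a q) τ (by simp only [size]; omega)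
      simp only [Step, e1, e2, e5, e6, e7, e8, e9, g1, g2, g3, g4, g5]
      refine or_congr (and_congr_right fun hst => ?_) (or_congr (and_congr_right fun _ =>
        or_congr Iff.rfl (exists_congr fun k => and_congr_right fun hk => ?_))
        (and_congr_right fun _ => and_congr_right fun _ => forall_congr' fun k =>
          imp_congr_right fun hk => f2 k hk))
      · subst hst
        refine or_congr (exists_congr fun k => and_congr_right fun hk => ?_)
          (and_congr_left fun _ => forall_congr' fun k => ?_)
        · rw [f1 k (Or.inr hk)]
        · rw [e7, e8]
          exact imp_congr_right fun hk => f2 k (Or.inr hk)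
      · rw [f1 k hk]
    | next b =>
      simp only [Step]
      rw [h σ (next b) (by simp only [size]; omega), h (col σ a q) b (by simp only [size]; omega)]
    | phi c d =>
      simp only [Step]
      rw [h (col σ a q) c (by simp only [size]; omega), h (col σ a q) d (by simp only [size]; omega)]
    | add c d =>
      simp only [Step]
      rw [h (col σ a q) c (by simp only [size]; omega)]
    | _ => simp only [Step]
  | phi a b =>
    cases y with
    | phi c d =>
      simp only [Step]
      rw [h a c (by simp only [size]; omega), h b (phi c d) (by simp only [size]; omega),
        h b d (by simp only [size]; omega), h c a (by simp only [size]; omega),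
        h (phi a b) d (by simp only [size]; omega)]
    | add c d =>
      simp only [Step]
      rw [h (phi a b) c (by simp only [size]; omega)]
    | zero => simp only [Step]
    | _ =>
      simp only [Step]
      rw [h a _ (by simp only [size]; omega), h b _ (by simp only [size]; omega)]
  | add a b =>
    cases y with
    | add c d =>
      simp only [Step]
      rw [h a c (by simp only [size]; omega), h b d (by simp only [size]; omega)]
    | zero => simp only [Step]
    | _ =>
      simp only [Step]
      rw [h a _ (by simp only [size]; omega)]
  | next a =>
    cases y with
    | col τ b p =>
      simp only [Step]
      rw [h (next a) τ (by simp only [size]; omega), h a (col τ b p) (by simp only [size]; omega)]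
    | next b =>
      simp only [Step]
      rw [h a b (by simp only [size]; omega)]
    | phi c d =>
      simp only [Step]
      rw [h (next a) c (by simp only [size]; omega), h (next a) d (by simp only [size]; omega)]
    | add c d =>
      simp only [Step]
      rw [h (next a) c (by simp only [size]; omega)]
    | _ => simp only [Step]
  | _ =>
    cases y with
    | phi c d =>
      simp only [Step]
      try rw [h _ c (by simp only [size]; omega), h _ d (by simp only [size]; omega)]
    | add c d =>
      simp only [Step]
      try rw [h _ c (by simp only [size]; omega)]
    | _ => simp only [Step]

theorem ltN_stable : ∀ (s : ℕ) (x y : Dg), size x + size y ≤ s →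
    ∀ n m, size x + size y ≤ n → size x + size y ≤ m → (ltN n x y ↔ ltN m x y) := by
  intro s
  induction s with
  | zero => intro x y hs; have := size_pos x; omega
  | succ s ih =>
    intro x y hs n m hn hm
    have hx := size_pos x
    obtain ⟨n, rfl⟩ : ∃ k, n = k + 1 := ⟨n - 1, by omega⟩
    obtain ⟨m, rfl⟩ : ∃ k, m = k + 1 := ⟨m - 1, by omega⟩
    exact Step_congr x y fun a b hab => ih a b (by omega) n m (by omega) (by omega)

/-- The ordering satisfies its defining clauses. -/
theorem lt_iff_step (x y : Dg) : lt x y ↔ Step lt x y := by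
  have hx := size_pos x
  obtain ⟨n, hn⟩ : ∃ k, size x + size y = k + 1 := ⟨size x + size y - 1, by omega⟩
  have h1 : lt x y ↔ Step (ltN n) x y := by
    unfold lt
    rw [hn]
    rfl
  rw [h1]
  exact Step_congr x y fun a b hab =>
    ltN_stable (size a + size b) a b (Nat.le_refl _) n _ (by omega) (Nat.le_refl _)

/-- `x ≤ y`. -/
def le (x y : Dg) : Prop := lt x y ∨ x = y

/-- `K_σ x`. -/
def K (σ x : Dg) : Set Dg := KWith lt σ x

/-- `ℬ_σ(x)`. -/
def B (σ : Dg) : Dg → Set Dg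
  | zero => ∅
  | omega => ∅
  | pi => ∅
  | add a b => B σ a ∪ B σ b
  | phi a b => B σ a ∪ B σ b
  | next a => B σ a
  | col τ a q =>
      {x | (le σ τ ∧ (x = a ∨ x ∈ B σ τ ∨ x ∈ B σ a ∨ x ∈ B σ q)) ∨ (lt τ σ ∧ x ∈ B σ τ)}
  | nil => ∅
  | cons _ k t n q => B σ k ∪ B σ t ∪ B σ n ∪ B σ q

/-- `ℬ_{>σ}(x)`, the union of the `ℬ_τ(x)` for the regular `τ > σ`.  It is enough to let `τ` range
over subdiagrams of `x`: an element of `ℬ_τ(x)` lies in `ℬ_τ'(x)` for some subscript `τ' ≥ τ` of a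
diagram `d_{τ'}^q a` occurring in `x`. -/
def Bgt (σ x : Dg) : Set Dg := {y | ∃ τ ∈ sub x, IsR τ ∧ lt σ τ ∧ y ∈ B τ x}

/-! ## Ordinal diagrams -/

/-- The first (largest) summand. -/
def head : Dg → Dg
  | add a _ => a
  | x => x

/-- The system of o.d.'s in which the formation of `d_σ^q a ∈ 𝒟^Q_σ` is restricted by the
condition `C` on `d_σ^q a`. -/
inductive IsOd (C : Dg → Prop) : Dg → Prop
  | zero : IsOd C zero
  | omega : IsOd C omega
  | pi : IsOd C pi
  /-- sums `a_1 + ⋯ + a_n`, `n ≥ 2`, of additive principal `a_1 ≥ ⋯ ≥ a_n` -/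
  | add {a b : Dg} (ha : IsOd C a) (hb : IsOd C b) (hpa : IsPrin a) (hpb : IsPrin (head b))
      (hab : le (head b) a) : IsOd C (add a b)
  /-- Veblen normal forms `φab`, below `π`, or of the form `ω^b` with `b > π` -/
  | phi {a b : Dg} (ha : IsOd C a) (hb : IsOd C b)
      (hpi : (lt a pi ∧ lt b pi) ∨ (a = Dg.zero ∧ lt pi b))
      (hphi : ∀ c d, b = phi c d → ¬ lt a c) (hb' : IsSC b → ¬ lt a b)
      (ha' : IsSC a → b ≠ Dg.zero) : IsOd C (phi a b)
  /-- `κ^{+k}`, `κ ∈ 𝒟^Q`, `k > 0`, by iteration -/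
  | next {a : Dg} (ha : IsOd C a) (h : IsDQ a ∨ ∃ b, a = next b) : IsOd C (next a)
  /-- `d_σ a` for `σ ∈ {Ω} ∪ {κ^{+k}}` -/
  | col {σ a : Dg} (hσ : IsOd C σ) (ha : IsOd C a) (hs : IsSR σ)
      (hB : ∀ x, x ∈ Bgt σ σ ∨ x ∈ Bgt σ a → lt x a) : IsOd C (col σ a nil)
  /-- `d_σ^q a` for `σ ∈ {π} ∪ 𝒟^Q` and a nonempty sequence `q` -/
  | colQ {σ a q : Dg} (hσ : IsOd C σ) (ha : IsOd C a) (hq : IsSeq q) (hne : q ≠ nil)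
      (hqx : ∀ x, InQ x q → IsOd C x) (hs : σ = Dg.pi ∨ IsDQ σ)
      (hB : ∀ x, x ∈ Bgt σ σ ∨ x ∈ Bgt σ a ∨ x ∈ Bgt σ q → lt x a)
      (hC : C (col σ a q)) : IsOd C (col σ a q)

/-! ## The data `pd_i`, `In`, `st_i`, `rg_i` of a diagram in `𝒟^Q` -/

/-- `pd_i(ρ) = τ_m` for the least `m` with `i ≤ j_m`. -/
def pd (i : ℕ) : Dg → Option Dg
  | col _ _ q => pd i q
  | cons j _ t _ q => if i ≤ j then some t else pd i q
  | _ => none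

/-- `In(ρ) = {j_m : m ≤ l}`. -/
def In : Dg → Set ℕ
  | col _ _ q => In q
  | cons j _ _ _ q => {j} ∪ In q
  | _ => ∅

/-- The pair `in_i(ρ) = (st_i(ρ), rg_i(ρ))`: it is `(ν_m, κ_m)` if `i = j_m`, and `in_i(pd_i(ρ))`
if `i ∉ In(ρ)`; `none` stands for undefined. -/
def inn (i : ℕ) : Dg → Option (Dg × Dg)
  | col _ _ q => inn i q
  | cons j k t n q => if i = j then some (n, k) else if i < j then inn i t else inn i q
  | _ => none

/-- `st_i(ρ)` -/
def st (i : ℕ) (ρ : Dg) : Option Dg := (inn i ρ).map Prod.fst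

/-- `rg_i(ρ)` -/
def rg (i : ℕ) (ρ : Dg) : Option Dg := (inn i ρ).map Prod.snd

/-- `a ≺_i b`: the transitive closure of `pd_i(a) = b`. -/
def PrecI (i : ℕ) (a b : Dg) : Prop := Relation.TransGen (fun x y => pd i x = some y) a b

/-- `a ≼_i b` -/
def PrecEqI (i : ℕ) (a b : Dg) : Prop := Relation.ReflTransGen (fun x y => pd i x = some y) a b

/-- `st_i(a) < st_i(b)`, both being defined. -/
def StLt (i : ℕ) (a b : Dg) : Prop := ∃ x y, st i a = some x ∧ st i b = some y ∧ lt x y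

/-- `ν < κ⁺` for `κ ∈ {π} ∪ 𝒟^Q`, where `π⁺ = ∞`. -/
def LtNext (ν κ : Dg) : Prop := κ = pi ∨ lt ν (next κ)

/-! ## The system `Od(M_3^2)` -/

/-- `M_3 = {π} ∪ {α ∈ 𝒟^Q : rg_2(α) = π}` (for diagrams of `Od(M_3^2)`). -/
def InM3 (α : Dg) : Prop := α = pi ∨ (IsDQ α ∧ rg 2 α = some pi)

/-- The restriction on `ρ = d_σ^q a` defining `Od(M_3^2)`: here `q = (2, κ, σ, ν)`, so that
`pd_2(ρ) = σ`, `rg_2(ρ) = κ` and `st_2(ρ) = ν`. -/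
def Cond32 (ρ : Dg) : Prop :=
  ∃ σ a κ ν, ρ = col σ a (cons 2 κ σ ν nil) ∧
    PrecEq σ κ ∧ InM3 κ ∧ (σ = pi → le ν a) ∧ LtNext ν κ ∧
    (κ = pi → ∀ η, InM3 η → lt η pi → Prec ρ η → StLt 2 ρ η) ∧
    (κ ≠ pi → (∀ κ', lt κ' pi → Prec ρ κ' → InM3 κ' → le κ κ') ∧
      ∀ τ, Prec ρ τ → Prec τ κ → StLt 2 ρ τ) ∧
    ∀ τ, le τ κ → ∀ x ∈ K τ ν, lt x ρ

/-- The set `Od(M_3^2)`. -/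
def Od32 : Set Dg := {α | IsOd Cond32 α}

/-! ## The system `Od(Π_N)` -/

/-- The conditions on the sequence `q` in `d_σ^q a`. -/
def CondSeq (N : ℕ) (σ a q : Dg) : Prop :=
  (∀ e ∈ quads q, 2 ≤ e.1) ∧
  (quads q).Pairwise (fun e f => e.1 < f.1) ∧
  (∀ e ∈ quads q, PrecEq σ e.2.1 ∧ PrecEq σ e.2.2.1 ∧ (e.2.2.1 = pi ∨ IsDQ e.2.2.1) ∧
    (e.1 < N - 1 → LtNext e.2.2.2 e.2.1)) ∧
  (∃ e, (quads q).head? = some e ∧ e.2.2.1 = σ) ∧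
  (∃ e, (quads q).getLast? = some e ∧ e.1 = N - 1 ∧ e.2.1 = pi ∧
    (σ = pi → le e.2.2.2 a) ∧ (e.2.2.1 = pi → σ = pi))

/-- `x` is `min {x : rg_i(x) = κ ∧ p ≺_i x ≺_i κ}`. -/
def IsSigmaOne (i : ℕ) (p κ x : Dg) : Prop :=
  (rg i x = some κ ∧ PrecI i p x ∧ PrecI i x κ) ∧
  ∀ y, rg i y = some κ → PrecI i p y → PrecI i y κ → le x y

/-- The conditions (D.11), (D.12) and (D.2) on `ρ` for `i ∈ In(ρ)`, where `p = pd_i(ρ)`,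
`κ = rg_i(ρ)` and `ν = st_i(ρ)`. -/
def CondIn (N i : ℕ) (ρ p κ ν : Dg) : Prop :=
  (i < N - 1 → ∃ p', pd (i + 1) ρ = some p' ∧ inn i κ = inn i p' ∧ PrecEqI i κ p' ∧ p ≠ p') ∧
  PrecEqI i p κ ∧
  ((κ = p ∧ ∃ α₁, PrecEq ρ α₁ ∧ DMem α₁ κ ∧ ∀ x ∈ Bgt κ ν, lt x (bOf α₁)) ∨
   (rg i p = some κ ∧ StLt i ρ p) ∨
   (∃ κ', rg i p = some κ' ∧ PrecI i κ' κ ∧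
     (∀ τ, PrecEqI i κ' τ → PrecI i τ κ → ∃ κ'', rg i τ = some κ'' ∧ PrecEqI i κ'' κ) ∧
     ∃ σ₁, IsSigmaOne i p κ σ₁ ∧ StLt i ρ σ₁)) ∧
  ∀ τ, le τ κ → ∀ x ∈ K τ ν, lt x ρ

/-- The restriction on `ρ = d_σ^q a` defining `Od(Π_N)`. -/
def CondN (N : ℕ) (ρ : Dg) : Prop :=
  ∃ σ a q, ρ = col σ a q ∧ CondSeq N σ a q ∧
    ∀ i ∈ In ρ, ∃ p κ ν, pd i ρ = some p ∧ rg i ρ = some κ ∧ st i ρ = some ν ∧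
      CondIn N i ρ p κ ν

/-- The set `Od(Π_N)`. -/
def OdN (N : ℕ) : Set Dg := {α | IsOd (CondN N) α}

/-! ## Closures, `𝒢(X)`, and iteration of operators -/

/-- `𝒞^α(X)` in the subsystem `S`: the closure of `{0, Ω, π} ∪ {x ∈ X : x < α}` under `+`, `φ`,
`κ ↦ κ⁺`, and `(σ, a, q) ↦ d_σ^q a` for `σ > α`. -/
inductive Cl (S : Set Dg) (α : Dg) (X : Set Dg) : Dg → Prop
  | zero : Cl S α X zero
  | omega : Cl S α X omega
  | pi : Cl S α X pi
  | base {x : Dg} (hx : x ∈ X) (hlt : lt x α) : Cl S α X x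
  | add {a b : Dg} (ha : Cl S α X a) (hb : Cl S α X b) (h : add a b ∈ S) : Cl S α X (add a b)
  | phi {a b : Dg} (ha : Cl S α X a) (hb : Cl S α X b) (h : phi a b ∈ S) : Cl S α X (phi a b)
  | next {a : Dg} (ha : Cl S α X a) (h : next a ∈ S) : Cl S α X (next a)
  | col {σ a q : Dg} (hσ : Cl S α X σ) (ha : Cl S α X a) (hq : ∀ x, InQ x q → Cl S α X x)
      (hlt : lt α σ) (h : col σ a q ∈ S) : Cl S α X (col σ a q)

/-- `𝒢(X) = {α : α ∈ 𝒞^α(X) and every element of 𝒞^α(X) below α is in X}`. -/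
def G (S X : Set Dg) : Set Dg :=
  {α | α ∈ S ∧ Cl S α X α ∧ ∀ x, Cl S α X x → lt x α → x ∈ X}

/-- `x ≤ (X|α)`: some element of `X` below `α` is `≥ x`. -/
def LeBelow (X : Set Dg) (α x : Dg) : Prop := ∃ δ ∈ X, lt δ α ∧ le x δ

/-- `Γ^x = ⋃ {Γ(Γ^y) : y < x}` -/
noncomputable def stage (Γ : Set Dg → Set Dg) (x : Ordinal.{0}) : Set Dg :=
  {α | ∃ (y : Ordinal.{0}) (_ : y < x), α ∈ Γ (stage Γ y)}
termination_by x

/-- `𝒲 = ⋃ {Γ^x : x ∈ Ord}` -/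
def W (Γ : Set Dg → Set Dg) : Set Dg := {α | ∃ x, α ∈ stage Γ x}

/-- `|α|_Γ`, the least ordinal `x` with `α ∈ Γ^{x+1}`. -/
noncomputable def norm (Γ : Set Dg → Set Dg) (α : Dg) : Ordinal.{0} :=
  sInf {x | α ∈ stage Γ (x + 1)}

/-! ## The operator `Γ_32` on `Od(M_3^2)` -/

/-- `α ◁ β :⇔ α, β ∈ 𝒟^Q and α ≺ β ≺ rg_2(α)` -/
def Lhd32 (α β : Dg) : Prop :=
  IsDQ α ∧ IsDQ β ∧ Prec α β ∧ ∃ κ, rg 2 α = some κ ∧ Prec β κ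

def V32 (X : Set Dg) : Set Dg := {α | ∀ γ, Lhd32 γ α → γ ∈ G Od32 X → γ ∈ X}

def Gamma30 (X : Set Dg) : Set Dg :=
  {α | lt α pi ∧ ¬ InM3 α ∧ α ∈ G Od32 X ∧ α ∈ V32 X ∧
    (IsSR α → ∀ γ, DMem γ α → γ ∈ G Od32 X → γ ∈ X)}

def Gamma32 (X : Set Dg) : Set Dg :=
  {α | α ∈ Gamma30 X ∨
    (Gamma30 X ⊆ X ∧ InM3 α ∧ lt α pi ∧ α ∈ G Od32 X ∧ α ∈ V32 X)}

/-! ## Resolution of diagrams in `Od(Π_N)` -/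

/-- `η_π`: the diagram with `η ≼ η_π ∈ 𝒟_π`. -/
noncomputable def top : Dg → Dg
  | col s a q => open Classical in if s = pi then col s a q else top s
  | x => x

/-- The minimal diagram `δ` with `η ≼_i δ` and `i ∈ In(δ)`, if there is one (the search follows
`η, pd_i(η), pd_i(pd_i(η)), …`). -/
noncomputable def firstIn (i : ℕ) : Dg → Option Dg
  | col s a q => open Classical in if i ∈ In q then some (col s a q) else firstIn i q
  | cons j _ t _ q => if i ≤ j then firstIn i t else firstIn i q
  | _ => none

/-- `η_i^0` -/
noncomputable def res0 (i : ℕ) (η : Dg) : Dg := (firstIn i η).getD (top η)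

/-- The sequence `η_i^n`, `n < lh_i(η)`; the value is `none` for `n ≥ lh_i(η)`. -/
noncomputable def res (i : ℕ) (η : Dg) : ℕ → Option Dg
  | 0 => some (res0 i η)
  | n + 1 =>
      match res i η n with
      | none => none
      | some δ => open Classical in
          if i ∈ In δ then some (((rg i δ).bind (firstIn i)).getD (top η)) else none

/-- `α ◁_i β :⇔ α, β ∈ 𝒟^Q, i ∈ In(α) and α ≺_i β ≺_i rg_i(α)` -/
def LhdI (i : ℕ) (α β : Dg) : Prop :=
  IsDQ α ∧ IsDQ β ∧ i ∈ In α ∧ PrecI i α β ∧ ∃ κ, rg i α = some κ ∧ PrecI i β κ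

/-- `γ ≺_i^p α :⇔ γ ≺_i α and there is no n < lh_i(γ) with γ_i^n ◁_i α` -/
def PrecP (i : ℕ) (γ α : Dg) : Prop :=
  PrecI i γ α ∧ ¬ ∃ n δ, res i γ n = some δ ∧ LhdI i δ α

/-- `γ ≼_i^p α` -/
def PrecPEq (i : ℕ) (γ α : Dg) : Prop := PrecP i γ α ∨ γ = α

open Classical in
/-- The least element of a set of diagrams (`0` if there is none). -/
noncomputable def leastOf (A : Set Dg) : Dg :=
  if h : ∃ x ∈ A, ∀ y ∈ A, le x y then h.choose else zero

open Classical in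
/-- The greatest element of a set of diagrams (`0` if there is none). -/
noncomputable def greatestOf (A : Set Dg) : Dg :=
  if h : ∃ x ∈ A, ∀ y ∈ A, le y x then h.choose else zero

/-! ## The decompositions `α(s)`

A function `s : [i, k) → {0, 1}` is given by `d(s) = i` and the list `w` of its values
`s(i), s(i+1), …, s(k-1)`; thus `ℓ(s) = i + w.length`. -/

open Classical in
/-- `α(s)` for the unitary `s : [c, p+1) → 2` with `s(p) = 1` (and `s(i) = 0` for `c ≤ i < p`).
It is the greatest `δ` with `α_p^0 ≼_{p+1}^p δ < α'(s)`, where `α'` is the least of the `α_i^0`,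
`c ≤ i < p`, and of `α_p^1`; or `α_π` if the displayed condition fails.  The test on `size` always succeeds; it only makes the recursion visibly well-founded.  If
`lh_p(α) = 1`, that is, if `α_p^1` does not exist, the value is `α_π`. -/
noncomputable def block (c p : ℕ) (α : Dg) : Dg :=
  if (∀ i, c ≤ i → i < p →
      lt (res0 p α) (res0 i α) ∧ ∃ κ, rg p α = some κ ∧ le κ (res0 i α)) then
    match res p α 1 with
    | none => top α
    | some α₁ =>
      if _h : size (leastOf {δ | (∃ i, c ≤ i ∧ i < p ∧ δ = res0 i α) ∨ δ = α₁}) < size α then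
        greatestOf {δ | PrecPEq (p + 1) (res0 p α) δ ∧
          lt δ (block c p (leastOf {δ | (∃ i, c ≤ i ∧ i < p ∧ δ = res0 i α) ∨ δ = α₁}))}
      else top α
  else top α
termination_by size α

/-- Evaluation along the unitary decomposition: `c` is the starting point of the current unitary
component, `p` the current position.  A last component consisting of zeros acts as the identity. -/
noncomputable def evFrom (c p : ℕ) : List Bool → Dg → Dg
  | [], α => α
  | false :: w, α => evFrom c (p + 1) w α
  | true :: w, α => evFrom (p + 1) (p + 1) w (block c p α)

/-- `α(s)` for `s = (i, w)`. -/
noncomputable def ev (i : ℕ) (w : List Bool) (α : Dg) : Dg := evFrom i i w α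

open Classical in
/-- The first `n` values of `s[k; α, β]`. -/
noncomputable def branch (k : ℕ) (α β : Dg) : ℕ → List Bool
  | 0 => []
  | n + 1 =>
      branch k α β n ++
        [decide (∃ γ, PrecEqI (k + n) (ev k (branch k α β n) α) γ ∧
          PrecI (k + n) γ (ev k (branch k α β n) β) ∧ k + n ∈ In γ)]

/-- `s ⊆ s[α, β]` -/
def SubBranch (i : ℕ) (w : List Bool) (α β : Dg) : Prop := w = branch i α β w.length

/-- `α ≺_s β` -/
def PrecS (i : ℕ) (w : List Bool) (α β : Dg) : Prop :=
  IsDQ α ∧ IsDQ β ∧ SubBranch i w α β ∧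
    ∀ n ≤ w.length, PrecP (i + n) (ev i (w.take n) α) (ev i (w.take n) β)

/-- `α ◁_s β` -/
def LhdS (i : ℕ) (w : List Bool) (α β : Dg) : Prop :=
  IsDQ α ∧ IsDQ β ∧ SubBranch i w α β ∧ (w ≠ [] → PrecS i w.dropLast α β) ∧
    LhdI (i + w.length) (ev i w α) (ev i w β)

/-- `s = (i, w) ∈ I_N`, i.e. `2 ≤ d(s) ≤ ℓ(s) ≤ N - 2`. -/
def InI (N i : ℕ) (w : List Bool) : Prop := 2 ≤ i ∧ i + w.length ≤ N - 2

/-- `α ◁_s^+ β` -/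
def LhdSPlus (N i : ℕ) (w : List Bool) (α β : Dg) : Prop :=
  LhdS i w α β ∧
  ∀ n, w[n]? = some true → i + n ∉ In (ev i (w.take n) α) →
    ∃ (L : ℕ) (a : ℕ → Dg) (v : ℕ → List Bool),
      a L = ev i (w.take n) α ∧ a 0 = res0 (i + n) (a L) ∧
      ∀ k < L, InI N (i + n) (v k) ∧ LhdS (i + n) (v k) (a (k + 1)) (a k)

/-! ## The operator `Γ_N` on `Od(Π_N)` -/

/-- `𝒢_{<i}(X)`, where `𝒢_1 = 𝒢` and, for `i ≥ 2`, `𝒢_i(X)` consists of those `α` such that for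
all `s ∈ I_N` with `d(s) = 2` and `2 + #s = i`, each `γ ◁_s^+ α` in `𝒢_{<i}(X)` is `≤ X|α`. -/
def GLt (N : ℕ) (X : Set Dg) : ℕ → Set Dg
  | 0 => OdN N
  | 1 => OdN N
  | 2 => G (OdN N) X
  | i + 3 => GLt N X (i + 2) ∩
      {α | ∀ w : List Bool, InI N 2 w → 2 + w.count true = i + 2 →
        ∀ γ, LhdSPlus N 2 w γ α → γ ∈ GLt N X (i + 2) → LeBelow X α γ}

def GammaN (N : ℕ) (X : Set Dg) : Set Dg :=
  {α | lt α pi ∧ α ∈ GLt N X (N - 1) ∧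
    (IsSR α → ∀ γ, DMem γ α → γ ∈ G (OdN N) X → γ ∈ X) ∧
    ∀ γ ∈ GLt N X (N - 1), PrecS 2 (branch 2 γ α (N - 4)) γ α → LeBelow X α γ}

end Dg

namespace Dg

/-! ## Unfolding the ordering -/

/-! Everything is reduced to one situation: X ⊆ Z, α ∈ Γ(X), γ ∈ Γ(Z), γ < α, the elements of Z
below α are in X, and all of X lies below γ. If this always forces γ ∈ X (so that it is in fact
contradictory), a double induction on stages (`mem_stage_of_lt`) shows that a diagram below some α ∈
Γ(Γ^x) which enters at the same or a later stage was already in Γ^x. Strict monotonicity of the norm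
follows (`norm_lt_norm`).

Membership in 𝒢(X) depends only on the part of X below the diagram (`mem_G_congr`), so γ and α both
lie in 𝒢(X). Since γ ∉ X, γ is not in 𝒞^α(X), although it is in 𝒞^γ(X). What is lost between the two
closures is collapsing d_σ with γ < σ ≤ α, and following the construction of γ to the place where it
breaks down gives γ ≺ α (`prec_of_mem_G`). Each operator then has to exclude γ ≺ α. For α ∈ SR this
is the clause about 𝒟_α; otherwise γ and α are in 𝒟^Q.

For Γ_32 put κ = rg_2(γ). If α ≺ κ, then γ ◁ α and V(X) applies to γ. If κ ≼ α, then γ ∉ M_3; either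
α ∈ M_3, and γ ∈ Γ_30(X) ⊆ X, or κ ◁ α, and V(X) puts κ into X although κ > γ
(`mem_of_mem_Gamma32`).

For Γ_N, call y covered from A at i if z ◁_i y for some z with A ≼_i z. By `DN.precP_iff`, ≺_i^p is
≺_i without covering. Walking through i = 2, …, N-2, the pair γ, α is kept when no i ∈ In occurs in
between, and otherwise replaced by its blocks. Blocks are constant on idle segments (`DN.block_eq`),
strictly monotone where i occurs and nothing covers (`DN.block_prec`), and every uncovered element
between two blocks is a block (`DN.block_surj`). So the walk yields γ ≺_s α for s = s[2;γ,α] as long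
as α(s) is never covered from γ(s), and then the last clause of Γ_N gives γ ≤ X|α, a contradiction.

Uncoveredness (`unc_of_mem_GLt`) goes by induction on #s. A covering resolvent of γ(s) is pulled
back to some η with γ ≼ η and η ◁_s^+ α (`exists_pullback`). If η has the required 𝒢-levels, the
level 2 + #s of α bounds η by X, which is impossible. If not, some ξ ◁_w^+ η with #w < #s witnesses
the failure, and `descend` gives either a y ≺ η with the same value along s, so that the argument
repeats, or ξ ◁_w^+ γ, against the level 2 + #w of γ.

All this presupposes that < is a linear order on well-formed diagrams. Totality is an induction on
size (`total_aux`); asymmetry and transitivity are proved together by induction on a measure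
(`lin`), and rest on the fact that coefficients of y stay below whatever y is below (`Lin.hid_lt`).
-/

theorem zero_lt {y : Dg} : lt zero y ↔ y ≠ zero := by
  rw [lt_iff_step]; rfl

theorem not_lt_zero {x : Dg} : ¬ lt x zero := by
  rw [lt_iff_step]; cases x <;> simp [Step]

theorem add_lt_add {a b c d : Dg} : lt (add a b) (add c d) ↔ lt a c ∨ (a = c ∧ lt b d) := by
  rw [lt_iff_step]; rfl

theorem add_lt_prin {a b y : Dg} (hy : IsPrin y) : lt (add a b) y ↔ lt a y := by
  rw [lt_iff_step]; cases y <;> simp_all [Step, IsPrin, IsSC]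

theorem prin_lt_add {x c d : Dg} (hx : IsPrin x) : lt x (add c d) ↔ le x c := by
  rw [lt_iff_step]; cases x <;> simp_all [Step, IsPrin, IsSC, le]

theorem phi_lt_phi {a b c d : Dg} : lt (phi a b) (phi c d) ↔
    (lt a c ∧ lt b (phi c d)) ∨ (a = c ∧ lt b d) ∨ (lt c a ∧ lt (phi a b) d) := by
  rw [lt_iff_step]; rfl

theorem phi_lt_sc {a b y : Dg} (hy : IsSC y) : lt (phi a b) y ↔ lt a y ∧ lt b y := by
  rw [lt_iff_step]; cases y <;> simp_all [Step, IsSC]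

theorem sc_lt_phi {x c d : Dg} (hx : IsSC x) : lt x (phi c d) ↔ le x c ∨ le x d := by
  rw [lt_iff_step]; cases x <;> simp_all [Step, IsSC, le]

theorem not_pi_lt_sc {y : Dg} (hy : IsSC y) : ¬ lt pi y := by
  rw [lt_iff_step]; cases y <;> simp_all [Step, IsSC]

theorem sc_lt_pi {x : Dg} (hx : IsSC x) : lt x pi ↔ x ≠ pi := by
  rw [lt_iff_step]; cases x <;> simp_all [Step, IsSC]

theorem not_omega_lt_omega : ¬ lt omega omega := by
  rw [lt_iff_step]; simp [Step]

theorem omega_lt_next {a : Dg} : lt omega (next a) := by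
  rw [lt_iff_step]; simp [Step]

theorem omega_lt_col {τ b p : Dg} : lt omega (col τ b p) ↔ τ ≠ omega := by
  rw [lt_iff_step]; rfl

theorem not_next_lt_omega {a : Dg} : ¬ lt (next a) omega := by
  rw [lt_iff_step]; simp [Step]

theorem col_lt_omega {τ b p : Dg} : lt (col τ b p) omega ↔ τ = omega := by
  rw [lt_iff_step]; rfl

theorem next_lt_next {a b : Dg} : lt (next a) (next b) ↔ lt a b := by
  rw [lt_iff_step]; rfl

theorem next_lt_col {a τ b p : Dg} :
    lt (next a) (col τ b p) ↔ lt (next a) τ ∧ lt a (col τ b p) := by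
  rw [lt_iff_step]; rfl

theorem col_lt_next {σ a q b : Dg} :
    lt (col σ a q) (next b) ↔ le σ (next b) ∨ le (col σ a q) b := by
  rw [lt_iff_step]; rfl

theorem col_lt_col {σ a q τ b p : Dg} : lt (col σ a q) (col τ b p) ↔
    (σ = τ ∧
      ((∃ k, (k ∈ K σ b ∨ k ∈ K σ p) ∧ le (col σ a q) k) ∨
       ((∀ k, (k ∈ K σ a ∨ k ∈ K σ q) → lt k (col τ b p)) ∧
        (lt a b ∨ (a = b ∧ SeqLt lt q p))))) ∨
    (lt σ τ ∧
      (le σ (col τ b p) ∨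
       (∃ k, (k ∈ K σ τ ∨ k ∈ K σ b ∨ k ∈ K σ p) ∧ le (col σ a q) k))) ∨
    (lt τ σ ∧ lt (col σ a q) τ ∧
      (∀ k, (k ∈ K τ σ ∨ k ∈ K τ a ∨ k ∈ K τ q) → lt k (col τ b p))) := by
  rw [lt_iff_step]; rfl

theorem le_refl (x : Dg) : le x x := Or.inr rfl

/-! ## Elementary facts on `≺` and `K` -/

/-- The subscript of `d_σ^q a`. -/
def ix : Dg → Dg
  | col σ _ _ => σ
  | x => x

theorem dMem_col {σ a q b : Dg} : DMem (col σ a q) b ↔ b = σ := by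
  constructor
  · rintro ⟨c, r, h⟩; cases h; rfl
  · rintro rfl; exact ⟨a, q, rfl⟩

theorem prec_col {σ a q b : Dg} : Prec (col σ a q) b ↔ PrecEq σ b := by
  constructor
  · intro h
    obtain ⟨c, h1, h2⟩ := Relation.TransGen.head'_iff.1 h
    rw [dMem_col] at h1
    subst h1
    exact h2
  · intro h
    exact Relation.TransGen.head'_iff.2 ⟨σ, dMem_col.2 rfl, h⟩

theorem precEq_iff {a b : Dg} : PrecEq a b ↔ a = b ∨ Prec a b := by
  rw [PrecEq, Relation.reflTransGen_iff_eq_or_transGen]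
  simp only [Prec, eq_comm]

theorem Prec.exists_col {a b : Dg} (h : Prec a b) : ∃ σ c q, a = col σ c q ∧ PrecEq σ b := by
  obtain ⟨c, ⟨d, q, rfl⟩, h2⟩ := Relation.TransGen.head'_iff.1 h
  exact ⟨c, d, q, rfl, h2⟩

theorem DMem.size_lt {a b : Dg} (h : DMem a b) : size b < size a := by
  obtain ⟨c, q, rfl⟩ := h
  simp only [size]; omega

theorem Prec.size_lt {a b : Dg} (h : Prec a b) : size b < size a := by
  induction h with
  | single h => exact h.size_lt
  | tail _ h ih => have := h.size_lt; omega

theorem PrecEq.size_le {a b : Dg} (h : PrecEq a b) : size b ≤ size a := by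
  rcases precEq_iff.1 h with rfl | h
  · exact le_rfl
  · exact h.size_lt.le

theorem Prec.toEq {a b : Dg} (h : Prec a b) : PrecEq a b := Relation.TransGen.to_reflTransGen h

/-- `K_σ` of the set of components of `d_τ^q b`. -/
def Kc (σ : Dg) : Dg → Set Dg
  | col τ b p => K σ τ ∪ (K σ b ∪ K σ p)
  | _ => ∅

theorem mem_Kc {σ τ b p k : Dg} : k ∈ Kc σ (col τ b p) ↔ k ∈ K σ τ ∨ k ∈ K σ b ∨ k ∈ K σ p :=
  Iff.rfl

theorem mem_K_col {σ τ b p k : Dg} : k ∈ K σ (col τ b p) ↔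
    (lt σ τ ∧ k ∈ Kc σ (col τ b p)) ∨ (lt τ σ ∧ ¬ PrecEq τ σ ∧ k ∈ K σ τ) ∨
      (PrecEq τ σ ∧ k = col τ b p) := by
  have e : k ∈ K σ (col τ b p) ↔ (lt σ τ ∧ k ∈ Kc σ (col τ b p)) ∨
      (lt τ σ ∧ ¬ PrecEq τ σ ∧ k ∈ K σ τ) ∨ (Prec (col τ b p) σ ∧ k = col τ b p) := Iff.rfl
  rw [e, prec_col]

/-- Only the third clause for `K_σ` produces elements, and it demands ≺ σ; the others merely pass
coefficients on. -/
theorem prec_of_mem_K {σ k x : Dg} (h : k ∈ K σ x) : Prec k σ := by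
  induction x with
  | col τ a q h1 h2 h3 =>
    rcases mem_K_col.1 h with ⟨_, h⟩ | ⟨_, _, h⟩ | ⟨h', rfl⟩
    · rcases h with h | h | h
      exacts [h1 h, h2 h, h3 h]
    · exact h1 h
    · exact prec_col.2 h'
  | add a b h1 h2 => exact h.elim h1 h2
  | phi a b h1 h2 => exact h.elim h1 h2
  | next a h1 => exact h1 h
  | cons j k t n q h1 h2 h3 h4 =>
    rcases h with ((h | h) | h) | h
    exacts [h1 h, h2 h, h3 h, h4 h]
  | _ => exact h.elim

theorem size_of_mem_K {σ k x : Dg} (h : k ∈ K σ x) : size k ≤ size x := size_of_mem_KWith h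

theorem size_lt_of_mem_Kc {σ k x : Dg} (h : k ∈ Kc σ x) : size k < size x := by
  cases x with
  | col τ b p =>
    rcases h with h | h | h <;> have := size_of_mem_K h <;> simp only [size] <;> omega
  | _ => exact h.elim

/-- Since k ≺ σ, a coefficient k is strictly larger than σ in size, and it is no larger than x. In
particular K_σ σ is empty. -/
theorem not_mem_K_of_size {σ k x : Dg} (hs : size x ≤ size σ) : k ∉ K σ x := fun h => by
  have h1 := (prec_of_mem_K h).size_lt
  have h2 := size_of_mem_K h
  omega

theorem prec_of_mem_Kc {σ k x : Dg} (h : k ∈ Kc σ x) : Prec k σ := by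
  cases x with
  | col τ b p => rcases h with h | h | h <;> exact prec_of_mem_K h
  | _ => exact h.elim

theorem inQ_cons {x : Dg} {j : ℕ} {k t n q : Dg} :
    InQ x (cons j k t n q) ↔ x = k ∨ x = t ∨ x = n ∨ InQ x q := by
  simp only [InQ, quads, List.mem_cons, exists_eq_or_imp, or_assoc]

theorem not_inQ_nil {x : Dg} : ¬ InQ x nil := by simp [InQ, quads]

theorem mem_K_seq {σ k q : Dg} (hq : IsSeq q) : k ∈ K σ q ↔ ∃ x, InQ x q ∧ k ∈ K σ x := by
  induction q with
  | nil => exact ⟨fun h => h.elim, fun ⟨x, h, _⟩ => (not_inQ_nil h).elim⟩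
  | cons j a t n q _ _ _ h4 =>
    have e : k ∈ K σ (cons j a t n q) ↔ ((k ∈ K σ a ∨ k ∈ K σ t) ∨ k ∈ K σ n) ∨ k ∈ K σ q := Iff.rfl
    rw [e, h4 hq]
    simp only [inQ_cons]
    constructor
    · rintro (((h | h) | h) | ⟨x, h, h'⟩)
      exacts [⟨_, Or.inl rfl, h⟩, ⟨_, Or.inr (Or.inl rfl), h⟩,
        ⟨_, Or.inr (Or.inr (Or.inl rfl)), h⟩, ⟨_, Or.inr (Or.inr (Or.inr h)), h'⟩]
    · rintro ⟨x, rfl | rfl | rfl | h, h'⟩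
      exacts [Or.inl (Or.inl (Or.inl h')), Or.inl (Or.inl (Or.inr h')), Or.inl (Or.inr h'),
        Or.inr ⟨x, h, h'⟩]
  | _ => exact hq.elim

theorem InQ.size_lt {x q : Dg} (h : InQ x q) : size x < size q := by
  induction q with
  | cons j a t n q _ _ _ h4 =>
    rcases inQ_cons.1 h with rfl | rfl | rfl | h
    · simp only [size]; omega
    · simp only [size]; omega
    · simp only [size]; omega
    · have := h4 h; simp only [size]; omega
  | _ => simp [InQ, quads] at h

/-! ## Well-formed diagrams -/

/-- Ordinal diagrams without a restriction on the formation of `d_σ^q a ∈ 𝒟^Q`. -/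
abbrev WF : Dg → Prop := IsOd (fun _ => True)

/-- The order theory never uses the restriction C, so it is developed once for `WF` and transferred
to both systems. -/
theorem IsOd.wf {C : Dg → Prop} {x : Dg} (h : IsOd C x) : WF x := by
  induction h with
  | zero => exact .zero
  | omega => exact .omega
  | pi => exact .pi
  | add _ _ hpa hpb hab iha ihb => exact .add iha ihb hpa hpb hab
  | phi _ _ h1 h2 h3 h4 iha ihb => exact .phi iha ihb h1 h2 h3 h4
  | next _ h ih => exact .next ih h
  | col _ _ hs hB ih1 ih2 => exact .col ih1 ih2 hs hB
  | colQ _ _ hq hne _ hs hB _ ih1 ih2 ih3 => exact .colQ ih1 ih2 hq hne ih3 hs hB trivial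

/-- The components of `d_τ^q b`. -/
def Comp (t : Dg) : Dg → Prop
  | col τ b q => t = τ ∨ t = b ∨ InQ t q
  | _ => False

theorem comp_col {t τ b q : Dg} : Comp t (col τ b q) ↔ t = τ ∨ t = b ∨ InQ t q := Iff.rfl

theorem Comp.size_lt {t x : Dg} (h : Comp t x) : size t < size x := by
  cases x with
  | col τ b q =>
    rcases h with rfl | rfl | h
    · simp only [size]; omega
    · simp only [size]; omega
    · have := h.size_lt; simp only [size]; omega
  | _ => exact h.elim

theorem IsOd.isSeq {C : Dg → Prop} {σ a q : Dg} (h : IsOd C (Dg.col σ a q)) : IsSeq q := by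
  cases h with
  | col => trivial
  | colQ _ _ hq => exact hq

theorem IsOd.comp {C : Dg → Prop} {t x : Dg} (h : IsOd C x) (ht : Comp t x) : IsOd C t := by
  cases h with
  | col h1 h2 =>
    rcases ht with rfl | rfl | h
    exacts [h1, h2, (not_inQ_nil h).elim]
  | colQ h1 h2 _ _ h3 =>
    rcases ht with rfl | rfl | h
    exacts [h1, h2, h3 _ h]
  | _ => exact ht.elim

theorem IsOd.ixOd {C : Dg → Prop} {σ a q : Dg} (h : IsOd C (Dg.col σ a q)) : IsOd C σ :=
  h.comp (Or.inl rfl)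

theorem IsOd.sc_ix {C : Dg → Prop} {σ a q : Dg} (h : IsOd C (Dg.col σ a q)) : IsSC σ := by
  cases h with
  | col _ _ hs => cases σ <;> simp_all [IsSR, IsSC]
  | colQ _ _ _ _ _ hs => cases σ <;> simp_all [IsDQ, IsSC]

/-- Elements of `𝒟_Ω` are not subscripts. -/
theorem IsOd.ix_ix {C : Dg → Prop} {σ a q τ b p : Dg}
    (h : IsOd C (Dg.col (Dg.col σ a q) b p)) (_ : τ = σ) : σ ≠ Dg.omega ∧ ¬ IsSR σ := by
  cases h with
  | col _ _ hs => exact hs.elim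
  | colQ h1 _ _ _ _ hs =>
    have : IsDQ (Dg.col σ a q) := by simpa using hs
    cases h1 with
    | col => exact this.elim
    | colQ _ _ _ _ _ hs => cases σ <;> simp_all [IsDQ, IsSR]

theorem IsOd.add_left {C : Dg → Prop} {a b : Dg} (h : IsOd C (Dg.add a b)) : IsOd C a := by
  cases h; assumption

theorem IsOd.add_right {C : Dg → Prop} {a b : Dg} (h : IsOd C (Dg.add a b)) : IsOd C b := by
  cases h; assumption

theorem IsOd.phi_left {C : Dg → Prop} {a b : Dg} (h : IsOd C (Dg.phi a b)) : IsOd C a := by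
  cases h; assumption

theorem IsOd.phi_right {C : Dg → Prop} {a b : Dg} (h : IsOd C (Dg.phi a b)) : IsOd C b := by
  cases h; assumption

theorem IsOd.next_arg {C : Dg → Prop} {a : Dg} (h : IsOd C (Dg.next a)) : IsOd C a := by
  cases h; assumption

theorem IsOd.next_sc {C : Dg → Prop} {a : Dg} (h : IsOd C (Dg.next a)) : IsSC a := by
  cases h with
  | next _ h => rcases h with h | ⟨b, rfl⟩
                · cases a <;> simp_all [IsDQ, IsSC]
                · trivial

theorem mem_Kc_iff {C : Dg → Prop} {σ k x : Dg} (hx : IsOd C x) :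
    k ∈ Kc σ x ↔ ∃ t, Comp t x ∧ k ∈ K σ t := by
  cases x with
  | col τ b q =>
    rw [mem_Kc, mem_K_seq hx.isSeq]
    simp only [comp_col]
    constructor
    · rintro (h | h | ⟨t, ht, h⟩)
      exacts [⟨_, Or.inl rfl, h⟩, ⟨_, Or.inr (Or.inl rfl), h⟩, ⟨t, Or.inr (Or.inr ht), h⟩]
    · rintro ⟨t, rfl | rfl | ht, h⟩
      exacts [Or.inl h, Or.inr (Or.inl h), Or.inr (Or.inr ⟨t, ht, h⟩)]
  | _ => exact ⟨fun h => h.elim, fun ⟨_, h, _⟩ => h.elim⟩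

theorem IsOd.precEq {C : Dg → Prop} {x y : Dg} (hx : IsOd C x) (h : PrecEq x y) : IsOd C y := by
  induction h with
  | refl => exact hx
  | tail _ h ih => obtain ⟨c, q, rfl⟩ := h; exact ih.ixOd

/-- Induction over well-formed diagrams by size, through their immediate components. -/
theorem IsOd.rec' {C : Dg → Prop} {P : Dg → Prop}
    (zero : P Dg.zero) (omega : P Dg.omega) (pi : P Dg.pi)
    (add : ∀ a b, IsOd C (Dg.add a b) → P a → P b → P (Dg.add a b))
    (phi : ∀ a b, IsOd C (Dg.phi a b) → P a → P b → P (Dg.phi a b))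
    (next : ∀ a, IsOd C (Dg.next a) → P a → P (Dg.next a))
    (col : ∀ σ a q, IsOd C (Dg.col σ a q) → (∀ t, Comp t (Dg.col σ a q) → P t) →
      P (Dg.col σ a q)) {x : Dg} (hx : IsOd C x) : P x := by
  induction hx with
  | zero => exact zero
  | omega => exact omega
  | pi => exact pi
  | add h1 h2 h3 h4 h5 i1 i2 => exact add _ _ (.add h1 h2 h3 h4 h5) i1 i2
  | phi h1 h2 h3 h4 h5 h6 i1 i2 => exact phi _ _ (.phi h1 h2 h3 h4 h5 h6) i1 i2
  | next h1 h2 i1 => exact next _ (.next h1 h2) i1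
  | col h1 h2 h3 h4 i1 i2 =>
    refine col _ _ _ (.col h1 h2 h3 h4) ?_
    rintro t (rfl | rfl | h)
    exacts [i1, i2, (not_inQ_nil h).elim]
  | colQ h1 h2 h3 h4 h5 h6 h7 h8 i1 i2 i3 =>
    refine col _ _ _ (.colQ h1 h2 h3 h4 h5 h6 h7 h8) ?_
    rintro t (rfl | rfl | h)
    exacts [i1, i2, i3 _ h]

theorem IsOd.mem_K {C : Dg → Prop} {σ k x : Dg} (hx : IsOd C x) (h : k ∈ K σ x) : IsOd C k := by
  revert h
  refine IsOd.rec' (P := fun x => k ∈ K σ x → IsOd C k) (fun h => h.elim) (fun h => h.elim)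
    (fun h => h.elim) (fun a b _ ha hb h => h.elim ha hb) (fun a b _ ha hb h => h.elim ha hb)
    (fun a _ ha h => ha h) (fun τ b q hc ih h => ?_) hx
  rcases mem_K_col.1 h with ⟨_, h⟩ | ⟨_, _, h⟩ | ⟨_, rfl⟩
  · obtain ⟨t, ht, h⟩ := (mem_Kc_iff hc).1 h
    exact ih t ht h
  · exact ih τ (Or.inl rfl) h
  · exact hc

theorem IsOd.mem_Kc {C : Dg → Prop} {σ k x : Dg} (hx : IsOd C x) (h : k ∈ Kc σ x) : IsOd C k := by
  obtain ⟨t, ht, h⟩ := (mem_Kc_iff hx).1 h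
  exact (hx.comp ht).mem_K h

theorem IsOd.cases4 {C : Dg → Prop} {x : Dg} (hx : IsOd C x) :
    x = Dg.zero ∨ (∃ a b, x = Dg.add a b) ∨ (∃ a b, x = Dg.phi a b) ∨ IsSC x := by
  cases hx <;> simp [IsSC]

theorem IsSC.cases {x : Dg} (hx : IsSC x) :
    x = omega ∨ x = pi ∨ (∃ a, x = next a) ∨ ∃ σ a q, x = col σ a q := by
  cases x <;> simp_all [IsSC]

theorem IsSC.prin {x : Dg} (hx : IsSC x) : IsPrin x := by
  cases x <;> simp_all [IsSC, IsPrin]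

/-! ## Comparability -/

theorem seqLt_total : ∀ {q p : Dg}, IsSeq q → IsSeq p → q ≠ p →
    (∀ x y, InQ x q → InQ y p → x ≠ y → lt x y ∨ lt y x) → SeqLt lt q p ∨ SeqLt lt p q := by
  intro q
  induction q with
  | nil =>
    intro p _ hp hne _
    cases p with
    | nil => exact (hne rfl).elim
    | cons => exact Or.inl trivial
    | _ => exact hp.elim
  | cons j k t n q _ _ _ ih =>
    intro p hq hp hne h
    cases p with
    | nil => exact Or.inr trivial
    | cons j' k' t' n' q' =>
      simp only [SeqLt]
      by_cases e : q = q'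
      · subst e
        have hk := h k k' (inQ_cons.2 (by tauto)) (inQ_cons.2 (by tauto))
        have ht := h t t' (inQ_cons.2 (by tauto)) (inQ_cons.2 (by tauto))
        have hn := h n n' (inQ_cons.2 (by tauto)) (inQ_cons.2 (by tauto))
        rcases lt_trichotomy j j' with hj | hj | hj
        · exact Or.inl (Or.inr ⟨rfl, Or.inl hj⟩)
        · subst hj
          by_cases ek : k = k'
          · by_cases et : t = t'
            · by_cases en : n = n'
              · subst ek; subst et; subst en; exact (hne rfl).elim
              · grind
            · grind
          · grind
        · exact Or.inr (Or.inr ⟨rfl, Or.inl hj⟩)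
      · rcases ih (p := q') hq hp e (fun x y hx hy => h x y (inQ_cons.2 (by tauto)) (inQ_cons.2 (by tauto)))
          with h | h
        · exact Or.inl (Or.inl h)
        · exact Or.inr (Or.inl h)
    | _ => exact hp.elim
  | _ => intro _ hq; exact hq.elim

/-- The clauses are dual: when the conditions for one direction fail, the induction hypothesis
reverses each failed inequality, and the reversed inequalities make up the clause for the other
direction. -/
theorem col_total {σ a q τ b p : Dg} (hx : WF (col σ a q)) (hy : WF (col τ b p))
    (hne : col σ a q ≠ col τ b p)
    (ih : ∀ u v, WF u → WF v → size u + size v < size (col σ a q) + size (col τ b p) → u ≠ v →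
      lt u v ∨ lt v u) : lt (col σ a q) (col τ b p) ∨ lt (col τ b p) (col σ a q) := by
  have key : ∀ {σ a q τ b p : Dg}, WF (col σ a q) → WF (col τ b p) → col σ a q ≠ col τ b p →
      (∀ u v, WF u → WF v → size u + size v < size (col σ a q) + size (col τ b p) → u ≠ v →
      lt u v ∨ lt v u) → lt σ τ → lt (col σ a q) (col τ b p) ∨ lt (col τ b p) (col σ a q) := by
    intro σ a q τ b p hx hy hne ih hst
    by_cases h1 : le σ (col τ b p)
    · exact Or.inl (col_lt_col.2 (Or.inr (Or.inl ⟨hst, Or.inl h1⟩)))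
    by_cases h2 : ∃ k, (k ∈ K σ τ ∨ k ∈ K σ b ∨ k ∈ K σ p) ∧ le (col σ a q) k
    · exact Or.inl (col_lt_col.2 (Or.inr (Or.inl ⟨hst, Or.inr h2⟩)))
    refine Or.inr (col_lt_col.2 (Or.inr (Or.inr ⟨hst, ?_, fun k hk => ?_⟩)))
    · have := ih σ (col τ b p) hx.ixOd hy (by simp only [size]; omega) (fun e => h1 (Or.inr e))
      exact this.resolve_left fun h => h1 (Or.inl h)
    · have hk' : k ∈ Kc σ (col τ b p) := hk
      have hsz := size_lt_of_mem_Kc hk'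
      have := ih (col σ a q) k hx (hy.mem_Kc hk') (by omega) fun e => h2 ⟨k, hk, Or.inr e⟩
      exact this.resolve_left fun h => h2 ⟨k, hk, Or.inl h⟩
  by_cases e : σ = τ
  · subst e
    by_cases h1 : ∃ k, (k ∈ K σ b ∨ k ∈ K σ p) ∧ le (col σ a q) k
    · exact Or.inl (col_lt_col.2 (Or.inl ⟨rfl, Or.inl h1⟩))
    by_cases h2 : ∃ k, (k ∈ K σ a ∨ k ∈ K σ q) ∧ le (col σ b p) k
    · exact Or.inr (col_lt_col.2 (Or.inl ⟨rfl, Or.inl h2⟩))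
    have g1 : ∀ k, (k ∈ K σ b ∨ k ∈ K σ p) → lt k (col σ a q) := by
      intro k hk
      have hk' : k ∈ Kc σ (col σ b p) := Or.inr hk
      have hsz := size_lt_of_mem_Kc hk'
      have := ih (col σ a q) k hx (hy.mem_Kc hk') (by omega) fun e => h1 ⟨k, hk, Or.inr e⟩
      exact this.resolve_left fun h => h1 ⟨k, hk, Or.inl h⟩
    have g2 : ∀ k, (k ∈ K σ a ∨ k ∈ K σ q) → lt k (col σ b p) := by
      intro k hk
      have hk' : k ∈ Kc σ (col σ a q) := Or.inr hk
      have hsz := size_lt_of_mem_Kc hk'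
      have := ih (col σ b p) k hy (hx.mem_Kc hk') (by omega) fun e => h2 ⟨k, hk, Or.inr e⟩
      exact this.resolve_left fun h => h2 ⟨k, hk, Or.inl h⟩
    by_cases e : a = b
    · subst e
      have hqp : q ≠ p := fun h => hne (by rw [h])
      rcases seqLt_total hx.isSeq hy.isSeq hqp (fun u v hu hv huv => ih u v
        (hx.comp (Or.inr (Or.inr hu))) (hy.comp (Or.inr (Or.inr hv))) (by
          have := hu.size_lt; have := hv.size_lt; simp only [size]; omega) huv) with h | h
      · exact Or.inl (col_lt_col.2 (Or.inl ⟨rfl, Or.inr ⟨g2, Or.inr ⟨rfl, h⟩⟩⟩))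
      · exact Or.inr (col_lt_col.2 (Or.inl ⟨rfl, Or.inr ⟨g1, Or.inr ⟨rfl, h⟩⟩⟩))
    · rcases ih a b (hx.comp (Or.inr (Or.inl rfl))) (hy.comp (Or.inr (Or.inl rfl)))
        (by simp only [size]; omega) e with h | h
      · exact Or.inl (col_lt_col.2 (Or.inl ⟨rfl, Or.inr ⟨g2, Or.inl h⟩⟩))
      · exact Or.inr (col_lt_col.2 (Or.inl ⟨rfl, Or.inr ⟨g1, Or.inl h⟩⟩))
  · rcases ih σ τ hx.ixOd hy.ixOd (by simp only [size]; omega) e with h | h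
    · exact key hx hy hne ih h
    · exact (key hy hx hne.symm (fun u v hu hv hs => ih u v hu hv (by omega)) h).symm

theorem sc_total {x y : Dg} (hx : WF x) (hy : WF y) (sx : IsSC x) (sy : IsSC y) (hne : x ≠ y)
    (ih : ∀ u v, WF u → WF v → size u + size v < size x + size y → u ≠ v →
      lt u v ∨ lt v u) : lt x y ∨ lt y x := by
  by_cases hpx : x = pi
  · subst hpx; exact Or.inr ((sc_lt_pi sy).2 hne.symm)
  by_cases hpy : y = pi
  · subst hpy; exact Or.inl ((sc_lt_pi sx).2 hne)
  have nc : ∀ {a σ b q : Dg}, WF (next a) → WF (col σ b q) →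
      (∀ u v, WF u → WF v → size u + size v < size (next a) + size (col σ b q) → u ≠ v →
      lt u v ∨ lt v u) → lt (next a) (col σ b q) ∨ lt (col σ b q) (next a) := by
    intro a σ b q h1 h2 ih
    rw [next_lt_col, col_lt_next]
    by_cases e1 : le σ (next a)
    · exact Or.inr (Or.inl e1)
    by_cases e2 : le (col σ b q) a
    · exact Or.inr (Or.inr e2)
    refine Or.inl ⟨?_, ?_⟩
    · exact (ih (next a) σ h1 h2.ixOd (by simp only [size]; omega)
        fun e => e1 (Or.inr e.symm)).resolve_right fun h => e1 (Or.inl h)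
    · exact (ih a (col σ b q) h1.next_arg h2 (by simp only [size]; omega)
        fun e => e2 (Or.inr e.symm)).resolve_right fun h => e2 (Or.inl h)
  rcases sx.cases with rfl | rfl | ⟨a, rfl⟩ | ⟨σ, a, q, rfl⟩
  · rcases sy.cases with rfl | rfl | ⟨b, rfl⟩ | ⟨τ, b, p, rfl⟩
    · exact (hne rfl).elim
    · exact (hpy rfl).elim
    · exact Or.inl omega_lt_next
    · rw [omega_lt_col, col_lt_omega]; tauto
  · exact (hpx rfl).elim
  · rcases sy.cases with rfl | rfl | ⟨b, rfl⟩ | ⟨τ, b, p, rfl⟩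
    · exact Or.inr omega_lt_next
    · exact (hpy rfl).elim
    · rw [next_lt_next, next_lt_next]
      exact ih a b hx.next_arg hy.next_arg (by simp only [size]; omega) fun e => hne (by rw [e])
    · exact nc hx hy ih
  · rcases sy.cases with rfl | rfl | ⟨b, rfl⟩ | ⟨τ, b, p, rfl⟩
    · rw [omega_lt_col, col_lt_omega]; tauto
    · exact (hpy rfl).elim
    · exact (nc hy hx fun u v hu hv hs => ih u v hu hv (by omega)).symm
    · exact col_total hx hy hne ih

theorem total_aux : ∀ (s : ℕ) (x y : Dg), WF x → WF y → size x + size y < s → x ≠ y →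
    lt x y ∨ lt y x := by
  intro s
  induction s with
  | zero => intro x y _ _ h; omega
  | succ s ih' =>
    intro x y hx hy hs hne
    have ih : ∀ u v, WF u → WF v → size u + size v < size x + size y → u ≠ v →
      lt u v ∨ lt v u := fun u v hu hv h => ih' u v hu hv (by omega)
    clear ih' hs
    have ap : ∀ {a b y : Dg}, WF (add a b) → WF y → IsPrin y →
        (∀ u v, WF u → WF v → size u + size v < size (add a b) + size y → u ≠ v →
          lt u v ∨ lt v u) → lt (add a b) y ∨ lt y (add a b) := by
      intro a b y h1 h2 h3 ih
      rw [add_lt_prin h3, prin_lt_add h3, le]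
      by_cases e : a = y
      · exact Or.inr (Or.inr e.symm)
      · have := ih a y h1.add_left h2 (by simp only [size]; omega) e
        tauto
    have ps : ∀ {a b y : Dg}, WF (phi a b) → WF y → IsSC y →
        (∀ u v, WF u → WF v → size u + size v < size (phi a b) + size y → u ≠ v →
          lt u v ∨ lt v u) → lt (phi a b) y ∨ lt y (phi a b) := by
      intro a b y h1 h2 h3 ih
      rw [phi_lt_sc h3, sc_lt_phi h3, le, le]
      have i1 := ih a y h1.phi_left h2 (by simp only [size]; omega)
      have i2 := ih b y h1.phi_right h2 (by simp only [size]; omega)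
      grind
    rcases hx.cases4 with rfl | ⟨a, b, rfl⟩ | ⟨a, b, rfl⟩ | sx
    · exact Or.inl (zero_lt.2 hne.symm)
    · rcases hy.cases4 with rfl | ⟨c, d, rfl⟩ | ⟨c, d, rfl⟩ | sy
      · exact Or.inr (zero_lt.2 hne)
      · rw [add_lt_add, add_lt_add]
        have i1 := ih a c hx.add_left hy.add_left (by simp only [size]; omega)
        have i2 := ih b d hx.add_right hy.add_right (by simp only [size]; omega)
        grind
      · exact ap hx hy trivial ih
      · exact ap hx hy sy.prin ih
    · rcases hy.cases4 with rfl | ⟨c, d, rfl⟩ | ⟨c, d, rfl⟩ | sy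
      · exact Or.inr (zero_lt.2 hne)
      · exact (ap hy hx trivial fun u v hu hv hs => ih u v hu hv (by omega)).symm
      · rw [phi_lt_phi, phi_lt_phi]
        have i1 := ih a c hx.phi_left hy.phi_left (by simp only [size]; omega)
        have i2 := ih b d hx.phi_right hy.phi_right (by simp only [size]; omega)
        have i3 := ih b (phi c d) hx.phi_right hy (by simp only [size]; omega)
        have i4 := ih d (phi a b) hy.phi_right hx (by simp only [size]; omega)
        -- Normal form is indispensable: for a < c and b = φcd neither φab < φcd nor the converse
        -- would hold.
        have nf1 : ∀ c' d', b = phi c' d' → ¬ lt a c' := by cases hx; assumption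
        have nf2 : ∀ c' d', d = phi c' d' → ¬ lt c c' := by cases hy; assumption
        grind
      · exact ps hx hy sy ih
    · rcases hy.cases4 with rfl | ⟨c, d, rfl⟩ | ⟨c, d, rfl⟩ | sy
      · exact Or.inr (zero_lt.2 (by rintro rfl; exact sx))
      · exact (ap hy hx sx.prin fun u v hu hv hs => ih u v hu hv (by omega)).symm
      · exact (ps hy hx sx fun u v hu hv hs => ih u v hu hv (by omega)).symm
      · exact sc_total hx hy sx sy hne ih

theorem lt_total {x y : Dg} (hx : WF x) (hy : WF y) (hne : x ≠ y) : lt x y ∨ lt y x :=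
  total_aux _ x y hx hy (Nat.lt_succ_self _) hne

theorem le_or_lt {x y : Dg} (hx : WF x) (hy : WF y) : le x y ∨ lt y x := by
  by_cases e : x = y
  · exact Or.inl (Or.inr e)
  · exact (lt_total hx hy e).imp Or.inl id

theorem tri {x y : Dg} (hx : WF x) (hy : WF y) : lt x y ∨ x = y ∨ lt y x := by
  by_cases e : x = y
  · exact Or.inr (Or.inl e)
  · exact (lt_total hx hy e).imp id Or.inr


/-! ### Subscripts and coefficients, with order laws of bounded measure -/

theorem col_lt_pi {σ a q : Dg} : lt (col σ a q) pi :=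
  (sc_lt_pi (x := col σ a q) trivial).2 (by simp)

/-- For a collapsed σ, clause (ii) applies with β = σ: by induction σ is below its own subscript,
and σ ≤ σ. -/
theorem col_lt_ix {σ a q : Dg} (h : WF (col σ a q)) : lt (col σ a q) σ := by
  have : ∀ n (σ a q : Dg), size σ < n → WF (col σ a q) → lt (col σ a q) σ := by
    intro n
    induction n with
    | zero => intro _ _ _ h; omega
    | succ n ih =>
      intro σ a q hn h
      rcases h.sc_ix.cases with rfl | rfl | ⟨b, rfl⟩ | ⟨τ, b, p, rfl⟩
      · exact col_lt_omega.2 rfl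
      · exact col_lt_pi
      · exact col_lt_next.2 (Or.inl (le_refl _))
      · exact col_lt_col.2 (Or.inr (Or.inl ⟨ih τ b p (by simp only [size] at hn; omega) h.ixOd,
          Or.inl (le_refl _)⟩))
  exact this _ σ a q (Nat.lt_succ_self _) h

theorem not_wf_next_pi : ¬ WF (next pi) := by
  intro h
  cases h with
  | next _ h => simp [IsDQ] at h

/-- A direct induction, because transitivity through c < c⁺ is not yet available. -/
theorem lt_of_next_lt {c d : Dg} (hc : WF (next c)) (wd : WF d) (hd : IsSC d)
    (h : lt (next c) d) : lt c d := by
  have : ∀ n (c d : Dg), size c < n → WF (next c) → WF d → IsSC d → lt (next c) d → lt c d := by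
    intro n
    induction n with
    | zero => intro _ _ h; omega
    | succ n ih =>
      intro c d hn hc wd hd h
      rcases hd.cases with rfl | rfl | ⟨d', rfl⟩ | ⟨τ, b, p, rfl⟩
      · exact (not_next_lt_omega h).elim
      · refine (sc_lt_pi hc.next_sc).2 ?_
        rintro rfl
        exact not_wf_next_pi hc
      · rw [next_lt_next] at h
        rcases hc.next_sc.cases with rfl | rfl | ⟨c', rfl⟩ | ⟨τ, b, p, rfl⟩
        · exact omega_lt_next
        · exact (not_wf_next_pi hc).elim
        · rw [next_lt_next]
          exact ih c' d' (by simp only [size] at hn; omega) hc.next_arg wd.next_arg wd.next_sc h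
        · exact col_lt_next.2 (Or.inr (Or.inl h))
      · exact (next_lt_col.1 h).2
  exact this _ c d (Nat.lt_succ_self _) hc wd hd h

/-- An exponential measure: a sum of values at two proper subexpressions of `x` is below the
value at `x`. -/
def ms (x : Dg) : ℕ := 3 ^ size x

theorem ms_pos (x : Dg) : 0 < ms x := by unfold ms; positivity

theorem ms_lt {x y : Dg} (h : size x < size y) : 3 * ms x ≤ ms y := by
  unfold ms
  calc 3 * 3 ^ size x = 3 ^ (size x + 1) := by ring
    _ ≤ 3 ^ size y := Nat.pow_le_pow_right (by norm_num) h

theorem ms_le {x y : Dg} (h : size x ≤ size y) : ms x ≤ ms y :=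
  Nat.pow_le_pow_right (by norm_num) h

/-- `<` is a strict order on the well-formed diagrams, as far as families of measure less than `s`
are concerned. -/
structure Lin (s : ℕ) : Prop where
  asym : ∀ {x y}, WF x → WF y → ms x + ms y < s → lt x y → ¬ lt y x
  trans : ∀ {x y z}, WF x → WF y → WF z → ms x + ms y + ms z < s → lt x y → lt y z → lt x z

namespace Lin

variable {s : ℕ} (L : Lin s)
include L

theorem prec_lt {x y : Dg} (hx : WF x) (hs : 2 * ms x ≤ s) (h : Prec x y) : lt x y := by
  induction h with
  | single h => obtain ⟨c, q, rfl⟩ := h; exact col_lt_ix hx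
  | @tail b c h1 h2 ih =>
    have hb := hx.precEq (Prec.toEq h1)
    have hc := hx.precEq (Prec.toEq (h1.tail h2))
    have e1 := ms_lt (Prec.size_lt h1)
    have e2 := ms_lt h2.size_lt
    have e3 := ms_pos x
    refine L.trans hx hb hc (by omega) ih ?_
    obtain ⟨c, q, rfl⟩ := h2
    exact col_lt_ix hb

theorem precEq_le {x y : Dg} (hx : WF x) (hs : 2 * ms x ≤ s) (h : PrecEq x y) : le x y := by
  rcases precEq_iff.1 h with rfl | h
  · exact le_refl _
  · exact Or.inl (L.prec_lt hx hs h)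

/-- Asymmetry for the subscripts makes the three clauses for two collapsed diagrams mutually
exclusive; this lemma and the next two isolate the surviving clause. -/
theorem col_lt_of_lt {σ a q τ b p : Dg} (hx : WF (col σ a q)) (hy : WF (col τ b p))
    (hs : ms (col σ a q) + ms (col τ b p) ≤ s) (h : lt σ τ) :
    lt (col σ a q) (col τ b p) ↔ le σ (col τ b p) ∨ ∃ k ∈ Kc σ (col τ b p), le (col σ a q) k := by
  have h1 := L.asym hx.ixOd hy.ixOd (by
    have := ms_lt (x := σ) (y := col σ a q) (by simp only [size]; omega)
    have := ms_lt (x := τ) (y := col τ b p) (by simp only [size]; omega)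
    have := ms_pos σ; have := ms_pos τ; omega) h
  have h2 : σ ≠ τ := by rintro rfl; exact h1 h
  rw [col_lt_col]
  constructor
  · rintro (⟨e, _⟩ | ⟨_, h⟩ | ⟨e, _⟩)
    exacts [(h2 e).elim, h, (h1 e).elim]
  · intro h'
    exact Or.inr (Or.inl ⟨h, h'⟩)

/-- Since K_σ σ = ∅, including the subscript in `Kc σ` adds nothing here, so the three clauses can
all be stated with `Kc`. -/
theorem col_lt_of_eq {σ a q b p : Dg} (hx : WF (col σ a q))
    (hs : ms (col σ a q) ≤ s) :
    lt (col σ a q) (col σ b p) ↔ (∃ k ∈ Kc σ (col σ b p), le (col σ a q) k) ∨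
      ((∀ k ∈ Kc σ (col σ a q), lt k (col σ b p)) ∧ (lt a b ∨ (a = b ∧ SeqLt lt q p))) := by
  have h1 : ¬ lt σ σ := fun h => L.asym hx.ixOd hx.ixOd (by
    have := ms_lt (x := σ) (y := col σ a q) (by simp only [size]; omega)
    have := ms_pos σ; omega) h h
  have h2 : ∀ k, k ∉ K σ σ := fun k => not_mem_K_of_size le_rfl
  have h3 : ∀ c r k, k ∈ Kc σ (col σ c r) ↔ k ∈ K σ c ∨ k ∈ K σ r := by
    intro c r k
    rw [mem_Kc]
    simp [h2]
  rw [col_lt_col]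
  simp only [h1, h3, false_and, or_false, true_and]

theorem col_lt_of_gt {σ a q τ b p : Dg} (hx : WF (col σ a q)) (hy : WF (col τ b p))
    (hs : ms (col σ a q) + ms (col τ b p) ≤ s) (h : lt τ σ) :
    lt (col σ a q) (col τ b p) ↔
      lt (col σ a q) τ ∧ ∀ k ∈ Kc τ (col σ a q), lt k (col τ b p) := by
  have h1 := L.asym hy.ixOd hx.ixOd (by
    have := ms_lt (x := σ) (y := col σ a q) (by simp only [size]; omega)
    have := ms_lt (x := τ) (y := col τ b p) (by simp only [size]; omega)
    have := ms_pos σ; have := ms_pos τ; omega) h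
  have h2 : σ ≠ τ := by rintro rfl; exact h1 h
  rw [col_lt_col]
  constructor
  · rintro (⟨e, _⟩ | ⟨e, _⟩ | ⟨_, h⟩)
    exacts [(h2 e).elim, (h1 e).elim, h]
  · intro h'
    exact Or.inr (Or.inr ⟨h, h'⟩)

/-- `K_τ t ∩ {k : k ≺ σ} ⊆ K_σ t` for `σ ≼ τ`. -/
theorem mem_K_of_precEq {σ τ k t : Dg} (ht : WF t) (hs : ms t < s) (hk : k ∈ K τ t)
    (h1 : Prec k σ) (h2 : PrecEq σ τ) : k ∈ K σ t := by
  rcases precEq_iff.1 h2 with rfl | h2'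
  · exact hk
  have wk := ht.mem_K hk
  have wσ := wk.precEq h1.toEq
  have wτ := wσ.precEq h2
  have eσ := ms_lt h1.size_lt
  have eτ := ms_lt h2'.size_lt
  have ek := ms_le (size_of_mem_K hk)
  have hστ : lt σ τ := L.prec_lt wσ (by omega) h2'
  revert hs hk
  refine IsOd.rec' (P := fun t => ms t < s → k ∈ K τ t → k ∈ K σ t) (fun _ h => h.elim)
    (fun _ h => h.elim) (fun _ h => h.elim) ?_ ?_ ?_ ?_ ht
  · intro a b _ ha hb hs h
    have e1 := ms_lt (x := a) (y := add a b) (by simp only [size]; omega)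
    have e2 := ms_lt (x := b) (y := add a b) (by simp only [size]; omega)
    exact h.imp (ha (by omega)) (hb (by omega))
  · intro a b _ ha hb hs h
    have e1 := ms_lt (x := a) (y := phi a b) (by simp only [size]; omega)
    have e2 := ms_lt (x := b) (y := phi a b) (by simp only [size]; omega)
    exact h.imp (ha (by omega)) (hb (by omega))
  · intro a _ ha hs h
    have e1 := ms_lt (x := a) (y := next a) (by simp only [size]; omega)
    exact ha (by omega) h
  · intro τ' b q wt ih hs h
    have eτ' := ms_lt (x := τ') (y := col τ' b q) (by simp only [size]; omega)
    have e' := ms_le (size_of_mem_K h)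
    have hp := ms_pos σ
    rcases mem_K_col.1 h with ⟨hlt, h⟩ | ⟨hlt, hn, h⟩ | ⟨hp, rfl⟩
    · obtain ⟨t, htc, hkt⟩ := (mem_Kc_iff wt).1 h
      have et := ms_lt htc.size_lt
      have := ih t htc (by omega) hkt
      exact mem_K_col.2 (Or.inl ⟨L.trans wσ wτ wt.ixOd (by omega) hστ hlt,
        (mem_Kc_iff wt).2 ⟨t, htc, this⟩⟩)
    · have := ih τ' (Or.inl rfl) (by omega) h
      rcases tri wσ wt.ixOd with h3 | rfl | h3
      · exact mem_K_col.2 (Or.inl ⟨h3, Or.inl this⟩)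
      · exact (hn h2).elim
      · exact mem_K_col.2 (Or.inr (Or.inl ⟨h3, fun h => hn (h.trans h2), this⟩))
    · exact mem_K_col.2 (Or.inr (Or.inr ⟨prec_col.1 h1, rfl⟩))

/-- Every subscript met between x and ρ is below τ without being ≼ τ, so only the second clause for
K_τ applies, and it hands the coefficients up to ρ. -/
theorem K_precEq {τ ρ x k : Dg} (hx : WF x) (wτ : WF τ) (hs : 2 * ms x + ms τ ≤ s)
    (hxρ : PrecEq x ρ) (hρ : lt ρ τ) (hn : ¬ PrecEq x τ) (hk : k ∈ K τ x) : k ∈ K τ ρ := by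
  have key : ∀ n (x : Dg), size x < n → WF x → 2 * ms x + ms τ ≤ s → PrecEq x ρ →
      ¬ PrecEq x τ → k ∈ K τ x → k ∈ K τ ρ := by
    intro n
    induction n with
    | zero => intro _ h; omega
    | succ n ih =>
      intro x hn hx hs hxρ hnx hk
      rcases precEq_iff.1 hxρ with rfl | hp
      · exact hk
      obtain ⟨x1, c, q, rfl, h1⟩ := hp.exists_col
      have e1 := ms_lt (x := x1) (y := col x1 c q) (by simp only [size]; omega)
      have e0 := ms_pos x1
      have w1 := hx.ixOd
      have hn1 : ¬ PrecEq x1 τ := fun h => hnx (prec_col.2 h).toEq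
      have e2 := ms_le h1.size_le
      have hlt : lt x1 τ := by
        rcases L.precEq_le w1 (by omega) h1 with h | rfl
        · exact L.trans w1 (w1.precEq h1) wτ (by omega) h hρ
        · exact hρ
      rcases mem_K_col.1 hk with ⟨h, _⟩ | ⟨_, _, h⟩ | ⟨h, _⟩
      · exact (L.asym wτ w1 (by omega) h hlt).elim
      · exact ih x1 (by simp only [size] at hn; omega) w1 (by omega) h1 hn1 h
      · exact (hn1 h).elim
  exact key _ x (Nat.lt_succ_self _) hx hs hxρ hn hk

/-- `K_ρ k ⊆ K_ρ t` for `k ∈ K_τ t` and `ρ < τ`. -/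
theorem K_subset {ρ τ k t : Dg} (ht : WF t) (wρ : WF ρ) (hs : ms ρ + ms t ≤ s) (hρτ : lt ρ τ)
    (hk : k ∈ K τ t) : K ρ k ⊆ K ρ t := by
  have wk := ht.mem_K hk
  have wτ := wk.precEq (prec_of_mem_K hk).toEq
  have eτ := ms_lt (prec_of_mem_K hk).size_lt
  have pρ := ms_pos ρ
  revert hs hk
  refine IsOd.rec' (P := fun t => ms ρ + ms t ≤ s → k ∈ K τ t → K ρ k ⊆ K ρ t)
    (fun _ h => h.elim) (fun _ h => h.elim) (fun _ h => h.elim) ?_ ?_ ?_ ?_ ht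
  · intro a b _ ha hb hs h
    have e1 := ms_lt (x := a) (y := add a b) (by simp only [size]; omega)
    have e2 := ms_lt (x := b) (y := add a b) (by simp only [size]; omega)
    rcases h with h | h
    · exact (ha (by omega) h).trans Set.subset_union_left
    · exact (hb (by omega) h).trans Set.subset_union_right
  · intro a b _ ha hb hs h
    have e1 := ms_lt (x := a) (y := phi a b) (by simp only [size]; omega)
    have e2 := ms_lt (x := b) (y := phi a b) (by simp only [size]; omega)
    rcases h with h | h
    · exact (ha (by omega) h).trans Set.subset_union_left
    · exact (hb (by omega) h).trans Set.subset_union_right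
  · intro a _ ha hs h
    have e1 := ms_lt (x := a) (y := next a) (by simp only [size]; omega)
    exact ha (by omega) h
  · intro τ' b q wt ih hs h
    have eτ' := ms_lt (x := τ') (y := col τ' b q) (by simp only [size]; omega)
    have pτ' := ms_pos τ'
    have e' := ms_le (size_of_mem_K h)
    rcases mem_K_col.1 h with ⟨hlt, h⟩ | ⟨hlt, hn, h⟩ | ⟨hp, rfl⟩
    · obtain ⟨t, htc, hkt⟩ := (mem_Kc_iff wt).1 h
      have et := ms_lt htc.size_lt
      have h1 := ih t htc (by omega) hkt
      intro j hj
      exact mem_K_col.2 (Or.inl ⟨L.trans wρ wτ wt.ixOd (by omega) hρτ hlt,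
        (mem_Kc_iff wt).2 ⟨t, htc, h1 hj⟩⟩)
    · have h1 := ih τ' (Or.inl rfl) (by omega) h
      intro j hj
      rcases tri wρ wt.ixOd with h3 | rfl | h3
      · exact mem_K_col.2 (Or.inl ⟨h3, Or.inl (h1 hj)⟩)
      · exact (not_mem_K_of_size (size_of_mem_K h) hj).elim
      -- If τ' ≼ ρ, then `K_precEq` makes k a coefficient of ρ itself, hence no larger than ρ, and
      -- K_ρ k is empty.
      · by_cases hp : PrecEq τ' ρ
        · have h4 := L.K_precEq wt.ixOd wτ (by omega) hp hρτ hn h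
          exact (not_mem_K_of_size (size_of_mem_K h4) hj).elim
        · exact mem_K_col.2 (Or.inr (Or.inl ⟨h3, hp, h1 hj⟩))
    · exact subset_rfl

/-- For `α ∈ 𝒟_σ` and `x < σ`: if `α < x`, then `α ≤ K_σ x`. -/
theorem le_K_of_lt {σ a q x : Dg} (hα : WF (col σ a q)) (hx : WF x) (sx : IsSC x)
    (hs : ms (col σ a q) + ms x ≤ s) (hxσ : lt x σ) (h : lt (col σ a q) x) :
    ∃ k ∈ K σ x, le (col σ a q) k := by
  have eσ := ms_lt (x := σ) (y := col σ a q) (by simp only [size]; omega)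
  have pσ := ms_pos σ
  have key : ∀ n (x : Dg), size x < n → WF x → IsSC x → ms (col σ a q) + ms x ≤ s → lt x σ →
      lt (col σ a q) x → ∃ k ∈ K σ x, le (col σ a q) k := by
    intro n
    induction n with
    | zero => intro _ h; omega
    | succ n ih =>
      intro x hn hx sx hs hxσ h
      rcases sx.cases with rfl | rfl | ⟨c, rfl⟩ | ⟨τ, b, p, rfl⟩
      · rw [col_lt_omega] at h
        subst h
        exact (not_omega_lt_omega hxσ).elim
      · exact (not_pi_lt_sc hα.sc_ix hxσ).elim
      · have ec := ms_lt (x := c) (y := next c) (by simp only [size]; omega)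
        rcases col_lt_next.1 h with (h | rfl) | (h | rfl)
        · exact (L.asym hα.ixOd hx (by omega) h hxσ).elim
        · exact (L.asym hx hx (by omega) hxσ hxσ).elim
        · exact ih c (by simp only [size] at hn; omega) hx.next_arg hx.next_sc (by omega)
            (lt_of_next_lt hx hα.ixOd hα.sc_ix hxσ) h
        · exact ⟨col σ a q, mem_K_col.2 (Or.inr (Or.inr ⟨.refl, rfl⟩)), le_refl _⟩
      · have eτ := ms_lt (x := τ) (y := col τ b p) (by simp only [size]; omega)
        rcases tri hα.ixOd hx.ixOd with h1 | rfl | h1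
        · rcases (L.col_lt_of_lt hα hx hs h1).1 h with (h | rfl) | ⟨k, hk, h⟩
          · exact (L.asym hα.ixOd hx (by omega) h hxσ).elim
          · exact (L.asym hx hx (by omega) hxσ hxσ).elim
          · exact ⟨k, mem_K_col.2 (Or.inl ⟨h1, hk⟩), h⟩
        · exact ⟨_, mem_K_col.2 (Or.inr (Or.inr ⟨.refl, rfl⟩)), Or.inl h⟩
        · by_cases hp : PrecEq τ σ
          · exact ⟨_, mem_K_col.2 (Or.inr (Or.inr ⟨hp, rfl⟩)), Or.inl h⟩
          · obtain ⟨h2, _⟩ := (L.col_lt_of_gt hα hx hs h1).1 h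
            obtain ⟨k, hk, h3⟩ := ih τ (by simp only [size] at hn; omega) hx.ixOd hx.sc_ix
              (by omega) h1 h2
            exact ⟨k, mem_K_col.2 (Or.inr (Or.inl ⟨h1, hp, hk⟩)), h3⟩
  exact key _ x (Nat.lt_succ_self _) hx sx hs hxσ h

/-- Two ways of saying that no strongly critical diagram separates a collapsed diagram from its
subscript. Deriving either from the other would need transitivity, so they support each other in an
induction on total size. -/
theorem ix_aux : ∀ n : ℕ,
    (∀ ρ f r z, size (col ρ f r) + size z < n → WF (col ρ f r) → WF z → IsSC z →
      ms (col ρ f r) + ms z ≤ s → lt ρ z → lt (col ρ f r) z) ∧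
    (∀ x μ g r, size x + size (col μ g r) < n → WF x → IsSC x → WF (col μ g r) →
      ms x + ms (col μ g r) ≤ s → lt x (col μ g r) → lt x μ) := by
  intro n
  induction n with
  | zero => exact ⟨fun _ _ _ _ h => by omega, fun _ _ _ _ h => by omega⟩
  | succ n ih =>
    obtain ⟨ih1, ih2⟩ := ih
    constructor
    · intro ρ f r z hn hu hz sz hs h
      have eρ := ms_lt (x := ρ) (y := col ρ f r) (by simp only [size]; omega)
      have pρ := ms_pos ρ
      rcases sz.cases with rfl | rfl | ⟨e, rfl⟩ | ⟨μ, g, r', rfl⟩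
      · rcases hu.sc_ix.cases with rfl | rfl | ⟨c, rfl⟩ | ⟨τ, b, p, rfl⟩
        · exact (not_omega_lt_omega h).elim
        · exact (not_pi_lt_sc (y := omega) trivial h).elim
        · exact (not_next_lt_omega h).elim
        · exact ((hu.ix_ix rfl).1 (col_lt_omega.1 h)).elim
      · exact col_lt_pi
      · exact col_lt_next.2 (Or.inl (Or.inl h))
      · have eμ := ms_lt (x := μ) (y := col μ g r') (by simp only [size]; omega)
        rcases tri hu.ixOd hz.ixOd with h1 | rfl | h1
        · exact (L.col_lt_of_lt hu hz hs h1).2 (Or.inl (Or.inl h))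
        · exact (L.asym hu.ixOd hz (by omega) h (col_lt_ix hz)).elim
        · have := ih2 ρ μ g r' (by simp only [size] at hn ⊢; omega) hu.ixOd hu.sc_ix hz
            (by omega) h
          exact (L.asym hu.ixOd hz.ixOd (by omega) this h1).elim
    · intro x μ g r hn hx sx hz hs h
      have eμ := ms_lt (x := μ) (y := col μ g r) (by simp only [size]; omega)
      have pμ := ms_pos μ
      rcases sx.cases with rfl | rfl | ⟨e, rfl⟩ | ⟨ρ, c, q, rfl⟩
      · rw [omega_lt_col] at h
        rcases hz.sc_ix.cases with rfl | rfl | ⟨c, rfl⟩ | ⟨τ, b, p, rfl⟩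
        · exact (h rfl).elim
        · exact (sc_lt_pi (x := omega) trivial).2 (by simp)
        · exact omega_lt_next
        · exact omega_lt_col.2 (hz.ix_ix rfl).1
      · exact (not_pi_lt_sc (y := col μ g r) trivial h).elim
      · exact (next_lt_col.1 h).1
      · rcases tri hx.ixOd hz.ixOd with h1 | rfl | h1
        · exact ih1 ρ c q μ (by simp only [size] at hn ⊢; omega) hx hz.ixOd hz.sc_ix
            (by omega) h1
        · exact col_lt_ix hx
        · exact ((L.col_lt_of_gt hx hz hs h1).1 h).1

theorem lt_ix_of_lt {x μ g r : Dg} (hx : WF x) (sx : IsSC x) (hz : WF (col μ g r))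
    (hs : ms x + ms (col μ g r) ≤ s) (h : lt x (col μ g r)) : lt x μ :=
  (L.ix_aux _).2 x μ g r (Nat.lt_succ_self _) hx sx hz hs h

end Lin

/-- `k` is a coefficient of `y` with respect to the subscript of `k`. -/
def Hid (k y : Dg) : Prop := k ∈ K (ix k) y ∨ (ix k = ix y ∧ k ∈ Kc (ix k) y)

theorem Hid.exists_col {k y : Dg} (h : Hid k y) : ∃ σ e r, k = col σ e r := by
  have : Prec k (ix k) := by
    rcases h with h | ⟨_, h⟩
    · exact prec_of_mem_K h
    · exact prec_of_mem_Kc h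
  obtain ⟨σ, c, q, rfl, _⟩ := this.exists_col
  exact ⟨σ, c, q, rfl⟩

theorem Hid.wf {C : Dg → Prop} {k y : Dg} (h : Hid k y) (hy : IsOd C y) : IsOd C k := by
  rcases h with h | ⟨_, h⟩
  · exact hy.mem_K h
  · exact hy.mem_Kc h

theorem Hid.size_le {k y : Dg} (h : Hid k y) : size k ≤ size y := by
  rcases h with h | ⟨_, h⟩
  · exact size_of_mem_K h
  · exact (size_lt_of_mem_Kc h).le

/-- The coefficients of a collapsed diagram other than itself. -/
theorem Hid.cases {σ e r τ b p : Dg} (h : Hid (col σ e r) (col τ b p))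
    (hne : col σ e r ≠ col τ b p) :
    (lt τ σ ∧ ¬ PrecEq τ σ ∧ col σ e r ∈ K σ τ) ∨ (le σ τ ∧ col σ e r ∈ Kc σ (col τ b p)) := by
  rcases h with h | ⟨h1, h⟩
  · rcases mem_K_col.1 h with ⟨h1, h⟩ | h | ⟨_, h⟩
    · exact Or.inr ⟨Or.inl h1, h⟩
    · exact Or.inl h
    · exact (hne h).elim
  · exact Or.inr ⟨Or.inr h1, h⟩

/-! ### Monotonicity of coefficients -/

namespace Lin

variable {s : ℕ} (L : Lin s)
include L

/-- The subscript σ' of k satisfies σ' ≼ σ, and `mem_K_of_precEq` moves k from K_σ to K_σ'. -/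
theorem hid_of_mem_K {σ k y : Dg} (hy : WF y) (hs : ms y < s) (h : k ∈ K σ y) : Hid k y := by
  have h1 := prec_of_mem_K h
  obtain ⟨σ', c, q, rfl, h2⟩ := h1.exists_col
  exact Or.inl (L.mem_K_of_precEq hy hs h (prec_col.2 .refl) h2)

/-- For collapsed y the possible positions of a coefficient k ≠ y match the clauses for k < y: k is
a coefficient of the subscript of y, or of a component and then k ≤ k is the witness required in
clause (i) or (ii). -/
theorem hid_le {k y : Dg} (hy : WF y) (sy : IsSC y) (hs : 2 * ms y ≤ s) (h : Hid k y) :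
    le k y := by
  have key : ∀ n (y : Dg), size y < n → WF y → IsSC y → 2 * ms y ≤ s → Hid k y → le k y := by
    intro n
    induction n with
    | zero => intro _ h; omega
    | succ n ih =>
      intro y hn hy sy hs h
      obtain ⟨σ, e, r, rfl⟩ := h.exists_col
      have wk := h.wf hy
      have ek := ms_le h.size_le
      rcases sy.cases with rfl | rfl | ⟨c, rfl⟩ | ⟨τ, b, p, rfl⟩
      · rcases h with h | ⟨_, h⟩ <;> exact h.elim
      · rcases h with h | ⟨_, h⟩ <;> exact h.elim
      · have ec := ms_lt (x := c) (y := next c) (by simp only [size]; omega)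
        rcases h with h | ⟨_, h⟩
        · exact Or.inl (col_lt_next.2 (Or.inr (ih c (by simp only [size] at hn; omega)
            hy.next_arg hy.next_sc (by omega) (Or.inl h))))
        · exact h.elim
      · by_cases hne : col σ e r = col τ b p
        · exact Or.inr hne
        left
        rcases h.cases hne with ⟨h1, h2, h3⟩ | ⟨h1 | rfl, h3⟩
        · have eτ := ms_lt (x := τ) (y := col τ b p) (by simp only [size]; omega)
          refine (L.col_lt_of_gt wk hy (by omega) h1).2 ⟨?_, fun k' hk' => ?_⟩
          · refine (ih τ (by simp only [size] at hn; omega) hy.ixOd hy.sc_ix (by omega)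
              (Or.inl h3)).resolve_right ?_
            rintro rfl
            exact h2 (prec_of_mem_K h3).toEq
          -- There is no such k': it would be ≺ τ and so larger than τ, yet it is smaller than k,
          -- which is no larger than τ.
          · have := (prec_of_mem_Kc hk').size_lt
            have := size_lt_of_mem_Kc hk'
            have := size_of_mem_K h3
            omega
        · exact (L.col_lt_of_lt wk hy (by omega) h1).2 (Or.inr ⟨_, h3, le_refl _⟩)
        · exact (L.col_lt_of_eq wk (by omega)).2 (Or.inl ⟨_, h3, le_refl _⟩)
  exact key _ y (Nat.lt_succ_self _) hy sy hs h

/-- The subscript of k is ≼ μ and hence ≤ ρ, so the coefficient may be taken with respect to its own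
subscript. -/
theorem hid_of_mem_Kc {μ ρ c r k : Dg} (hx : WF (col ρ c r)) (hs : ms (col ρ c r) ≤ s)
    (hμ : le μ ρ) (hk : k ∈ Kc μ (col ρ c r)) : Hid k (col ρ c r) := by
  have wk := hx.mem_Kc hk
  have hp := prec_of_mem_Kc hk
  obtain ⟨σ', e, q, rfl, h2⟩ := hp.exists_col
  obtain ⟨t, ht, hkt⟩ := (mem_Kc_iff hx).1 hk
  have et := ms_lt ht.size_lt
  have et' := ms_le (size_of_mem_K hkt)
  have eσ := ms_lt (x := σ') (y := col σ' e q) (by simp only [size]; omega)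
  have eρ := ms_lt (x := ρ) (y := col ρ c r) (by simp only [size]; omega)
  have eμ := ms_le h2.size_le
  have pt := ms_pos t
  have wμ := wk.ixOd.precEq h2
  have h3 : col σ' e q ∈ Kc σ' (col ρ c r) :=
    (mem_Kc_iff hx).2 ⟨t, ht, L.mem_K_of_precEq (hx.comp ht) (by omega) hkt (prec_col.2 .refl) h2⟩
  have h4 : le σ' ρ := by
    rcases L.precEq_le wk.ixOd (by omega) h2 with h | rfl
    · rcases hμ with h' | rfl
      · exact Or.inl (L.trans wk.ixOd wμ hx.ixOd (by omega) h h')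
      · exact Or.inl h
    · exact hμ
  rcases h4 with h4 | rfl
  · exact Or.inl (mem_K_col.2 (Or.inl ⟨h4, h3⟩))
  · exact Or.inr ⟨rfl, h3⟩

/-- Coefficients are monotone: if `k` is a coefficient of `y < x`, then `k < x`. -/
theorem hid_lt {k y x : Dg} (hy : WF y) (sy : IsSC y) (hx : WF x) (sx : IsSC x)
    (hs : ms y + ms x ≤ s) (h : Hid k y) (hyx : lt y x) : lt k x := by
  have key : ∀ n (y x k : Dg), size y + size x < n → WF y → IsSC y → WF x → IsSC x →
      ms y + ms x ≤ s → Hid k y → lt y x → lt k x := by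
    intro n
    induction n with
    | zero => intro _ _ _ h; omega
    | succ n ih' =>
      intro y x k hn hy sy hx sx hs h hyx
      have ih : ∀ y' x' k', size y' + size x' < size y + size x → WF y' → IsSC y' → WF x' →
          IsSC x' → ms y' + ms x' ≤ s → Hid k' y' → lt y' x' → lt k' x' :=
        fun y' x' k' h => ih' y' x' k' (by omega)
      clear ih' hn
      obtain ⟨σ, e, r, rfl⟩ := h.exists_col
      have wk := h.wf hy
      have ek := ms_le h.size_le
      have eσ := ms_lt (x := σ) (y := col σ e r) (by simp only [size]; omega)
      have pσ := ms_pos σ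
      have px := ms_pos x
      rcases sy.cases with rfl | rfl | ⟨c, rfl⟩ | ⟨τ, b, p, rfl⟩
      · rcases h with h | ⟨_, h⟩ <;> exact h.elim
      · rcases h with h | ⟨_, h⟩ <;> exact h.elim
      · have ec := ms_lt (x := c) (y := next c) (by simp only [size]; omega)
        have h' : Hid (col σ e r) c := by
          rcases h with h | ⟨_, h⟩
          · exact Or.inl h
          · exact h.elim
        rcases sx.cases with rfl | rfl | ⟨d, rfl⟩ | ⟨ρ, f, q, rfl⟩
        · exact (not_next_lt_omega hyx).elim
        · exact col_lt_pi
        · have ed := ms_lt (x := d) (y := next d) (by simp only [size]; omega)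
          rw [next_lt_next] at hyx
          exact col_lt_next.2 (Or.inr (Or.inl (ih c d _ (by simp only [size]; omega) hy.next_arg
            hy.next_sc hx.next_arg hx.next_sc (by omega) h' hyx)))
        · exact ih c _ _ (by simp only [size]; omega) hy.next_arg hy.next_sc hx sx (by omega) h'
            (next_lt_col.1 hyx).2
      · have eτ := ms_lt (x := τ) (y := col τ b p) (by simp only [size]; omega)
        have pτ := ms_pos τ
        by_cases hne : col σ e r = col τ b p
        · rw [hne]; exact hyx
        have hc := h.cases hne
        have hkτ : col σ e r ∈ K σ τ → col σ e r ≠ τ := by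
          rintro h1 rfl
          rcases hc with ⟨_, h2, _⟩ | ⟨h2, _⟩
          · exact h2 (prec_of_mem_K h1).toEq
          · have h3 := col_lt_ix hy.ixOd
            rcases h2 with h2 | h2
            · exact L.asym hy.ixOd.ixOd hy.ixOd (by omega) h2 h3
            · have : size σ = size (col σ e r) := congrArg size h2
              simp only [size] at this
              omega
        rcases sx.cases with rfl | rfl | ⟨d, rfl⟩ | ⟨ρ, c, q, rfl⟩
        · rw [col_lt_omega] at hyx
          subst hyx
          have h0 : ∀ t : Prop, lt σ omega → t := by
            intro t h1
            rcases wk.sc_ix.cases with rfl | rfl | ⟨c, rfl⟩ | ⟨τ, b, p, rfl⟩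
            · exact (not_omega_lt_omega h1).elim
            · exact (not_pi_lt_sc (y := omega) trivial h1).elim
            · exact (not_next_lt_omega h1).elim
            · exact ((wk.ix_ix rfl).1 (col_lt_omega.1 h1)).elim
          rcases hc with ⟨_, _, h3⟩ | ⟨h1 | rfl, h3⟩
          · exact h3.elim
          · exact h0 _ h1
          · exact col_lt_omega.2 rfl
        · exact col_lt_pi
        · have ed := ms_lt (x := d) (y := next d) (by simp only [size]; omega)
          have hτ : col σ e r ∈ K σ τ → le τ (next d) → lt (col σ e r) (next d) := by
            rintro h3 (h1 | rfl)
            · exact ih τ _ _ (by simp only [size]; omega) hy.ixOd hy.sc_ix hx sx (by omega)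
                (Or.inl h3) h1
            · exact (L.hid_le hx sx (by omega) (Or.inl h3)).resolve_right (hkτ h3)
          rcases col_lt_next.1 hyx with h1 | h1 | h1
          · rcases hc with ⟨_, _, h3⟩ | ⟨h2 | rfl, h3⟩
            · exact hτ h3 h1
            · refine col_lt_next.2 (Or.inl ?_)
              rcases h1 with h1 | rfl
              · exact Or.inl (L.trans wk.ixOd hy.ixOd hx (by omega) h2 h1)
              · exact Or.inl h2
            · exact col_lt_next.2 (Or.inl h1)
          · exact col_lt_next.2 (Or.inr (Or.inl (ih _ d _ (by simp only [size]; omega) hy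
              sy hx.next_arg hx.next_sc (by omega) h h1)))
          · refine col_lt_next.2 (Or.inr (Or.inl ?_))
            subst h1
            exact (L.hid_le hy sy (by omega) h).resolve_right hne
        · have eρ := ms_lt (x := ρ) (y := col ρ c q) (by simp only [size]; omega)
          have pρ := ms_pos ρ
          have py := ms_pos (col τ b p)
          have esy : size (col σ e r) ≤ size (col τ b p) := h.size_le
          have esy' : size (col σ e r) < size (col τ b p) := by
            rcases hc with ⟨_, _, h3⟩ | ⟨_, h3⟩
            · have := size_of_mem_K h3; simp only [size] at this ⊢; omega
            · exact size_lt_of_mem_Kc h3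
          have ek' := ms_lt esy'
          have pk := ms_pos (col σ e r)
          -- From now on x ≤ k, whence x < σ. The clause responsible for y < x is refuted in each
          -- case.
          by_contra hcon
          have hxk : le (col ρ c q) (col σ e r) := (le_or_lt hx wk).resolve_right hcon
          have hxσ : lt (col ρ c q) σ := by
            rcases hxk with h1 | h1
            · exact L.lt_ix_of_lt hx sx wk (by omega) h1
            · rw [h1]; exact col_lt_ix wk
          have asymk : ∀ z, WF z → ms z + ms (col ρ c q) < s → lt z (col ρ c q) →
              ¬ le (col ρ c q) z := by
            rintro z wz hz h1 (h2 | h2)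
            · exact L.asym wz hx hz h1 h2
            · rw [← h2] at h1 hz
              exact L.asym hx hx hz h1 h1
          -- If y < x because y ≤ k2 for a coefficient k2 of x, then monotonicity for smaller pairs
          -- gives k < k2 from y ≤ k2, and k2 < k from x ≤ k.
          have type1 : ∀ μ k2, k2 ∈ Kc μ (col ρ c q) → le μ ρ → le (col τ b p) k2 → False := by
            intro μ k2 hk2 hμ hle
            have wk2 := hx.mem_Kc hk2
            have hh := L.hid_of_mem_Kc hx (by omega) hμ hk2
            have es2 := size_lt_of_mem_Kc hk2
            have em2 := ms_lt es2
            obtain ⟨σ2, e2, r2, rfl⟩ := hh.exists_col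
            have g1 : lt (col σ e r) (col σ2 e2 r2) := by
              rcases hle with h1 | h1
              · exact ih _ _ _ (by omega) hy sy wk2 trivial (by omega) h h1
              · rw [← h1] at em2 ⊢
                exact (L.hid_le hy sy (by omega) h).resolve_right hne
            have g2 : lt (col σ2 e2 r2) (col σ e r) := by
              rcases hxk with h1 | h1
              · exact ih _ _ _ (by omega) hx sx wk trivial (by omega) hh h1
              · rw [← h1] at ek' ⊢
                refine (L.hid_le hx sx (by omega) hh).resolve_right ?_
                intro h2
                rw [h2] at es2
                omega
            exact L.asym wk wk2 (by omega) g1 g2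
          -- Here y < x because the K_ρ-coefficients of the components of y lie below x. For ρ < σ
          -- those of k are among them, so clause (iii) gives k < x; for ρ = σ, k is one of them.
          have caseA : le ρ τ → (∀ k' ∈ Kc ρ (col τ b p), lt k' (col ρ c q)) →
              lt (col τ b p) ρ → False := by
            intro hρτ hK hyρ
            have hkρ : lt (col σ e r) ρ := ih _ ρ _ (by simp only [size]; omega) hy sy hx.ixOd
              hx.sc_ix (by omega) h hyρ
            obtain ⟨t, ht, hkt⟩ : ∃ t, Comp t (col τ b p) ∧ col σ e r ∈ K σ t := by
              rcases hc with ⟨_, _, h3⟩ | ⟨_, h3⟩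
              · exact ⟨τ, Or.inl rfl, h3⟩
              · exact (mem_Kc_iff hy).1 h3
            have et := ms_lt ht.size_lt
            rcases tri hx.ixOd wk.ixOd with h1 | rfl | h1
            · refine hcon ((L.col_lt_of_gt wk hx (by omega) h1).2 ⟨hkρ, fun k' hk' => ?_⟩)
              have h2 : k' ∈ K ρ (col σ e r) := mem_K_col.2 (Or.inl ⟨h1, hk'⟩)
              exact hK k' ((mem_Kc_iff hy).2
                ⟨t, ht, L.K_subset (hy.comp ht) hx.ixOd (by omega) h1 hkt h2⟩)
            · exact hcon (hK _ ((mem_Kc_iff hy).2 ⟨t, ht, hkt⟩))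
            -- For σ < ρ one descends in t towards k. Either a diagram having k as a coefficient is
            -- itself in K_ρ t, hence below x, so that k < x by induction; or x is below a subscript
            -- τ' < ρ, and then x is bounded by a K_ρ-coefficient, although these are all below x.
            · have Q : ∀ t, WF t → size t < size (col τ b p) →
                  (∀ k' ∈ K ρ t, lt k' (col ρ c q)) → col σ e r ∈ K σ t → False := by
                intro t wt
                refine IsOd.rec' (P := fun t => size t < size (col τ b p) →
                  (∀ k' ∈ K ρ t, lt k' (col ρ c q)) → col σ e r ∈ K σ t → False)
                  (fun _ _ h => h.elim) (fun _ _ h => h.elim) (fun _ _ h => h.elim) ?_ ?_ ?_ ?_ wt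
                · intro a' b' _ ha hb hsz hK h
                  simp only [size] at hsz ha hb
                  exact h.elim (ha (by omega) fun k' hk' => hK k' (Or.inl hk'))
                    (hb (by omega) fun k' hk' => hK k' (Or.inr hk'))
                · intro a' b' _ ha hb hsz hK h
                  simp only [size] at hsz ha hb
                  exact h.elim (ha (by omega) fun k' hk' => hK k' (Or.inl hk'))
                    (hb (by omega) fun k' hk' => hK k' (Or.inr hk'))
                · intro a' _ ha hsz hK h
                  simp only [size] at hsz ha
                  exact ha (by omega) hK h
                · intro τ' b' q' wt' ih2 hsz hK h
                  have eτ' := ms_lt (x := τ') (y := col τ' b' q') (by simp only [size]; omega)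
                  have pτ' := ms_pos τ'
                  have esz := ms_lt hsz
                  have viaKm : col τ' b' q' ∈ K ρ (col τ' b' q') → False := fun h1 =>
                    hcon (ih _ _ _ (by omega) wt' trivial hx sx (by omega) (Or.inl h) (hK _ h1))
                  have viaG : lt τ' ρ → ¬ PrecEq τ' ρ → lt (col ρ c q) τ' → False := by
                    intro h1 h2 h3
                    obtain ⟨k3, hk3, h4⟩ := L.le_K_of_lt hx wt'.ixOd wt'.sc_ix (by omega) h1 h3
                    have h5 := hK k3 (mem_K_col.2 (Or.inr (Or.inl ⟨h1, h2, hk3⟩)))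
                    have e3 := ms_le (size_of_mem_K hk3)
                    exact asymk k3 (wt'.ixOd.mem_K hk3) (by omega) h5 h4
                  have ekt := ms_le (size_of_mem_K h)
                  rcases mem_K_col.1 h with ⟨h2, h3⟩ | ⟨h2, h3, h4⟩ | ⟨h2, h3⟩
                  · rcases tri wt'.ixOd hx.ixOd with h4 | rfl | h4
                    · by_cases h5 : PrecEq τ' ρ
                      · exact viaKm (mem_K_col.2 (Or.inr (Or.inr ⟨h5, rfl⟩)))
                      · exact viaG h4 h5 (L.trans hx wk.ixOd wt'.ixOd (by omega) hxσ h2)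
                    · exact viaKm (mem_K_col.2 (Or.inr (Or.inr ⟨.refl, rfl⟩)))
                    · obtain ⟨t1, ht1, hk1⟩ := (mem_Kc_iff wt').1 h3
                      have := ht1.size_lt
                      exact ih2 t1 ht1 (by omega) (fun k' hk' => hK k' (mem_K_col.2
                        (Or.inl ⟨h4, (mem_Kc_iff wt').2 ⟨t1, ht1, hk'⟩⟩))) hk1
                  · have h5 : lt τ' ρ := L.trans wt'.ixOd wk.ixOd hx.ixOd (by omega) h2 h1
                    by_cases h6 : PrecEq τ' ρ
                    · exact viaKm (mem_K_col.2 (Or.inr (Or.inr ⟨h6, rfl⟩)))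
                    · refine ih2 τ' (Or.inl rfl) (by simp only [size] at hsz ⊢; omega)
                        (fun k' hk' => hK k' (mem_K_col.2 (Or.inr (Or.inl ⟨h5, h6, hk'⟩)))) h4
                  · cases h3
                    by_cases h6 : PrecEq σ ρ
                    · exact viaKm (mem_K_col.2 (Or.inr (Or.inr ⟨h6, rfl⟩)))
                    · exact viaG h1 h6 hxσ
              exact Q t (hy.comp ht) ht.size_lt
                (fun k' hk' => hK k' ((mem_Kc_iff hy).2 ⟨t, ht, hk'⟩)) hkt
          rcases tri hy.ixOd hx.ixOd with h1 | rfl | h1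
          · rcases (L.col_lt_of_lt hy hx (by omega) h1).1 hyx with h2 | ⟨k2, hk2, h2⟩
            · rcases hc with ⟨_, _, h3⟩ | ⟨h3, _⟩
              · rcases h2 with h2 | h2
                · exact hcon (ih τ _ _ (by simp only [size]; omega) hy.ixOd hy.sc_ix hx sx
                    (by omega) (Or.inl h3) h2)
                · have h4 := (L.hid_le hy.ixOd hy.sc_ix (by omega) (Or.inl h3)).resolve_right
                    (hkτ h3)
                  rw [h2] at h4
                  exact hcon h4
              · have h4 : lt (col ρ c q) τ := by
                  rcases h3 with h3 | rfl
                  · exact L.trans hx wk.ixOd hy.ixOd (by omega) hxσ h3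
                  · exact hxσ
                rcases h2 with h2 | h2
                · exact L.asym hx hy.ixOd (by omega) h4 h2
                · rw [← h2] at h4
                  exact L.asym hy.ixOd hy.ixOd (by omega) h4 h4
            · exact type1 τ k2 hk2 (Or.inl h1) h2
          · rcases (L.col_lt_of_eq hy (by omega)).1 hyx with ⟨k2, hk2, h2⟩ | ⟨h2, _⟩
            · exact type1 τ k2 hk2 (le_refl _) h2
            · exact caseA (le_refl _) h2 (col_lt_ix hy)
          · obtain ⟨h2, h3⟩ := (L.col_lt_of_gt hy hx (by omega) h1).1 hyx
            exact caseA (Or.inl h1) h3 h2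
  exact key _ y x k (Nat.lt_succ_self _) hy sy hx sx hs h hyx

end Lin

/-! ### No cycles of length two or three -/

theorem seqLt_asymm : ∀ {q p : Dg},
    (∀ x y, InQ x q → InQ y p → lt x y → ¬ lt y x) → SeqLt lt q p → ¬ SeqLt lt p q := by
  intro q
  induction q with
  | cons j k t n q _ _ _ ih =>
    intro p h h1 h2
    cases p with
    | cons j' k' t' n' q' =>
      have hk := h k k' (inQ_cons.2 (by tauto)) (inQ_cons.2 (by tauto))
      have ht := h t t' (inQ_cons.2 (by tauto)) (inQ_cons.2 (by tauto))
      have hn := h n n' (inQ_cons.2 (by tauto)) (inQ_cons.2 (by tauto))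
      have hq := ih (p := q')
        (fun x y hx hy => h x y (inQ_cons.2 (by tauto)) (inQ_cons.2 (by tauto)))
      simp only [SeqLt] at h1 h2
      grind
    | _ => exact h1.elim
  | nil =>
    intro p _ _ h2
    cases p <;> exact h2.elim
  | _ => intro p _ h1; exact h1.elim

/-- A cycle of three lexicographic comparisons is a cycle in the second components. -/
theorem lex_cycle {α : Type*} {r : α → α → Prop} {a b c : α} {P Q R : Prop}
    (h1 : r a b → ¬ r b a) (h2 : r b c → ¬ r c b) (h3 : r c a → ¬ r a c)
    (h : r a b → r b c → ¬ r c a) (hP : r a b ∨ (a = b ∧ P)) (hQ : r b c ∨ (b = c ∧ Q))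
    (hR : r c a ∨ (c = a ∧ R)) : P ∧ Q ∧ R := by
  rcases hP with hP | ⟨rfl, hP⟩
  · rcases hQ with hQ | ⟨rfl, hQ⟩
    · rcases hR with hR | ⟨rfl, hR⟩
      · exact (h hP hQ hR).elim
      · exact (h1 hP hQ).elim
    · rcases hR with hR | ⟨rfl, hR⟩
      · exact (h1 hP hR).elim
      · exact (h1 hP hP).elim
  · rcases hQ with hQ | ⟨rfl, hQ⟩
    · rcases hR with hR | ⟨rfl, hR⟩
      · exact (h2 hQ hR).elim
      · exact (h2 hQ hQ).elim
    · rcases hR with hR | ⟨_, hR⟩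
      · exact (h3 hR hR).elim
      · exact ⟨hP, hQ, hR⟩

theorem seqLt_cycle : ∀ {q p r : Dg},
    (∀ x y, InQ x q → InQ y p → lt x y → ¬ lt y x) →
    (∀ x y, InQ x p → InQ y r → lt x y → ¬ lt y x) →
    (∀ x y, InQ x r → InQ y q → lt x y → ¬ lt y x) →
    (∀ x y z, InQ x q → InQ y p → InQ z r → lt x y → lt y z → ¬ lt z x) →
    SeqLt lt q p → SeqLt lt p r → ¬ SeqLt lt r q := by
  intro q
  induction q with
  | cons j k t n q _ _ _ ih =>
    intro p r h12 h23 h31 h h1 h2 h3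
    cases p with
    | cons j' k' t' n' q' =>
      cases r with
      | cons j'' k'' t'' n'' q'' =>
        have mk : ∀ {j k t n q}, InQ k (cons j k t n q) := fun {_ _ _ _ _} =>
          inQ_cons.2 (Or.inl rfl)
        have mt : ∀ {j k t n q}, InQ t (cons j k t n q) := fun {_ _ _ _ _} =>
          inQ_cons.2 (Or.inr (Or.inl rfl))
        have mn : ∀ {j k t n q}, InQ n (cons j k t n q) := fun {_ _ _ _ _} =>
          inQ_cons.2 (Or.inr (Or.inr (Or.inl rfl)))
        have mq : ∀ {x j k t n q}, InQ x q → InQ x (cons j k t n q) :=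
          fun {_ _ _ _ _ _} h => inQ_cons.2 (Or.inr (Or.inr (Or.inr h)))
        have g1 := fun x y hx hy => h12 x y (mq hx) (mq hy)
        have g2 := fun x y hx hy => h23 x y (mq hx) (mq hy)
        have g3 := fun x y hx hy => h31 x y (mq hx) (mq hy)
        obtain ⟨h1, h2, h3⟩ := lex_cycle (seqLt_asymm g1) (seqLt_asymm g2) (seqLt_asymm g3)
          (ih g1 g2 g3 fun x y z hx hy hz => h x y z (mq hx) (mq hy) (mq hz)) h1 h2 h3
        obtain ⟨h1, h2, h3⟩ := lex_cycle Nat.lt_asymm Nat.lt_asymm Nat.lt_asymm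
          (fun a b => Nat.lt_asymm (Nat.lt_trans a b)) h1 h2 h3
        obtain ⟨h1, h2, h3⟩ := lex_cycle (h12 _ _ mk mk) (h23 _ _ mk mk) (h31 _ _ mk mk)
          (h _ _ _ mk mk mk) h1 h2 h3
        obtain ⟨h1, h2, h3⟩ := lex_cycle (h12 _ _ mt mt) (h23 _ _ mt mt) (h31 _ _ mt mt)
          (h _ _ _ mt mt mt) h1 h2 h3
        exact h _ _ _ mn mn mn h1 h2 h3
      | _ => exact h2.elim
    | _ => exact h1.elim
  | nil =>
    intro p r _ _ _ _ _ h2 h3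
    cases r <;> cases p <;> first | exact h2.elim | exact h3.elim
  | _ => intro p r _ _ _ _ h1; exact h1.elim

namespace Lin

variable {s : ℕ} (L : Lin s)
include L

theorem cycle {x y z : Dg} (hx : WF x) (hy : WF y) (hz : WF z) (hs : ms x + ms y + ms z < s)
    (h1 : lt x y) (h2 : lt y z) : ¬ lt z x := by
  have := ms_pos y
  exact L.asym hx hz (by omega) (L.trans hx hy hz hs h1 h2)

theorem asym_of_le {x y : Dg} (hx : WF x) (hy : WF y) (hs : ms x + ms y < s) (h1 : lt x y) :
    ¬ le y x := by
  rintro (h | rfl)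
  · exact L.asym hx hy hs h1 h
  · exact L.asym hx hx hs h1 h1

theorem cycle_of_le {x y z : Dg} (hx : WF x) (hy : WF y) (hz : WF z)
    (hs : ms x + ms y + ms z < s) (h1 : lt x y) (h2 : lt y z) : ¬ le z x := by
  rintro (h | rfl)
  · exact L.cycle hx hy hz hs h1 h2 h
  · have := ms_pos z
    exact L.asym hz hy (by omega) h1 h2

/-- Suppose two collapsed diagrams are below each other. If α < β holds through α ≤ k for a
coefficient k of β, then β < α yields k < α. If it holds through σ ≤ β, then β < α yields β < σ.
What remains are equal subscripts with the lexicographic alternative on both sides. -/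
theorem asym_sc {x y : Dg} (hx : WF x) (hy : WF y) (sx : IsSC x) (sy : IsSC y)
    (hs : ms x + ms y ≤ s) (h1 : lt x y) : ¬ lt y x := by
  intro h2
  have nc : ∀ {a τ b p : Dg}, WF (next a) → WF (col τ b p) → ms (next a) + ms (col τ b p) ≤ s →
      lt (next a) (col τ b p) → lt (col τ b p) (next a) → False := by
    intro a τ b p hx hy hs h1 h2
    have ea := ms_lt (x := a) (y := next a) (by simp only [size]; omega)
    have eτ := ms_lt (x := τ) (y := col τ b p) (by simp only [size]; omega)
    have := ms_pos a
    have := ms_pos τ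
    obtain ⟨h3, h4⟩ := next_lt_col.1 h1
    rcases col_lt_next.1 h2 with h | h
    · exact L.asym_of_le hx hy.ixOd (by omega) h3 h
    · exact L.asym_of_le hx.next_arg hy (by omega) h4 h
  rcases sx.cases with rfl | rfl | ⟨a, rfl⟩ | ⟨σ, a, q, rfl⟩
  · rcases sy.cases with rfl | rfl | ⟨b, rfl⟩ | ⟨τ, b, p, rfl⟩
    · exact not_omega_lt_omega h1
    · exact not_pi_lt_sc sx h2
    · exact not_next_lt_omega h2
    · exact omega_lt_col.1 h1 (col_lt_omega.1 h2)
  · exact not_pi_lt_sc sy h1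
  · rcases sy.cases with rfl | rfl | ⟨b, rfl⟩ | ⟨τ, b, p, rfl⟩
    · exact not_next_lt_omega h1
    · exact not_pi_lt_sc sx h2
    · have ea := ms_lt (x := a) (y := next a) (by simp only [size]; omega)
      have eb := ms_lt (x := b) (y := next b) (by simp only [size]; omega)
      have := ms_pos a
      exact L.asym hx.next_arg hy.next_arg (by omega) (next_lt_next.1 h1) (next_lt_next.1 h2)
    · exact nc hx hy hs h1 h2
  · rcases sy.cases with rfl | rfl | ⟨b, rfl⟩ | ⟨τ, b, p, rfl⟩
    · exact omega_lt_col.1 h2 (col_lt_omega.1 h1)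
    · exact not_pi_lt_sc sx h2
    · exact nc hy hx (by omega) h2 h1
    · have t1 : ∀ {σ a q τ b p μ k : Dg}, WF (col σ a q) → WF (col τ b p) →
          ms (col σ a q) + ms (col τ b p) ≤ s → lt (col τ b p) (col σ a q) → le μ τ →
          k ∈ Kc μ (col τ b p) → le (col σ a q) k → False := by
        intro σ a q τ b p μ k hx hy hs h2 hμ hk h
        have pk := ms_pos (col σ a q)
        have ek := ms_lt (size_lt_of_mem_Kc hk)
        have pk := ms_pos k
        have hh := L.hid_of_mem_Kc hy (by omega) hμ hk
        have h3 := L.hid_lt hy trivial hx trivial (by omega) hh h2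
        exact L.asym_of_le (hy.mem_Kc hk) hx (by omega) h3 h
      have t2 : ∀ {σ a q τ b p : Dg}, WF (col σ a q) → WF (col τ b p) →
          ms (col σ a q) + ms (col τ b p) ≤ s → lt (col σ a q) (col τ b p) →
          lt (col τ b p) (col σ a q) → ¬ lt σ τ := by
        intro σ a q τ b p hx hy hs h1 h2 h
        have eσ := ms_lt (x := σ) (y := col σ a q) (by simp only [size]; omega)
        have pσ := ms_pos σ
        rcases (L.col_lt_of_lt hx hy hs h).1 h1 with h3 | ⟨k, hk, h3⟩
        · exact L.asym_of_le hy hx.ixOd (by omega)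
            (L.lt_ix_of_lt hy trivial hx (by omega) h2) h3
        · exact t1 hx hy hs h2 (Or.inl h) hk h3
      rcases tri hx.ixOd hy.ixOd with h | rfl | h
      · exact t2 hx hy hs h1 h2 h
      · have pa := ms_pos (col σ a q)
        have pb := ms_pos (col σ b p)
        have ea := ms_lt (x := a) (y := col σ a q) (by simp only [size]; omega)
        have eb := ms_lt (x := b) (y := col σ b p) (by simp only [size]; omega)
        rcases (L.col_lt_of_eq hx (by omega)).1 h1 with ⟨k, hk, h3⟩ | ⟨_, h3⟩
        · exact t1 hx hy hs h2 (le_refl _) hk h3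
        rcases (L.col_lt_of_eq hy (by omega)).1 h2 with ⟨k, hk, h4⟩ | ⟨_, h4⟩
        · exact t1 hy hx (by omega) h1 (le_refl _) hk h4
        have wa := hx.comp (t := a) (Or.inr (Or.inl rfl))
        have wb := hy.comp (t := b) (Or.inr (Or.inl rfl))
        rcases h3 with h3 | ⟨e, h3⟩
        · exact L.asym_of_le wa wb (by omega) h3 (h4.imp id fun h => h.1)
        · rcases h4 with h4 | ⟨_, h4⟩
          · exact L.asym_of_le wb wa (by omega) h4 (Or.inr e)
          · refine seqLt_asymm (fun x y hx' hy' => ?_) h3 h4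
            have cx : Comp x (col σ a q) := Or.inr (Or.inr hx')
            have cy : Comp y (col σ b p) := Or.inr (Or.inr hy')
            have := ms_lt cx.size_lt
            have := ms_lt cy.size_lt
            exact L.asym (hx.comp cx) (hy.comp cy) (by omega)
      · exact t2 hy hx (by omega) h2 h1 h

theorem asym_succ {x y : Dg} (hx : WF x) (hy : WF y) (hs : ms x + ms y ≤ s) (h1 : lt x y) :
    ¬ lt y x := by
  intro h2
  have px := ms_pos x
  have py := ms_pos y
  have ap : ∀ {a b y : Dg}, WF (add a b) → WF y → IsPrin y → ms (add a b) + ms y ≤ s →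
      lt (add a b) y → lt y (add a b) → False := by
    intro a b y hx hy py hs h1 h2
    have ea := ms_lt (x := a) (y := add a b) (by simp only [size]; omega)
    have := ms_pos a
    rw [add_lt_prin py] at h1
    rw [prin_lt_add py] at h2
    exact L.asym_of_le hx.add_left hy (by omega) h1 h2
  have ps : ∀ {a b y : Dg}, WF (phi a b) → WF y → IsSC y → ms (phi a b) + ms y ≤ s →
      lt (phi a b) y → lt y (phi a b) → False := by
    intro a b y hx hy py hs h1 h2
    have ea := ms_lt (x := a) (y := phi a b) (by simp only [size]; omega)
    have eb := ms_lt (x := b) (y := phi a b) (by simp only [size]; omega)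
    have := ms_pos a
    have := ms_pos b
    rw [phi_lt_sc py] at h1
    rw [sc_lt_phi py] at h2
    rcases h2 with h2 | h2
    · exact L.asym_of_le hx.phi_left hy (by omega) h1.1 h2
    · exact L.asym_of_le hx.phi_right hy (by omega) h1.2 h2
  rcases hx.cases4 with rfl | ⟨a, b, rfl⟩ | ⟨a, b, rfl⟩ | sx
  · exact not_lt_zero h2
  · rcases hy.cases4 with rfl | ⟨c, d, rfl⟩ | ⟨c, d, rfl⟩ | sy
    · exact not_lt_zero h1
    · have ea := ms_lt (x := a) (y := add a b) (by simp only [size]; omega)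
      have eb := ms_lt (x := b) (y := add a b) (by simp only [size]; omega)
      have ec := ms_lt (x := c) (y := add c d) (by simp only [size]; omega)
      have ed := ms_lt (x := d) (y := add c d) (by simp only [size]; omega)
      have i1 := L.asym hx.add_left hy.add_left (by omega)
      have i2 := L.asym hx.add_right hy.add_right (by omega)
      rw [add_lt_add] at h1 h2
      grind
    · exact ap hx hy trivial hs h1 h2
    · exact ap hx hy sy.prin hs h1 h2
  · rcases hy.cases4 with rfl | ⟨c, d, rfl⟩ | ⟨c, d, rfl⟩ | sy
    · exact not_lt_zero h1
    · exact ap hy hx trivial (by omega) h2 h1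
    · have ea := ms_lt (x := a) (y := phi a b) (by simp only [size]; omega)
      have eb := ms_lt (x := b) (y := phi a b) (by simp only [size]; omega)
      have ec := ms_lt (x := c) (y := phi c d) (by simp only [size]; omega)
      have ed := ms_lt (x := d) (y := phi c d) (by simp only [size]; omega)
      have i1 := L.asym hx.phi_left hy.phi_left (by omega)
      have i2 := L.asym hx.phi_right hy.phi_right (by omega)
      have i3 := L.asym hx.phi_right hy (by omega)
      have i4 := L.asym hx hy.phi_right (by omega)
      rw [phi_lt_phi] at h1 h2
      grind
    · exact ps hx hy sy hs h1 h2
  · rcases hy.cases4 with rfl | ⟨c, d, rfl⟩ | ⟨c, d, rfl⟩ | sy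
    · exact not_lt_zero h1
    · exact ap hy hx sx.prin (by omega) h2 h1
    · exact ps hy hx sx (by omega) h2 h1
    · exact L.asym_sc hx hy sx sy hs h1 h2

/-- The argument of `asym_sc` shows that along a 3-cycle no subscript is below the next one. Hence
the three subscripts coincide, only the lexicographic alternatives remain, and they give a cycle in
the components. -/
theorem cycle_col {σ a q τ b p ρ c r : Dg} (hx : WF (col σ a q)) (hy : WF (col τ b p))
    (hz : WF (col ρ c r)) (hs : ms (col σ a q) + ms (col τ b p) + ms (col ρ c r) ≤ s)
    (h1 : lt (col σ a q) (col τ b p)) (h2 : lt (col τ b p) (col ρ c r)) :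
    ¬ lt (col ρ c r) (col σ a q) := by
  intro h3
  have t1 : ∀ {σ a q τ b p ρ c r μ k : Dg}, WF (col σ a q) → WF (col τ b p) → WF (col ρ c r) →
      ms (col σ a q) + ms (col τ b p) + ms (col ρ c r) ≤ s → lt (col τ b p) (col ρ c r) →
      lt (col ρ c r) (col σ a q) → le μ τ → k ∈ Kc μ (col τ b p) → le (col σ a q) k → False := by
    intro σ a q τ b p ρ c r μ k hx hy hz hs h2 h3 hμ hk h
    have pa := ms_pos (col σ a q)
    have pk := ms_pos k
    have ek := ms_lt (size_lt_of_mem_Kc hk)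
    have hh := L.hid_of_mem_Kc hy (by omega) hμ hk
    have h4 := L.hid_lt hy trivial hz trivial (by omega) hh h2
    exact L.cycle_of_le (hy.mem_Kc hk) hz hx (by omega) h4 h3 h
  have t2 : ∀ {σ a q τ b p ρ c r : Dg}, WF (col σ a q) → WF (col τ b p) → WF (col ρ c r) →
      ms (col σ a q) + ms (col τ b p) + ms (col ρ c r) ≤ s → lt (col σ a q) (col τ b p) →
      lt (col τ b p) (col ρ c r) → lt (col ρ c r) (col σ a q) → ¬ lt σ τ := by
    intro σ a q τ b p ρ c r hx hy hz hs h1 h2 h3 h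
    have eσ := ms_lt (x := σ) (y := col σ a q) (by simp only [size]; omega)
    have pσ := ms_pos σ
    rcases (L.col_lt_of_lt hx hy (by omega) h).1 h1 with h4 | ⟨k, hk, h4⟩
    · exact L.cycle_of_le hy hz hx.ixOd (by omega) h2
        (L.lt_ix_of_lt hz trivial hx (by omega) h3) h4
    · exact t1 hx hy hz hs h2 h3 (Or.inl h) hk h4
  have n1 := t2 hx hy hz hs h1 h2 h3
  have n2 := t2 hy hz hx (by omega) h2 h3 h1
  have n3 := t2 hz hx hy (by omega) h3 h1 h2
  have pa := ms_pos (col σ a q)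
  have pb := ms_pos (col τ b p)
  have pc := ms_pos (col ρ c r)
  have eσ := ms_lt (x := σ) (y := col σ a q) (by simp only [size]; omega)
  have eτ := ms_lt (x := τ) (y := col τ b p) (by simp only [size]; omega)
  have eρ := ms_lt (x := ρ) (y := col ρ c r) (by simp only [size]; omega)
  have e1 := (tri hx.ixOd hy.ixOd).resolve_left n1
  have e2 := (tri hy.ixOd hz.ixOd).resolve_left n2
  have e3 := (tri hz.ixOd hx.ixOd).resolve_left n3
  have a1 := L.asym hx.ixOd hy.ixOd (by omega)
  have a2 := L.asym hy.ixOd hz.ixOd (by omega)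
  have a3 := L.cycle hx.ixOd hz.ixOd hy.ixOd (by omega)
  obtain ⟨rfl, rfl⟩ : σ = τ ∧ τ = ρ := by grind
  have ea := ms_lt (x := a) (y := col σ a q) (by simp only [size]; omega)
  have eb := ms_lt (x := b) (y := col σ b p) (by simp only [size]; omega)
  have ec := ms_lt (x := c) (y := col σ c r) (by simp only [size]; omega)
  have pa' := ms_pos a
  have pb' := ms_pos b
  have pc' := ms_pos c
  rcases (L.col_lt_of_eq hx (by omega)).1 h1 with ⟨k, hk, g⟩ | ⟨_, g1⟩
  · exact t1 hx hy hz hs h2 h3 (le_refl _) hk g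
  rcases (L.col_lt_of_eq hy (by omega)).1 h2 with ⟨k, hk, g⟩ | ⟨_, g2⟩
  · exact t1 hy hz hx (by omega) h3 h1 (le_refl _) hk g
  rcases (L.col_lt_of_eq hz (by omega)).1 h3 with ⟨k, hk, g⟩ | ⟨_, g3⟩
  · exact t1 hz hx hy (by omega) h1 h2 (le_refl _) hk g
  have wa := hx.comp (t := a) (Or.inr (Or.inl rfl))
  have wb := hy.comp (t := b) (Or.inr (Or.inl rfl))
  have wc := hz.comp (t := c) (Or.inr (Or.inl rfl))
  have b1 := L.asym wa wb (by omega)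
  have b2 := L.asym wb wc (by omega)
  have b3 := L.asym wc wa (by omega)
  have b4 := L.cycle wa wb wc (by omega)
  have sq : SeqLt lt q p → SeqLt lt p r → SeqLt lt r q → False := by
    have cq : ∀ {x}, InQ x q → Comp x (col σ a q) := fun h => Or.inr (Or.inr h)
    have cp : ∀ {x}, InQ x p → Comp x (col σ b p) := fun h => Or.inr (Or.inr h)
    have cr : ∀ {x}, InQ x r → Comp x (col σ c r) := fun h => Or.inr (Or.inr h)
    refine seqLt_cycle (fun x y h1 h2 => ?_) (fun x y h1 h2 => ?_) (fun x y h1 h2 => ?_)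
      (fun x y z h1 h2 h3 => ?_)
    · have := ms_lt (cq h1).size_lt
      have := ms_lt (cp h2).size_lt
      exact L.asym (hx.comp (cq h1)) (hy.comp (cp h2)) (by omega)
    · have := ms_lt (cp h1).size_lt
      have := ms_lt (cr h2).size_lt
      exact L.asym (hy.comp (cp h1)) (hz.comp (cr h2)) (by omega)
    · have := ms_lt (cr h1).size_lt
      have := ms_lt (cq h2).size_lt
      exact L.asym (hz.comp (cr h1)) (hx.comp (cq h2)) (by omega)
    · have := ms_lt (cq h1).size_lt
      have := ms_lt (cp h2).size_lt
      have := ms_lt (cr h3).size_lt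
      exact L.cycle (hx.comp (cq h1)) (hy.comp (cp h2)) (hz.comp (cr h3)) (by omega)
  clear t1 t2
  grind

theorem cycle_sc {x y z : Dg} (hx : WF x) (hy : WF y) (hz : WF z) (sx : IsSC x) (sy : IsSC y)
    (sz : IsSC z) (hs : ms x + ms y + ms z ≤ s) (h1 : lt x y) (h2 : lt y z) : ¬ lt z x := by
  have om : ∀ {y z : Dg}, WF y → WF z → IsSC y → IsSC z → ms omega + ms y + ms z ≤ s →
      lt omega y → lt y z → lt z omega → False := by
    intro y z hy hz sy sz hs h1 h2 h3
    have pz := ms_pos z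
    have po := ms_pos omega
    rcases sz.cases with rfl | rfl | ⟨a, rfl⟩ | ⟨ρ, c, r, rfl⟩
    · exact not_omega_lt_omega h3
    · exact not_pi_lt_sc (y := omega) trivial h3
    · exact not_next_lt_omega h3
    · rw [col_lt_omega] at h3
      subst h3
      exact L.asym .omega hy (by omega) h1 (L.lt_ix_of_lt hy sy hz (by omega) h2)
  have nncol : ∀ {a b τ c p : Dg}, WF (next a) → WF (next b) → WF (col τ c p) →
      ms (next a) + ms (next b) + ms (col τ c p) ≤ s → lt (next a) (next b) →
      lt (next b) (col τ c p) → lt (col τ c p) (next a) → False := by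
    intro a b τ c p hx hy hz hs h1 h2 h3
    have ea := ms_lt (x := a) (y := next a) (by simp only [size]; omega)
    have eb := ms_lt (x := b) (y := next b) (by simp only [size]; omega)
    have eτ := ms_lt (x := τ) (y := col τ c p) (by simp only [size]; omega)
    have := ms_pos a
    have := ms_pos b
    have := ms_pos τ
    obtain ⟨h4, h5⟩ := next_lt_col.1 h2
    rcases col_lt_next.1 h3 with h | h
    · exact L.cycle_of_le hx hy hz.ixOd (by omega) h1 h4 h
    · exact L.cycle_of_le hx.next_arg hy.next_arg hz (by omega) (next_lt_next.1 h1) h5 h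
  have ncc : ∀ {a τ b p ρ c r : Dg}, WF (next a) → WF (col τ b p) → WF (col ρ c r) →
      ms (next a) + ms (col τ b p) + ms (col ρ c r) ≤ s → lt (next a) (col τ b p) →
      lt (col τ b p) (col ρ c r) → lt (col ρ c r) (next a) → False := by
    intro a τ b p ρ c r hx hy hz hs h1 h2 h3
    have ea := ms_lt (x := a) (y := next a) (by simp only [size]; omega)
    have eρ := ms_lt (x := ρ) (y := col ρ c r) (by simp only [size]; omega)
    have := ms_pos a
    have := ms_pos ρ
    rcases col_lt_next.1 h3 with h | h
    · exact L.cycle_of_le hx hy hz.ixOd (by omega) h1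
        (L.lt_ix_of_lt hy trivial hz (by omega) h2) h
    · exact L.cycle_of_le hx.next_arg hy hz (by omega) (next_lt_col.1 h1).2 h2 h
  intro h3
  rcases sx.cases with rfl | rfl | ⟨a, rfl⟩ | ⟨σ, a, q, rfl⟩
  · exact om hy hz sy sz hs h1 h2 h3
  · exact not_pi_lt_sc sy h1
  · rcases sy.cases with rfl | rfl | ⟨b, rfl⟩ | ⟨τ, b, p, rfl⟩
    · exact om hz hx sz sx (by omega) h2 h3 h1
    · exact not_pi_lt_sc sz h2
    · rcases sz.cases with rfl | rfl | ⟨c, rfl⟩ | ⟨ρ, c, r, rfl⟩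
      · exact om hx hy sx sy (by omega) h3 h1 h2
      · exact not_pi_lt_sc sx h3
      · have ea := ms_lt (x := a) (y := next a) (by simp only [size]; omega)
        have eb := ms_lt (x := b) (y := next b) (by simp only [size]; omega)
        have ec := ms_lt (x := c) (y := next c) (by simp only [size]; omega)
        have := ms_pos a
        exact L.cycle hx.next_arg hy.next_arg hz.next_arg (by omega) (next_lt_next.1 h1)
          (next_lt_next.1 h2) (next_lt_next.1 h3)
      · exact nncol hx hy hz hs h1 h2 h3
    · rcases sz.cases with rfl | rfl | ⟨c, rfl⟩ | ⟨ρ, c, r, rfl⟩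
      · exact om hx hy sx sy (by omega) h3 h1 h2
      · exact not_pi_lt_sc sx h3
      · exact nncol hz hx hy (by omega) h3 h1 h2
      · exact ncc hx hy hz hs h1 h2 h3
  · rcases sy.cases with rfl | rfl | ⟨b, rfl⟩ | ⟨τ, b, p, rfl⟩
    · exact om hz hx sz sx (by omega) h2 h3 h1
    · exact not_pi_lt_sc sz h2
    · rcases sz.cases with rfl | rfl | ⟨c, rfl⟩ | ⟨ρ, c, r, rfl⟩
      · exact om hx hy sx sy (by omega) h3 h1 h2
      · exact not_pi_lt_sc sx h3
      · exact nncol hy hz hx (by omega) h2 h3 h1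
      · exact ncc hy hz hx (by omega) h2 h3 h1
    · rcases sz.cases with rfl | rfl | ⟨c, rfl⟩ | ⟨ρ, c, r, rfl⟩
      · exact om hx hy sx sy (by omega) h3 h1 h2
      · exact not_pi_lt_sc sx h3
      · exact ncc hz hx hy (by omega) h3 h1 h2
      · exact L.cycle_col hx hy hz hs h1 h2 h3

theorem cycle_add {a b y z : Dg} (hx : WF (add a b)) (hy : WF y) (hz : WF z)
    (ny : y ≠ zero) (hs : ms (add a b) + ms y + ms z ≤ s) (h1 : lt (add a b) y) (h2 : lt y z) :
    ¬ lt z (add a b) := by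
  intro h3
  have ea := ms_lt (x := a) (y := add a b) (by simp only [size]; omega)
  have eb := ms_lt (x := b) (y := add a b) (by simp only [size]; omega)
  have pa := ms_pos a
  have pb := ms_pos b
  have wa := hx.add_left
  have pr : ∀ x, WF x → x ≠ zero → IsPrin x ∨ ∃ c d, x = add c d := by
    intro x hx hne
    rcases hx.cases4 with h | h | ⟨a, b, rfl⟩ | h
    exacts [(hne h).elim, Or.inr h, Or.inl trivial, Or.inl h.prin]
  have nz : z ≠ zero := by rintro rfl; exact not_lt_zero h2
  rcases pr y hy ny with py | ⟨c, d, rfl⟩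
  · rw [add_lt_prin py] at h1
    rcases pr z hz nz with pz | ⟨e, f, rfl⟩
    · rw [prin_lt_add pz] at h3
      exact L.cycle_of_le wa hy hz (by omega) h1 h2 h3
    · have ee := ms_lt (x := e) (y := add e f) (by simp only [size]; omega)
      have pe := ms_pos e
      rw [prin_lt_add py] at h2
      have i1 := L.cycle wa hy hz.add_left (by omega) h1
      have i2 := L.asym wa hy (by omega) h1
      have i3 := L.asym hz.add_left wa (by omega)
      rw [add_lt_add] at h3
      unfold le at h2
      grind
  · have ec := ms_lt (x := c) (y := add c d) (by simp only [size]; omega)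
    have ed := ms_lt (x := d) (y := add c d) (by simp only [size]; omega)
    have pc := ms_pos c
    have pd := ms_pos d
    rw [add_lt_add] at h1
    have wc := hy.add_left
    rcases pr z hz nz with pz | ⟨e, f, rfl⟩
    · rw [prin_lt_add pz, le] at h3
      rw [add_lt_prin pz] at h2
      have i1 := L.cycle wa wc hz (by omega)
      have i2 := L.asym wa hz (by omega)
      have i3 := L.asym wc wa (by omega)
      grind
    · have ee := ms_lt (x := e) (y := add e f) (by simp only [size]; omega)
      have ef := ms_lt (x := f) (y := add e f) (by simp only [size]; omega)
      have pe := ms_pos e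
      have pf := ms_pos f
      rw [add_lt_add] at h2 h3
      have we := hz.add_left
      have i1 := L.cycle wa wc we (by omega)
      have i2 := L.cycle hx.add_right hy.add_right hz.add_right (by omega)
      have i3 := L.asym wa wc (by omega)
      have i4 := L.asym wa we (by omega)
      have i5 := L.asym wc we (by omega)
      grind

theorem cycle_phi {a b y z : Dg} (hx : WF (phi a b)) (hy : WF y) (hz : WF z)
    (py : IsPrin y) (pz : IsPrin z) (hs : ms (phi a b) + ms y + ms z ≤ s)
    (h1 : lt (phi a b) y) (h2 : lt y z) : ¬ lt z (phi a b) := by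
  intro h3
  have ea := ms_lt (x := a) (y := phi a b) (by simp only [size]; omega)
  have eb := ms_lt (x := b) (y := phi a b) (by simp only [size]; omega)
  have pa := ms_pos a
  have pb := ms_pos b
  have wa := hx.phi_left
  have wb := hx.phi_right
  have pr : ∀ x, IsPrin x → IsSC x ∨ ∃ c d, x = phi c d := by
    intro x hx
    cases x <;> simp_all [IsPrin, IsSC]
  rcases pr y py with sy | ⟨c, d, rfl⟩
  · rw [phi_lt_sc sy] at h1
    rcases pr z pz with sz | ⟨e, f, rfl⟩
    · rw [sc_lt_phi sz] at h3
      rcases h3 with h3 | h3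
      · exact L.cycle_of_le wa hy hz (by omega) h1.1 h2 h3
      · exact L.cycle_of_le wb hy hz (by omega) h1.2 h2 h3
    · have ee := ms_lt (x := e) (y := phi e f) (by simp only [size]; omega)
      have ef := ms_lt (x := f) (y := phi e f) (by simp only [size]; omega)
      have pe := ms_pos e
      have pf := ms_pos f
      have we := hz.phi_left
      have wf := hz.phi_right
      rw [sc_lt_phi sy] at h2
      rw [phi_lt_phi] at h3
      have hy1 := L.asym_of_le wa hy (by omega) h1.1
      have hy2 := L.asym_of_le wb hy (by omega) h1.2
      have i1 := L.cycle_of_le we wa hy (by omega)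
      have i2 := L.cycle_of_le wf wb hy (by omega)
      have i3 := L.cycle_of_le wf hx hy (by omega)
      have i4 := L.cycle_of_le hz wb hy (by omega)
      have i5 : lt (phi a b) y := (phi_lt_sc sy).2 h1
      have i6 : le y e ∨ le y f → lt y (phi e f) := (sc_lt_phi sy).2
      have i7 := L.asym hy wa (by omega)
      have i8 := L.asym wb hy (by omega) h1.2
      have i9 := L.cycle wb hy hz (by omega) h1.2
      grind
  · have ec := ms_lt (x := c) (y := phi c d) (by simp only [size]; omega)
    have ed := ms_lt (x := d) (y := phi c d) (by simp only [size]; omega)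
    have pc := ms_pos c
    have pd := ms_pos d
    have wc := hy.phi_left
    have wd := hy.phi_right
    rcases pr z pz with sz | ⟨e, f, rfl⟩
    · rw [phi_lt_sc sz] at h2
      rw [sc_lt_phi sz] at h3
      have i0 : lt (phi c d) z := (phi_lt_sc sz).2 h2
      rw [phi_lt_phi] at h1
      have i1 := L.cycle_of_le wa wc hz (by omega)
      have i2 := L.cycle_of_le wb wd hz (by omega)
      have i3 := L.cycle_of_le wb hy hz (by omega)
      have i4 := L.cycle hx wd hz (by omega)
      have i5 : lt z (phi a b) := (sc_lt_phi sz).2 h3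
      have i6 := L.asym_of_le wc hz (by omega)
      have i7 := L.asym_of_le wd hz (by omega)
      grind
    · have ee := ms_lt (x := e) (y := phi e f) (by simp only [size]; omega)
      have ef := ms_lt (x := f) (y := phi e f) (by simp only [size]; omega)
      have pe := ms_pos e
      have pf := ms_pos f
      have we := hz.phi_left
      have wf := hz.phi_right
      have i1 := L.cycle wa wc we (by omega)
      have i2 := L.cycle wb wd wf (by omega)
      have i3 := L.cycle wb hy hz (by omega)
      have i4 := L.cycle hx wd hz (by omega)
      have i5 := L.cycle hx hy wf (by omega)
      have i6 := L.asym wa wc (by omega)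
      have i7 := L.asym wc we (by omega)
      have i8 := L.asym we wa (by omega)
      have h1' := h1
      have h2' := h2
      have h3' := h3
      rw [phi_lt_phi] at h1 h2 h3
      have j1 := L.cycle wb wd hz (by omega)
      have j2 := L.cycle wb hy wf (by omega)
      have j3 := L.cycle hx wd wf (by omega)
      rcases h1 with ⟨h1, g1⟩ | ⟨rfl, g1⟩ | ⟨h1, g1⟩
      · rcases h2 with ⟨h2, g2⟩ | ⟨rfl, g2⟩ | ⟨h2, g2⟩
        · exact i3 g1 h2' (by grind)
        · exact i3 g1 h2' (by grind)
        · rcases h3 with ⟨h3, g3⟩ | ⟨rfl, g3⟩ | ⟨h3, g3⟩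
          · exact i5 h1' g2 g3
          · exact j2 g1 g2 g3
          · exact i3 g1 h2' g3
      · rcases h2 with ⟨h2, g2⟩ | ⟨rfl, g2⟩ | ⟨h2, g2⟩
        · rcases h3 with ⟨h3, g3⟩ | ⟨rfl, g3⟩ | ⟨h3, g3⟩
          · exact (i8 h3 h2).elim
          · exact (i7 h2 h2).elim
          · exact j1 g1 g2 g3
        · rcases h3 with ⟨h3, g3⟩ | ⟨_, g3⟩ | ⟨h3, g3⟩
          · exact (i6 h3 h3).elim
          · exact i2 g1 g2 g3
          · exact (i6 h3 h3).elim
        · rcases h3 with ⟨h3, g3⟩ | ⟨rfl, g3⟩ | ⟨h3, g3⟩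
          · exact i5 h1' g2 g3
          · exact (i6 h2 h2).elim
          · exact (i8 h2 h3).elim
      · rcases h2 with ⟨h2, g2⟩ | ⟨rfl, g2⟩ | ⟨h2, g2⟩
        · exact i4 g1 g2 h3'
        · rcases h3 with ⟨h3, g3⟩ | ⟨rfl, g3⟩ | ⟨h3, g3⟩
          · exact j3 g1 g2 g3
          · exact (i7 h1 h1).elim
          · exact (i6 h3 h1).elim
        · rcases h3 with ⟨h3, g3⟩ | ⟨rfl, g3⟩ | ⟨h3, g3⟩
          · exact i5 h1' g2 g3
          · exact (i7 h1 h2).elim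
          · exact (L.cycle we wc wa (by omega) h2 h1 h3).elim

/-- With totality, transitivity means that there are no 3-cycles. This form is invariant under
rotation, so a sum, or failing that a Veblen term, may be assumed to stand first. -/
theorem cycle_succ {x y z : Dg} (hx : WF x) (hy : WF y) (hz : WF z)
    (hs : ms x + ms y + ms z ≤ s) (h1 : lt x y) (h2 : lt y z) : ¬ lt z x := by
  intro h3
  have nx : x ≠ zero := by rintro rfl; exact not_lt_zero h3
  have ny : y ≠ zero := by rintro rfl; exact not_lt_zero h1
  have nz : z ≠ zero := by rintro rfl; exact not_lt_zero h2
  rcases hx.cases4 with h | ⟨a, b, rfl⟩ | hpx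
  · exact nx h
  · exact L.cycle_add hx hy hz ny hs h1 h2 h3
  rcases hy.cases4 with h | ⟨a, b, rfl⟩ | hpy
  · exact ny h
  · exact L.cycle_add hy hz hx nz (by omega) h2 h3 h1
  rcases hz.cases4 with h | ⟨a, b, rfl⟩ | hpz
  · exact nz h
  · exact L.cycle_add hz hx hy nx (by omega) h3 h1 h2
  have pr : ∀ x, ((∃ a b, x = phi a b) ∨ IsSC x) → IsPrin x := by
    rintro x (⟨a, b, rfl⟩ | h)
    exacts [trivial, h.prin]
  have px := pr x hpx
  have py := pr y hpy
  have pz := pr z hpz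
  rcases hpx with ⟨a, b, rfl⟩ | sx
  · exact L.cycle_phi hx hy hz py pz hs h1 h2 h3
  rcases hpy with ⟨a, b, rfl⟩ | sy
  · exact L.cycle_phi hy hz hx pz px (by omega) h2 h3 h1
  rcases hpz with ⟨a, b, rfl⟩ | sz
  · exact L.cycle_phi hz hx hy px py (by omega) h3 h1 h2
  exact L.cycle_sc hx hy hz sx sy sz hs h1 h2 h3

theorem succ : Lin (s + 1) where
  asym hx hy hs h1 := L.asym_succ hx hy (by omega) h1
  trans {x y z} hx hy hz hs h1 h2 := by
    have := ms_pos z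
    rcases tri hx hz with h | rfl | h
    · exact h
    · exact (L.asym_succ hx hy (by omega) h1 h2).elim
    · exact (L.cycle_succ hx hy hz (by omega) h1 h2 h).elim

end Lin

theorem lin (s : ℕ) : Lin s := by
  induction s with
  | zero => exact ⟨fun _ _ h => by omega, fun _ _ _ h => by omega⟩
  | succ s ih => exact ih.succ

/-! ## The linear order of the well-formed diagrams -/

theorem lt_asymm {x y : Dg} (hx : WF x) (hy : WF y) : lt x y → ¬ lt y x :=
  (lin _).asym hx hy (Nat.lt_succ_self _)

theorem lt_irrefl {x : Dg} (hx : WF x) : ¬ lt x x := fun h => lt_asymm hx hx h h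

theorem lt_trans {x y z : Dg} (hx : WF x) (hy : WF y) (hz : WF z) : lt x y → lt y z → lt x z :=
  (lin _).trans hx hy hz (Nat.lt_succ_self _)

theorem lt_of_le_of_lt {x y z : Dg} (hx : WF x) (hy : WF y) (hz : WF z) (h : le x y)
    (h' : lt y z) : lt x z := by
  rcases h with h | rfl
  · exact lt_trans hx hy hz h h'
  · exact h'

theorem lt_of_lt_of_le {x y z : Dg} (hx : WF x) (hy : WF y) (hz : WF z) (h : lt x y)
    (h' : le y z) : lt x z := by
  rcases h' with h' | rfl
  · exact lt_trans hx hy hz h h'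
  · exact h

theorem le_trans {x y z : Dg} (hx : WF x) (hy : WF y) (hz : WF z) (h : le x y)
    (h' : le y z) : le x z := by
  rcases h with h | rfl
  · exact Or.inl (lt_of_lt_of_le hx hy hz h h')
  · exact h'

theorem not_lt_of_le {x y : Dg} (hx : WF x) (hy : WF y) (h : le x y) : ¬ lt y x := by
  rcases h with h | rfl
  · exact lt_asymm hx hy h
  · exact lt_irrefl hx

theorem le_antisymm {x y : Dg} (hx : WF x) (hy : WF y) (h : le x y) (h' : le y x) : x = y := by
  rcases h' with h' | rfl
  · exact (not_lt_of_le hx hy h h').elim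
  · rfl

theorem Prec.lt {x y : Dg} (hx : WF x) (h : Prec x y) : Dg.lt x y :=
  (lin (2 * ms x)).prec_lt hx le_rfl h

theorem PrecEq.le {x y : Dg} (hx : WF x) (h : PrecEq x y) : Dg.le x y :=
  (lin (2 * ms x)).precEq_le hx le_rfl h


/-! ## Subdiagrams and coefficients -/

theorem lt_next {C : Dg → Prop} {c : Dg} (h : IsOd C (next c)) : lt c (next c) := by
  induction c with
  | next d ih => exact next_lt_next.2 (ih h.next_arg)
  | omega => exact omega_lt_next
  | pi => exact (not_wf_next_pi h.wf).elim
  | col σ a q => exact col_lt_next.2 (Or.inr (le_refl _))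
  | _ => exact h.next_sc.elim

theorem lt_add_left {C : Dg → Prop} {a b : Dg} (h : IsOd C (add a b)) : lt a (add a b) := by
  cases h with
  | add _ _ hpa => exact (prin_lt_add hpa).2 (le_refl _)

theorem lt_add_right {C : Dg → Prop} {a b : Dg} (h : IsOd C (add a b)) : lt b (add a b) := by
  induction b generalizing a with
  | add c d _ ih =>
    have hcd := h.add_right
    cases h with
    | add _ _ _ _ hab => exact add_lt_add.2 (hab.imp id fun e => ⟨e, ih hcd⟩)
  | _ =>
    cases h with
    | add _ _ _ hpb hab => exact (prin_lt_add hpb).2 hab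

/-- If φab were below its argument u, the inequality could be passed down to ever smaller subterms x
≤ u: to the first summand of a sum, to d for x = φcd. It would end at 0 or at a strongly critical x,
where φab < x requires a, b < x. -/
theorem lt_phi {C : Dg → Prop} {a b : Dg} (h : IsOd C (phi a b)) :
    lt a (phi a b) ∧ lt b (phi a b) := by
  have key : ∀ n (a b : Dg), size (phi a b) < n → WF (phi a b) →
      lt a (phi a b) ∧ lt b (phi a b) := by
    intro n
    induction n with
    | zero => intro _ _ h; omega
    | succ n ih =>
      intro a b hn h
      have ha := h.phi_left
      have hb := h.phi_right
      have sa : size a < size (phi a b) := by simp only [size]; omega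
      have sb : size b < size (phi a b) := by simp only [size]; omega
      have ind : ∀ u, WF u → size u < size (phi a b) →
          (∀ x, WF x → le x u → IsSC x → ¬ lt (phi a b) x) →
          (∀ c d, WF (phi c d) → le (phi c d) u → lt c u → lt d u →
            lt (phi a b) (phi c d) → lt (phi a b) d) →
          ∀ x, WF x → le x u → size x ≤ size u → ¬ lt (phi a b) x := by
        intro u hu su hsc hphi x hx
        refine IsOd.rec' (C := fun _ => True) (P := fun x => le x u → size x ≤ size u →
          ¬ lt (phi a b) x) ?_ ?_ ?_ ?_ ?_ ?_ ?_ hx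
        · exact fun _ _ => not_lt_zero
        · exact fun h _ => hsc _ .omega h trivial
        · exact fun h _ => hsc _ .pi h trivial
        · intro c d w ic _ hxu hs hlt
          rw [prin_lt_add (x := phi a b) trivial] at hlt
          have hc := w.add_left
          simp only [size] at hs
          rcases hlt with hlt | rfl
          · exact ic (Or.inl (lt_of_lt_of_le hc w hu (lt_add_left w) hxu)) (by omega) hlt
          · omega
        · intro c d w _ id hxu hs hlt
          obtain ⟨h1, h2⟩ := ih c d (by omega) w
          have h3 := lt_of_lt_of_le w.phi_left w hu h1 hxu
          have h4 := lt_of_lt_of_le w.phi_right w hu h2 hxu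
          simp only [size] at hs
          exact id (Or.inl h4) (by omega) (hphi c d w hxu h3 h4 hlt)
        · exact fun c w _ hxu _ => hsc _ w hxu trivial
        · exact fun c d e w _ hxu _ => hsc _ w hxu trivial
      constructor
      · refine (tri ha h).resolve_right (not_or.2 ⟨fun e => ?_, ?_⟩)
        · rw [← e] at sa; omega
        refine ind a ha sa (fun x hx hxa sx hlt => ?_) (fun c d w hxa hc hd hlt => ?_) a ha
          (le_refl _) le_rfl
        · exact not_lt_of_le hx ha hxa ((phi_lt_sc sx).1 hlt).1
        · rcases phi_lt_phi.1 hlt with ⟨h1, _⟩ | ⟨rfl, _⟩ | ⟨_, h1⟩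
          · exact (lt_asymm ha w.phi_left h1 hc).elim
          · exact (lt_irrefl ha hc).elim
          · exact h1
      · refine (tri hb h).resolve_right (not_or.2 ⟨fun e => ?_, ?_⟩)
        · rw [← e] at sb; omega
        refine ind b hb sb (fun x hx hxb sx hlt => ?_) (fun c d w hxb hc hd hlt => ?_) b hb
          (le_refl _) le_rfl
        · exact not_lt_of_le hx hb hxb ((phi_lt_sc sx).1 hlt).2
        · rcases phi_lt_phi.1 hlt with ⟨_, h1⟩ | ⟨_, h1⟩ | ⟨_, h1⟩
          · exact (not_lt_of_le w hb hxb h1).elim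
          · exact (lt_asymm hb w.phi_right h1 hd).elim
          · exact h1
  exact key _ a b (Nat.lt_succ_self _) h.wf

theorem le_of_mem_K {σ k x : Dg} (hx : WF x) (h : k ∈ K σ x) : le k x := by
  have wk := hx.mem_K h
  revert h
  refine IsOd.rec' (C := fun _ => True) (P := fun x => k ∈ K σ x → le k x) (fun h => h.elim)
    (fun h => h.elim) (fun h => h.elim) ?_ ?_ ?_ ?_ hx
  · intro a b w ha hb h
    rcases h with h | h
    · exact Or.inl (lt_of_le_of_lt wk w.add_left w (ha h) (lt_add_left w))
    · exact Or.inl (lt_of_le_of_lt wk w.add_right w (hb h) (lt_add_right w))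
  · intro a b w ha hb h
    rcases h with h | h
    · exact Or.inl (lt_of_le_of_lt wk w.phi_left w (ha h) (lt_phi w).1)
    · exact Or.inl (lt_of_le_of_lt wk w.phi_right w (hb h) (lt_phi w).2)
  · intro a w ha h
    exact Or.inl (lt_of_le_of_lt wk w.next_arg w (ha h) (lt_next w))
  · intro τ a q w _ h
    exact (lin _).hid_le w trivial le_rfl
      ((lin _).hid_of_mem_K w (Nat.lt_succ_self _) h)

theorem le_of_mem_Kc {μ ρ c r k : Dg} (hx : WF (col ρ c r)) (hμ : le μ ρ)
    (hk : k ∈ Kc μ (col ρ c r)) : le k (col ρ c r) :=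
  (lin _).hid_le hx trivial le_rfl ((lin _).hid_of_mem_Kc hx le_rfl hμ hk)

theorem exists_le_K_of_lt {σ a q x : Dg} (hα : WF (col σ a q)) (hx : WF x) (sx : IsSC x)
    (hxσ : lt x σ) (h : lt (col σ a q) x) : ∃ k ∈ K σ x, le (col σ a q) k :=
  (lin _).le_K_of_lt hα hx sx le_rfl hxσ h

/-! ## The operator `𝒢` -/

section
variable {C : Dg → Prop} {X : Set Dg}

theorem Cl.comp {α σ a q t : Dg} (hσ : Cl {x | IsOd C x} α X σ) (ha : Cl {x | IsOd C x} α X a)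
    (hq : ∀ x, InQ x q → Cl {x | IsOd C x} α X x) (h : Comp t (Dg.col σ a q)) :
    Cl {x | IsOd C x} α X t := by
  rcases h with rfl | rfl | h
  exacts [hσ, ha, hq _ h]

theorem Cl.col_of_comp {α σ a q : Dg} (h : ∀ t, Comp t (Dg.col σ a q) → Cl {x | IsOd C x} α X t)
    (hlt : lt α σ) (w : IsOd C (Dg.col σ a q)) : Cl {x | IsOd C x} α X (Dg.col σ a q) :=
  .col (h _ (Or.inl rfl)) (h _ (Or.inr (Or.inl rfl))) (fun x hx => h x (Or.inr (Or.inr hx))) hlt w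

/-- Induction on the construction of t in 𝒞^γ(X). A step that 𝒞^α(X) lacks is d_σ with γ < σ ≤ α;
either its result can be recovered below γ, or a coefficient above γ appears. -/
theorem cl_or_lt_K {γ α : Dg} (hX : X ⊆ {x | IsOd C x}) (hγ : γ ∈ G {x | IsOd C x} X)
    (hα : α ∈ G {x | IsOd C x} X) (hlt : lt γ α) (hXγ : ∀ δ ∈ X, lt δ γ) {t : Dg}
    (ht : Cl {x | IsOd C x} γ X t) (hs : size t < size γ) :
    Cl {x | IsOd C x} α X t ∨ ∃ k ∈ K α t, lt γ k := by
  have wγ := hγ.1.wf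
  have wα := hα.1.wf
  induction ht with
  | zero => exact Or.inl .zero
  | omega => exact Or.inl .omega
  | pi => exact Or.inl .pi
  | base h h' => exact Or.inl (.base h (lt_trans (hX h).wf wγ wα h' hlt))
  | add ha hb h iha ihb =>
    simp only [size] at hs
    rcases iha (by omega) with ha | ⟨k, hk, h1⟩
    · rcases ihb (by omega) with hb | ⟨k, hk, h1⟩
      · exact Or.inl (.add ha hb h)
      · exact Or.inr ⟨k, Or.inr hk, h1⟩
    · exact Or.inr ⟨k, Or.inl hk, h1⟩
  | phi ha hb h iha ihb =>
    simp only [size] at hs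
    rcases iha (by omega) with ha | ⟨k, hk, h1⟩
    · rcases ihb (by omega) with hb | ⟨k, hk, h1⟩
      · exact Or.inl (.phi ha hb h)
      · exact Or.inr ⟨k, Or.inr hk, h1⟩
    · exact Or.inr ⟨k, Or.inl hk, h1⟩
  | next ha h iha =>
    simp only [size] at hs
    exact (iha (by omega)).imp (fun ha => .next ha h) id
  | @col σ a q hσ ha hq h1 h ihσ iha ihq =>
    have wc : WF (col σ a q) := h.wf
    have ih : ∀ t, Comp t (col σ a q) → Cl {x | IsOd C x} α X t ∨ ∃ k ∈ K α t, lt γ k := by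
      rintro t ht
      have hst := ht.size_lt
      rcases ht with rfl | rfl | ht
      exacts [ihσ (by omega), iha (by omega), ihq _ ht (by omega)]
    rcases tri wα wc.ixOd with h2 | h2
    · by_cases h3 : ∀ t, Comp t (col σ a q) → Cl {x | IsOd C x} α X t
      · exact Or.inl (.col_of_comp h3 h2 h)
      · push Not at h3
        obtain ⟨t, ht, h3⟩ := h3
        obtain ⟨k, hk, h4⟩ := (ih t ht).resolve_left h3
        exact Or.inr ⟨k, mem_K_col.2 (Or.inl ⟨h2, (mem_Kc_iff wc).2 ⟨t, ht, hk⟩⟩), h4⟩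
    -- For σ ≼ α the diagram is below γ, hence in X since γ ∈ 𝒢(X), or is itself the desired
    -- coefficient; the size bound excludes γ. If σ is not ≼ α, then σ ∈ 𝒞^α(X) would give σ ∈ X,
    -- hence σ < γ, against γ < σ.
    by_cases h3 : PrecEq σ α
    · rcases tri wc wγ with h4 | rfl | h4
      · exact Or.inl (.base (hγ.2.2 _ (.col hσ ha hq h1 h) h4) (lt_trans wc wγ wα h4 hlt))
      · omega
      · exact Or.inr ⟨_, mem_K_col.2 (Or.inr (Or.inr ⟨h3, rfl⟩)), h4⟩
    · have h2' : lt σ α := by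
        rcases h2 with rfl | h2
        · exact (h3 .refl).elim
        · exact h2
      rcases ih σ (Or.inl rfl) with h4 | ⟨k, hk, h4⟩
      · exact (lt_asymm wγ wc.ixOd h1 (hXγ _ (hα.2.2 _ h4 h2'))).elim
      · exact Or.inr ⟨k, mem_K_col.2 (Or.inr (Or.inl ⟨h2', h3, hk⟩)), h4⟩

/-- Two elements of `𝒢(X)`, the smaller one above all of `X`, are related by `≺`. -/
theorem prec_of_mem_G {γ α : Dg} (hX : X ⊆ {x | IsOd C x}) (hγ : γ ∈ G {x | IsOd C x} X)
    (hα : α ∈ G {x | IsOd C x} X) (hlt : lt γ α) (hXγ : ∀ δ ∈ X, lt δ γ) : Prec γ α := by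
  have wγ := hγ.1.wf
  have wα := hα.1.wf
  have nX : γ ∉ X := fun h => lt_irrefl wγ (hXγ _ h)
  -- γ < α and α ∈ 𝒢(X) keep γ out of 𝒞^α(X), and elements of K_α γ do not exceed γ. With
  -- `cl_or_lt_K` for the immediate parts of γ this refutes every possible last step of its
  -- construction except d_σ with σ ≼ α.
  have nCl : ¬ Cl {x | IsOd C x} α X γ := fun h => nX (hα.2.2 _ h hlt)
  have key := fun t => @cl_or_lt_K C X γ α hX hγ hα hlt hXγ t
  have noK : ∀ k ∈ K α γ, ¬ lt γ k := fun k hk =>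
    not_lt_of_le (wγ.mem_K hk) wγ (le_of_mem_K wγ hk)
  have hcl := hγ.2.1
  cases hcl with
  | zero => exact (nCl .zero).elim
  | omega => exact (nCl .omega).elim
  | pi => exact (nCl .pi).elim
  | base h => exact (nX h).elim
  | @add a b ha hb h =>
    rcases key a ha (by simp only [size]; omega) with ha | ⟨k, hk, h1⟩
    · rcases key b hb (by simp only [size]; omega) with hb | ⟨k, hk, h1⟩
      · exact (nCl (.add ha hb h)).elim
      · exact (noK k (Or.inr hk) h1).elim
    · exact (noK k (Or.inl hk) h1).elim
  | @phi a b ha hb h =>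
    rcases key a ha (by simp only [size]; omega) with ha | ⟨k, hk, h1⟩
    · rcases key b hb (by simp only [size]; omega) with hb | ⟨k, hk, h1⟩
      · exact (nCl (.phi ha hb h)).elim
      · exact (noK k (Or.inr hk) h1).elim
    · exact (noK k (Or.inl hk) h1).elim
  | @next a ha h =>
    rcases key a ha (by simp only [size]; omega) with ha | ⟨k, hk, h1⟩
    · exact (nCl (.next ha h)).elim
    · exact (noK k hk h1).elim
  | @col σ a q hσ ha hq h1 h =>
    rcases tri wα wγ.ixOd with h2 | rfl | h2
    · refine (nCl (.col_of_comp (fun t ht => ?_) h2 h)).elim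
      refine (key t (.comp hσ ha hq ht) ht.size_lt).resolve_right ?_
      rintro ⟨k, hk, h3⟩
      have hk' := (mem_Kc_iff wγ).2 ⟨t, ht, hk⟩
      exact not_lt_of_le (wγ.mem_Kc hk') wγ (le_of_mem_Kc wγ (Or.inl h2) hk') h3
    · exact .single ⟨a, q, rfl⟩
    · by_cases h3 : PrecEq σ α
      · exact prec_col.2 h3
      rcases key σ hσ (by simp only [size]; omega) with h4 | ⟨k, hk, h4⟩
      · exact (lt_asymm wγ wγ.ixOd h1 (hXγ _ (hα.2.2 _ h4 h2))).elim
      · exact (noK k (mem_K_col.2 (Or.inr (Or.inl ⟨h2, h3, hk⟩))) h4).elim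

/-- Collapsings in 𝒞^σ(X) have subscripts above σ, so they create no diagram ≺ σ: all σ-coefficients
stem from elements of X. -/
theorem Cl.exists_le_of_mem_K {σ t k : Dg} (wσ : WF σ) (hX : X ⊆ {x | IsOd C x})
    (ht : Cl {x | IsOd C x} σ X t)
    (hk : k ∈ K σ t) : ∃ y ∈ X, le k y := by
  induction ht with
  | zero => exact hk.elim
  | omega => exact hk.elim
  | pi => exact hk.elim
  | base h _ => exact ⟨_, h, le_of_mem_K (hX h).wf hk⟩
  | add _ _ _ iha ihb => exact hk.elim iha ihb
  | phi _ _ _ iha ihb => exact hk.elim iha ihb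
  | next _ _ iha => exact iha hk
  | @col τ a q _ _ _ h1 h ihσ iha ihq =>
    have wc : WF (Dg.col τ a q) := h.wf
    have hk' : k ∈ Kc σ (Dg.col τ a q) := by
      rcases mem_K_col.1 hk with ⟨_, h⟩ | ⟨h, _⟩ | ⟨h, _⟩
      · exact h
      · exact (lt_asymm wσ wc.ixOd h1 h).elim
      · exact (not_lt_of_le wc.ixOd wσ (h.le wc.ixOd) h1).elim
    obtain ⟨t, ht, hkt⟩ := (mem_Kc_iff wc).1 hk'
    rcases ht with rfl | rfl | ht
    exacts [ihσ hkt, iha hkt, ihq _ ht hkt]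

/-- The subscript of an element of `𝒢(X)` above `X` is in `𝒢(X)`. -/
theorem ix_mem_G {σ a q : Dg} (hX : X ⊆ {x | IsOd C x})
    (hγ : col σ a q ∈ G {x | IsOd C x} X) (hXγ : ∀ δ ∈ X, lt δ (col σ a q)) :
    σ ∈ G {x | IsOd C x} X := by
  have wγ := hγ.1.wf
  have wσ := wγ.ixOd
  have hγσ := col_lt_ix wγ
  have hcl : Cl {x | IsOd C x} (col σ a q) X σ := by
    have hcl := hγ.2.1
    cases hcl with
    | base h => exact (lt_irrefl wγ (hXγ _ h)).elim
    | col hσ => exact hσ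
  -- The generators survive because X lies below d_σ^q a, and the subscripts allowed for σ are
  -- allowed for the smaller d_σ^q a.
  have sub : ∀ x, Cl {x | IsOd C x} σ X x → Cl {x | IsOd C x} (col σ a q) X x := by
    intro x hx
    induction hx with
    | zero => exact .zero
    | omega => exact .omega
    | pi => exact .pi
    | base h _ => exact .base h (hXγ _ h)
    | add _ _ h ha hb => exact .add ha hb h
    | phi _ _ h ha hb => exact .phi ha hb h
    | next _ h ha => exact .next ha h
    | col _ _ _ h1 h hσ ha hq =>
      exact .col hσ ha hq (lt_trans wγ wσ (IsOd.wf (IsOd.ixOd h)) hγσ h1) h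
  -- The closure has no element between d_σ^q a and σ: a collapsed one would have a σ-coefficient
  -- above d_σ^q a, hence so would X have an element there.
  have low : ∀ x, Cl {x | IsOd C x} σ X x → lt x σ → lt x (col σ a q) := by
    intro x hx
    induction hx with
    | zero => exact fun _ => zero_lt.2 (by simp)
    | omega =>
      intro h
      refine omega_lt_col.2 ?_
      rintro rfl
      exact not_omega_lt_omega h
    | pi => exact fun h => (not_pi_lt_sc wγ.sc_ix h).elim
    | base h _ => exact fun _ => hXγ _ h
    | add _ _ _ ha _ =>
      intro h
      rw [add_lt_prin wγ.sc_ix.prin] at h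
      rw [add_lt_prin (y := col σ a q) trivial]
      exact ha h
    | phi _ _ _ ha hb =>
      intro h
      rw [phi_lt_sc wγ.sc_ix] at h
      rw [phi_lt_sc (y := col σ a q) trivial]
      exact ⟨ha h.1, hb h.2⟩
    | next _ w ha =>
      intro h
      have w' := IsOd.wf w
      exact next_lt_col.2 ⟨h, ha (lt_trans w'.next_arg w' wσ (lt_next w') h)⟩
    | @col τ b p hτ hb hp h1 w _ _ _ =>
      intro h
      have wx : WF (col τ b p) := IsOd.wf w
      rcases tri wx wγ with h2 | h2 | h2
      · exact h2
      · cases h2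
        exact (lt_irrefl wσ h1).elim
      · obtain ⟨k, hk, h3⟩ := exists_le_K_of_lt wγ wx trivial h h2
        obtain ⟨y, hy, h4⟩ := Cl.exists_le_of_mem_K wσ hX (.col hτ hb hp h1 w) hk
        have wy := (hX hy).wf
        exact (not_lt_of_le wγ wy (le_trans wγ (wx.mem_K hk) wy h3 h4) (hXγ _ hy)).elim
  refine ⟨hγ.1.ixOd, ?_, fun x hx h => hγ.2.2 x (sub x hx) (low x hx h)⟩
  -- The diagrams used to build σ are no larger than σ. If a subscript τ above d_σ^q a were below σ,
  -- then K_σ τ would be nonempty, which needs τ larger than σ.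
  have : ∀ t, Cl {x | IsOd C x} (col σ a q) X t → size t ≤ size σ →
      Cl {x | IsOd C x} σ X t := by
    intro t ht
    induction ht with
    | zero => exact fun _ => .zero
    | omega => exact fun _ => .omega
    | pi => exact fun _ => .pi
    | base h h' => exact fun _ => .base h (lt_trans (hX h).wf wγ wσ h' hγσ)
    | add _ _ h ha hb =>
      intro hs
      simp only [size] at hs
      exact .add (ha (by omega)) (hb (by omega)) h
    | phi _ _ h ha hb =>
      intro hs
      simp only [size] at hs
      exact .phi (ha (by omega)) (hb (by omega)) h
    | next _ h ha =>
      intro hs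
      simp only [size] at hs
      exact .next (ha (by omega)) h
    | @col τ b p _ _ _ h1 w ihτ ihb ihp =>
      intro hs
      have wx : WF (col τ b p) := IsOd.wf w
      refine .col_of_comp (fun t ht => ?_) ?_ w
      · have := ht.size_lt
        rcases ht with rfl | rfl | ht
        exacts [ihτ (by omega), ihb (by omega), ihp _ ht (by omega)]
      · simp only [size] at hs
        rcases tri wσ wx.ixOd with h2 | rfl | h2
        · exact h2
        · omega
        · obtain ⟨k, hk, _⟩ := exists_le_K_of_lt wγ wx.ixOd wx.sc_ix h2 h1
          exact (not_mem_K_of_size (by omega) hk).elim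
  exact this σ hcl le_rfl

/-- `𝒢(X)` above `X` is closed upwards under `≺`. -/
theorem mem_G_of_precEq {γ α : Dg} (hX : X ⊆ {x | IsOd C x}) (hγ : γ ∈ G {x | IsOd C x} X)
    (hXγ : ∀ δ ∈ X, lt δ γ) (h : PrecEq γ α) : α ∈ G {x | IsOd C x} X := by
  induction h with
  | refl => exact hγ
  | @tail b c h1 h2 ih =>
    obtain ⟨a, q, rfl⟩ := h2
    have h3 : PrecEq γ (col c a q) := h1
    refine ix_mem_G hX ih fun δ hδ => ?_
    exact lt_of_lt_of_le (hX hδ).wf hγ.1.wf (hγ.1.precEq h3).wf (hXγ δ hδ) (h3.le hγ.1.wf)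

theorem Cl.congr {Z : Set Dg} {α : Dg} (h : ∀ x, lt x α → (x ∈ X ↔ x ∈ Z)) {x : Dg} {S : Set Dg}
    (hx : Cl S α X x) : Cl S α Z x := by
  induction hx with
  | zero => exact .zero
  | omega => exact .omega
  | pi => exact .pi
  | base h1 h2 => exact .base ((h _ h2).1 h1) h2
  | add _ _ h ha hb => exact .add ha hb h
  | phi _ _ h ha hb => exact .phi ha hb h
  | next _ h ha => exact .next ha h
  | col _ _ _ h1 h hσ ha hq => exact .col hσ ha hq h1 h

/-- `𝒢` is local. -/
theorem mem_G_congr {Z S : Set Dg} {α : Dg} (h : ∀ x, lt x α → (x ∈ X ↔ x ∈ Z)) :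
    α ∈ G S X ↔ α ∈ G S Z := by
  have key : ∀ {X Z : Set Dg}, (∀ x, lt x α → (x ∈ X ↔ x ∈ Z)) → α ∈ G S X → α ∈ G S Z :=
    fun h hα => ⟨hα.1, hα.2.1.congr h, fun x hx hlt =>
      (h x hlt).1 (hα.2.2 x (hx.congr fun y hy => (h y hy).symm) hlt)⟩
  exact ⟨key h, key fun x hx => (h x hx).symm⟩

end

/-! ## Strict monotonicity of the norm -/

theorem mem_stage {Γ : Set Dg → Set Dg} {x : Ordinal.{0}} {α : Dg} :
    α ∈ stage Γ x ↔ ∃ y < x, α ∈ Γ (stage Γ y) := by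
  rw [stage]
  simp only [Set.mem_ofPred_eq, exists_prop]

theorem stage_mono {Γ : Set Dg → Set Dg} {x y : Ordinal.{0}} (h : x ≤ y) :
    stage Γ x ⊆ stage Γ y := by
  intro α hα
  obtain ⟨z, hz, hα⟩ := mem_stage.1 hα
  exact mem_stage.2 ⟨z, hz.trans_le h, hα⟩

section
variable {Γ : Set Dg → Set Dg} {S : Set Dg} (hS : S ⊆ {x | WF x}) (hΓ : ∀ X, Γ X ⊆ S)
  (key : ∀ X Z γ α, X ⊆ S → Z ⊆ S → X ⊆ Z → α ∈ Γ X → γ ∈ Γ Z → lt γ α →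
    (∀ x ∈ Z, lt x α → x ∈ X) → (∀ x ∈ X, lt x γ) → γ ∈ X)
include hS hΓ key

/-- Outer induction on z, inner induction on x. The hypothesis `key` describes a γ lying above all
of the earlier stage; the two inductions show that a counterexample would satisfy its premises. -/
theorem mem_stage_of_lt (z : Ordinal.{0}) : ∀ x ≤ z, ∀ γ ∈ Γ (stage Γ z), ∀ α ∈ Γ (stage Γ x),
    lt γ α → γ ∈ stage Γ x := by
  have sub : ∀ y, stage Γ y ⊆ S := fun y α hα => by
    obtain ⟨z, _, h⟩ := mem_stage.1 hα
    exact hΓ _ h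
  induction z using WellFoundedLT.induction with
  | _ z ihz =>
  intro x
  induction x using WellFoundedLT.induction with
  | _ x ihx =>
  intro hxz γ hγ α hα hlt
  by_contra hn
  -- That Γ^z and Γ^x agree below α comes from the outer induction. That Γ^x lies below γ comes from
  -- the inner one: a δ ∈ Γ^x above γ would force γ into an earlier stage.
  refine hn (key _ _ γ α (sub x) (sub z) (stage_mono hxz) hα hγ hlt ?_ ?_)
  · intro δ hδ h
    obtain ⟨y, hy, hδ⟩ := mem_stage.1 hδ
    rcases lt_or_ge y x with h1 | h1
    · exact mem_stage.2 ⟨y, h1, hδ⟩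
    · exact ihz y hy x h1 δ hδ α hα h
  · intro δ hδ
    obtain ⟨y, hy, hδ'⟩ := mem_stage.1 hδ
    rcases tri (hS (sub x hδ)) (hS (hΓ _ hγ)) with h | rfl | h
    · exact h
    · exact (hn hδ).elim
    · exact (hn (stage_mono hy.le (ihx y hy (hy.le.trans hxz) γ hγ δ hδ' h))).elim

/-- β arises by applying Γ to some Γ^u with u ≤ |β|. By `mem_stage_of_lt` α already lies in Γ^u, so
it arises from some Γ^v with v < u. -/
theorem norm_lt_norm {α β : Dg} (hα : α ∈ W Γ) (hβ : β ∈ W Γ) (h : lt α β) :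
    norm Γ α < norm Γ β := by
  have hne : {x | β ∈ stage Γ (x + 1)}.Nonempty := by
    obtain ⟨x, hx⟩ := hβ
    exact ⟨x, stage_mono (le_self_add) hx⟩
  have hn : β ∈ stage Γ (norm Γ β + 1) := csInf_mem hne
  obtain ⟨u, hu, hβ'⟩ := mem_stage.1 hn
  have hu' : u ≤ norm Γ β := Order.lt_add_one_iff.1 hu
  obtain ⟨x, hx⟩ := hα
  have hαu : α ∈ stage Γ u := by
    obtain ⟨z, hz, hα⟩ := mem_stage.1 hx
    rcases lt_or_ge z u with h1 | h1
    · exact mem_stage.2 ⟨z, h1, hα⟩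
    · exact mem_stage_of_lt hS hΓ key z u h1 α hα β hβ' h
  obtain ⟨v, hv, hαv⟩ := mem_stage.1 hαu
  have hv' : norm Γ α ≤ v :=
    csInf_le' (s := {x | α ∈ stage Γ (x + 1)})
      (mem_stage.2 ⟨v, Order.lt_add_one_iff.2 le_rfl, hαv⟩)
  exact hv'.trans_lt (hv.trans_le hu')

end

/-! ## Elements of `𝒟^Q` -/

section
variable {C : Dg → Prop}

theorem IsDQ.exists_eq {x : Dg} (h : IsDQ x) :
    ∃ σ a j k t n q, x = col σ a (cons j k t n q) := by
  cases x with
  | col σ a q =>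
    cases q with
    | cons j k t n q => exact ⟨_, _, _, _, _, _, _, rfl⟩
    | _ => exact h.elim
  | _ => exact h.elim

theorem IsDQ.ne_pi {x : Dg} (h : IsDQ x) : x ≠ pi := by rintro rfl; exact h

theorem IsDQ.not_isSR {x : Dg} (h : IsDQ x) : ¬ IsSR x := by
  cases x <;> first | exact h.elim | exact id

theorem IsOd.ix_dq {σ a q : Dg} (w : IsOd C (Dg.col σ a q)) (h : IsDQ (Dg.col σ a q)) :
    σ = Dg.pi ∨ IsDQ σ := by
  cases w with
  | col => exact h.elim
  | colQ _ _ _ _ _ hs => exact hs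

theorem IsOd.cond {x : Dg} (w : IsOd C x) (h : IsDQ x) : C x := by
  cases w with
  | colQ _ _ _ _ _ _ _ hC => exact hC
  | _ => exact h.elim

theorem IsDQ.precEq {x y : Dg} (w : IsOd C x) (hx : IsDQ x) (h : PrecEq x y) :
    y = pi ∨ IsDQ y := by
  induction h with
  | refl => exact Or.inr hx
  | @tail b c h1 h2 ih =>
    obtain ⟨a, q, rfl⟩ := h2
    rcases ih with ih | ih
    · cases ih
    · exact (w.precEq h1).ix_dq ih

theorem IsDQ.prec_pi {x : Dg} (w : IsOd C x) (hx : IsDQ x) : Prec x pi := by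
  induction x with
  | col σ a q ih =>
    rcases w.ix_dq hx with rfl | h
    · exact prec_col.2 .refl
    · exact prec_col.2 (ih w.ixOd h).toEq
  | _ => exact hx.elim

theorem not_prec_pi {y : Dg} : ¬ Prec pi y := by
  intro h
  obtain ⟨σ, c, q, h, _⟩ := h.exists_col
  cases h

theorem eq_pi_of_precEq {y : Dg} (h : PrecEq pi y) : y = pi := by
  rcases precEq_iff.1 h with h | h
  · exact h.symm
  · exact (not_prec_pi h).elim

/-- A diagram `≺` to some `α` is in `𝒟_α`, or both are in `𝒟^Q ∪ {π}`. -/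
theorem Prec.cases_dq {γ α : Dg} (w : IsOd C γ) (h : Prec γ α) :
    (IsSR α ∧ DMem γ α) ∨ (IsDQ γ ∧ (α = pi ∨ IsDQ α)) := by
  obtain ⟨σ, c, q, rfl, h1⟩ := h.exists_col
  cases w with
  | col _ _ hs =>
    rcases precEq_iff.1 h1 with rfl | h1
    · exact Or.inl ⟨hs, c, _, rfl⟩
    · obtain ⟨_, _, _, rfl, _⟩ := h1.exists_col
      exact hs.elim
  | colQ hσ ha hq hne hqx hs hB hC =>
    have hd : IsDQ (Dg.col σ c q) := by
      cases q <;> first | exact (hne rfl).elim | exact hq.elim | trivial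
    exact Or.inr ⟨hd, hd.precEq (.colQ hσ ha hq hne hqx hs hB hC) (prec_col.2 h1).toEq⟩

/-- A collapsed diagram has only one subscript, so the diagrams above x form a chain. -/
theorem precEq_total {x y z : Dg} (h1 : PrecEq x y) (h2 : PrecEq x z) :
    PrecEq z y ∨ Prec y z := by
  have : Relator.RightUnique DMem := by
    rintro a b c ⟨d, q, rfl⟩ h
    exact (dMem_col.1 h).symm
  rcases Relation.ReflTransGen.total_of_right_unique this h1 h2 with h | h
  · rcases precEq_iff.1 h with rfl | h
    · exact Or.inl .refl
    · exact Or.inr h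
  · exact Or.inl h

end

/-! ## The operator `Γ_32` -/

theorem Gamma32_cases {X : Set Dg} {α : Dg} (h : α ∈ Gamma32 X) :
    lt α pi ∧ α ∈ G Od32 X ∧ α ∈ V32 X := by
  rcases h with h | h
  · exact ⟨h.1, h.2.2.1, h.2.2.2.1⟩
  · exact ⟨h.2.2.1, h.2.2.2⟩

/-- The premise of `norm_lt_norm` for Γ_32. Locality of 𝒢 moves γ from 𝒢(Z) to 𝒢(X), and
`prec_of_mem_G` then yields γ ≺ α. -/
theorem mem_of_mem_Gamma32 {X Z : Set Dg} {γ α : Dg} (hX : X ⊆ Od32) (hZS : Z ⊆ Od32) (hXZ : X ⊆ Z)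
    (hα : α ∈ Gamma32 X) (hγ : γ ∈ Gamma32 Z) (hlt : lt γ α) (hZ : ∀ x ∈ Z, lt x α → x ∈ X)
    (hXγ : ∀ x ∈ X, lt x γ) : γ ∈ X := by
  obtain ⟨hαpi, hαG, hαV⟩ := Gamma32_cases hα
  obtain ⟨-, hγG', -⟩ := Gamma32_cases hγ
  have wα := hαG.1.wf
  have wγ := hγG'.1.wf
  have hγG : γ ∈ G Od32 X :=
    (mem_G_congr fun x h => ⟨fun h' => hXZ h', fun h' =>
      hZ x h' (lt_trans (hZS h').wf wγ wα h hlt)⟩).2 hγG'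
  have hp : Prec γ α := prec_of_mem_G hX hγG hαG hlt hXγ
  have nM : ¬ InM3 α ∨ Gamma30 X ⊆ X := hα.imp (fun h => h.2.1) fun h => h.1
  rcases hp.cases_dq hγG.1 with ⟨hs, hm⟩ | ⟨hd, h1⟩
  · rcases hα with hα | hα
    · exact hα.2.2.2.2 hs γ hm hγG
    · rcases hα.2.1 with rfl | ⟨h, _⟩
      · exact hs.elim
      · exact (h.not_isSR hs).elim
  have hdα : IsDQ α := by
    rcases h1 with rfl | h1
    · exact (not_pi_lt_sc (y := pi) trivial hαpi).elim
    · exact h1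
  obtain ⟨σ, a, κ, ν, rfl, hσκ, hM, -⟩ := hγG.1.cond hd
  have hrg : rg 2 (col σ a (cons 2 κ σ ν nil)) = some κ := by simp [rg, inn]
  -- Both α and κ = rg_2(γ) lie on the chain above γ. If α ≺ κ, then γ ◁ α and V(X) finishes; the
  -- rest treats κ ≼ α.
  rcases precEq_total (prec_col.1 hp) hσκ with h2 | h2
  swap
  · exact (Gamma32_cases hα).2.2 _ ⟨hd, hdα, hp, κ, hrg, h2⟩ hγG
  have hκ : κ ≠ pi := by
    rintro rfl
    exact hdα.ne_pi (eq_pi_of_precEq h2)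
  have hnM : ¬ InM3 (col σ a (cons 2 κ σ ν nil)) := by
    rintro (h | ⟨_, h⟩)
    · cases h
    · rw [hrg] at h
      exact hκ (Option.some.inj h)
  have hγ0 : col σ a (cons 2 κ σ ν nil) ∈ Gamma30 Z := by
    rcases hγ with h | h
    · exact h
    · exact (hnM h.2.1).elim
  -- For α ∈ M_3 the second clause of Γ_32 must have been used, so Γ_30(X) ⊆ X. Any δ ◁ γ is below
  -- α, so V can be brought back from Z to X.
  by_cases hMα : InM3 α
  · refine nM.resolve_left (fun h => h hMα) ⟨hγ0.1, hnM, hγG, fun δ h3 h4 => ?_, fun h => h.elim⟩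
    have wδ := h4.1.wf
    have h5 : lt δ _ := h3.2.2.1.lt wδ
    have h6 := lt_trans wδ wγ wα h5 hlt
    refine hZ δ (hγ0.2.2.2.1 δ h3 ((mem_G_congr fun x h => ⟨fun h' => hXZ h', fun h' =>
      hZ x h' (lt_trans (hZS h').wf wδ wα h h6)⟩).1 h4)) h6
  · have h3 : Prec κ α := by
      rcases precEq_iff.1 h2 with rfl | h
      · exact (hMα hM).elim
      · exact h
    -- κ ∈ M_3 has range π, so κ ◁ α; being in 𝒢(X) by upward closure, κ is forced into X, which
    -- contradicts X < γ < κ.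
    have hκG : κ ∈ G Od32 X := mem_G_of_precEq hX hγG hXγ (prec_col.2 hσκ).toEq
    have hκd := hM.resolve_left hκ
    have hκX := hαV κ ⟨hκd.1, hdα, h3, pi, hκd.2, hdα.prec_pi hαG.1⟩ hκG
    exact (lt_asymm wγ hκG.1.wf (Prec.lt wγ (prec_col.2 hσκ)) (hXγ κ hκX)).elim

theorem norm_Gamma32_lt {α β : Dg} (hα : α ∈ W Gamma32) (hβ : β ∈ W Gamma32) (h : lt α β) :
    norm Gamma32 α < norm Gamma32 β :=
  norm_lt_norm (S := Od32) (fun _ h => IsOd.wf h) (fun _ _ h => (Gamma32_cases h).2.1.1)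
    (fun _ _ _ _ hX hZ hXZ hα hγ hlt h1 h2 => mem_of_mem_Gamma32 hX hZ hXZ hα hγ hlt h1 h2)
    hα hβ h


/-! ## The structure of `Od(Π_N)` -/

/-- The elements of `𝒟^Q` in `Od(Π_N)`. -/
def DN (N : ℕ) (x : Dg) : Prop := x ∈ OdN N ∧ IsDQ x

theorem DN.wf {N : ℕ} {x : Dg} (h : DN N x) : WF x := IsOd.wf h.1

theorem DN.ne_pi {N : ℕ} {x : Dg} (h : DN N x) : x ≠ pi := h.2.ne_pi

theorem pd_eq_find (i : ℕ) : ∀ {q : Dg}, IsSeq q →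
    pd i q = ((quads q).find? (fun e => i ≤ e.1)).map (fun e => e.2.2.1) := by
  intro q
  induction q with
  | cons j k t n q _ _ _ ih =>
    intro hq
    by_cases h : i ≤ j
    · simp [pd, quads, h]
    · simp [pd, quads, h, ih hq]
  | nil => intro _; rfl
  | _ => intro h; exact h.elim

theorem find_last {l : List (ℕ × Dg × Dg × Dg)} {e : ℕ × Dg × Dg × Dg}
    (hl : l.Pairwise fun e f => e.1 < f.1) (h : l.getLast? = some e) :
    l.find? (fun f => e.1 ≤ f.1) = some e := by
  induction l with
  | nil => simp at h
  | cons a l ih =>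
    cases l with
    | nil =>
      simp at h
      simp [h]
    | cons b l =>
      rw [List.getLast?_cons_cons] at h
      have he : e ∈ b :: l := List.mem_of_getLast? h
      have := (List.pairwise_cons.1 hl).1 e he
      rw [List.find?_cons, ih (List.pairwise_cons.1 hl).2 h]
      have h' : ¬ e.1 ≤ a.1 := by omega
      simp [h']

section
variable {N : ℕ} {x y z : Dg} {i : ℕ}

theorem DN.exists_eq (h : DN N x) : ∃ σ a q, x = col σ a q ∧ IsSeq q ∧ CondSeq N σ a q ∧
    ∀ i ∈ In x, ∃ p κ ν, pd i x = some p ∧ rg i x = some κ ∧ st i x = some ν ∧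
      CondIn N i x p κ ν := by
  obtain ⟨σ, a, q, rfl, h1, h2⟩ := h.1.cond h.2
  exact ⟨σ, a, q, rfl, IsOd.isSeq h.1, h1, h2⟩

theorem DN.exists_pd (h : DN N x) (hi : i ≤ N - 1) : ∃ y, pd i x = some y := by
  obtain ⟨σ, a, q, rfl, hq, ⟨_, _, _, _, e, he, he1, _⟩, _⟩ := h.exists_eq
  have h1 : ∃ f, (quads q).find? (fun f => i ≤ f.1) = some f := by
    rw [← Option.isSome_iff_exists, List.find?_isSome]
    exact ⟨e, List.mem_of_getLast? he, by simpa [he1] using hi⟩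
  obtain ⟨f, hf⟩ := h1
  refine ⟨f.2.2.1, ?_⟩
  change pd i q = _
  rw [pd_eq_find i hq, hf]
  rfl

theorem DN.pd_mem {σ a q : Dg} (h : DN N (col σ a q)) (hp : pd i (col σ a q) = some y) :
    PrecEq σ y ∧ (y = pi ∨ DN N y) := by
  obtain ⟨σ', a', q', e, hq, ⟨_, _, h1, _⟩, _⟩ := h.exists_eq
  cases e
  change pd i q = _ at hp
  rw [pd_eq_find i hq, Option.map_eq_some_iff] at hp
  obtain ⟨f, hf, rfl⟩ := hp
  obtain ⟨_, h2, h3, _⟩ := h1 f (List.mem_of_find?_eq_some hf)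
  exact ⟨h2, h3.imp id fun h3 => ⟨(IsOd.ixOd h.1).precEq h2, h3⟩⟩

theorem DN.pd_prec (h : DN N x) (hp : pd i x = some y) : Prec x y ∧ (y = pi ∨ DN N y) := by
  obtain ⟨σ, a, q, rfl, -⟩ := h.exists_eq
  have := h.pd_mem hp
  exact ⟨prec_col.2 this.1, this.2⟩

/-- All j_m are at least 2, so the entry selected is the one with m = 0, where τ_0 = σ. -/
theorem DN.pd_two {σ a q : Dg} (h : DN N (col σ a q)) : pd 2 (col σ a q) = some σ := by
  obtain ⟨σ', a', q', e, hq, ⟨h1, _, _, ⟨f, hf, h2⟩, _⟩, _⟩ := h.exists_eq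
  cases e
  change pd 2 q = _
  rw [pd_eq_find 2 hq]
  cases hl : quads q with
  | nil => simp [hl] at hf
  | cons b l =>
    rw [hl] at hf h1
    have hb : b = f := by simpa using hf
    subst hb
    have := h1 b (by simp)
    rw [List.find?_cons_of_pos (by simpa using this), Option.map_some, h2]

theorem not_precI_pi : ¬ PrecI i pi y := by
  intro h
  obtain ⟨c, h1, _⟩ := Relation.TransGen.head'_iff.1 h
  cases h1

theorem precEqI_iff : PrecEqI i x y ↔ x = y ∨ PrecI i x y := by
  rw [PrecEqI, Relation.reflTransGen_iff_eq_or_transGen]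
  simp only [PrecI, eq_comm]

theorem PrecI.toEq (h : PrecI i x y) : PrecEqI i x y := Relation.TransGen.to_reflTransGen h

theorem PrecEqI.trans_precI (h : PrecEqI i x y) (h' : PrecI i y z) : PrecI i x z :=
  Relation.TransGen.trans_right h h'

theorem PrecI.trans_precEqI (h : PrecI i x y) (h' : PrecEqI i y z) : PrecI i x z :=
  Relation.TransGen.trans_left h h'

theorem eq_pi_of_precEqI (h : PrecEqI i pi y) : y = pi := by
  rcases precEqI_iff.1 h with h | h
  · exact h.symm
  · exact (not_precI_pi h).elim

theorem DN.precEqI_prec (h : DN N x) (hp : PrecEqI i x y) : PrecEq x y ∧ (y = pi ∨ DN N y) := by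
  induction hp with
  | refl => exact ⟨.refl, Or.inr h⟩
  | @tail b c _ h2 ih =>
    rcases ih.2 with rfl | hb
    · cases h2
    · exact ⟨ih.1.trans (hb.pd_prec h2).1.toEq, (hb.pd_prec h2).2⟩

theorem DN.of_precI (h : DN N x) (h1 : PrecEqI i x y) (h2 : PrecI i y z) : DN N y := by
  refine (h.precEqI_prec h1).2.resolve_left ?_
  rintro rfl
  exact not_precI_pi h2

theorem DN.of_dq (h : DN N x) (h1 : PrecEqI i x y) (h2 : IsDQ y) : DN N y :=
  (h.precEqI_prec h1).2.resolve_left h2.ne_pi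

theorem DN.precI_prec (h : DN N x) (hp : PrecI i x y) : Prec x y := by
  obtain ⟨c, h1, h2⟩ := Relation.TransGen.head'_iff.1 hp
  have h3 := h.pd_prec h1
  rcases h3.2 with rfl | hc
  · rw [eq_pi_of_precEqI h2]
    exact h3.1
  · exact Relation.TransGen.trans_left h3.1 (hc.precEqI_prec h2).1

theorem DN.precI_size (h : DN N x) (hp : PrecI i x y) : size y < size x :=
  (h.precI_prec hp).size_lt

theorem DN.precEqI_size (h : DN N x) (hp : PrecEqI i x y) : size y ≤ size x :=
  (h.precEqI_prec hp).1.size_le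

theorem DN.precI_lt (h : DN N x) (hp : PrecI i x y) : lt x y := (h.precI_prec hp).lt h.wf

theorem DN.precEqI_le (h : DN N x) (hp : PrecEqI i x y) : le x y := (h.precEqI_prec hp).1.le h.wf

theorem DN.wf_of_precEqI (h : DN N x) (hp : PrecEqI i x y) : WF y :=
  h.wf.precEq (h.precEqI_prec hp).1

theorem DN.precI_irrefl (h : DN N x) : ¬ PrecI i x x := fun h' => by
  have := h.precI_size h'
  omega

theorem DN.precI_asymm (h : DN N x) (h1 : PrecI i x y) : ¬ PrecEqI i y x :=
  fun h2 => h.precI_irrefl (h1.trans_precEqI h2)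

theorem precEqI_total (h1 : PrecEqI i x y) (h2 : PrecEqI i x z) :
    PrecEqI i y z ∨ PrecI i z y := by
  have : Relator.RightUnique (fun x y => pd i x = some y) := fun a b c h1 h2 =>
    Option.some.inj (h1.symm.trans h2)
  rcases Relation.ReflTransGen.total_of_right_unique this h1 h2 with h | h
  · exact Or.inl h
  · rcases precEqI_iff.1 h with rfl | h
    · exact Or.inl .refl
    · exact Or.inr h

/-- Comparable elements are ordered by `<` as by `≼_i`. -/
theorem DN.precEqI_of_le (hx : DN N x) (h1 : PrecEqI i x y) (h2 : PrecEqI i x z) (h : le y z) :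
    PrecEqI i y z := by
  rcases precEqI_total h1 h2 with h3 | h3
  · exact h3
  · have hz := hx.of_precI h2 h3
    exact (not_lt_of_le (hx.wf_of_precEqI h1) hz.wf h (hz.precI_lt h3)).elim

theorem DN.precI_of_lt (hx : DN N x) (h1 : PrecEqI i x y) (h2 : PrecEqI i x z) (h : lt y z) :
    PrecI i y z := by
  rcases precEqI_iff.1 (hx.precEqI_of_le h1 h2 (Or.inl h)) with rfl | h3
  · exact (lt_irrefl (hx.wf_of_precEqI h1) h).elim
  · exact h3

theorem precI_head (hp : pd i x = some y) : PrecI i x z ↔ PrecEqI i y z := by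
  constructor
  · intro h
    obtain ⟨c, h1, h2⟩ := Relation.TransGen.head'_iff.1 h
    rw [hp] at h1
    cases h1
    exact h2
  · exact fun h => Relation.TransGen.head'_iff.2 ⟨y, hp, h⟩

/-- The entry into the hierarchy of relations ≺_i from the plain ≺ that 𝒢 provides. -/
theorem DN.precI_two_iff (h : DN N x) : PrecI 2 x y ↔ Prec x y := by
  refine ⟨h.precI_prec, fun h1 => ?_⟩
  induction x with
  | col σ a q ih =>
    rw [precI_head h.pd_two]
    rcases precEq_iff.1 (prec_col.1 h1) with rfl | h2
    · exact .refl
    · rcases (h.pd_prec h.pd_two).2 with rfl | h3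
      · exact (not_prec_pi h2).elim
      · exact (ih h3 h2).toEq
  | _ => exact h.2.elim

/-! ### Elements outside `In` -/

theorem pd_succ (h : i ∉ In x) : pd (i + 1) x = pd i x := by
  induction x with
  | col σ a q _ _ ih => exact ih h
  | cons j k t n q _ _ _ ih =>
    have h1 : i ≠ j := fun e => h (Or.inl e)
    have h2 := ih fun h' => h (Or.inr h')
    simp only [pd, h2]
    have : i + 1 ≤ j ↔ i ≤ j := by omega
    simp only [this]
  | _ => rfl

theorem inn_pd (h : i ∉ In x) (hp : pd i x = some y) : inn i x = inn i y := by
  induction x with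
  | col σ a q _ _ ih => exact ih h hp
  | cons j k t n q _ _ _ ih =>
    have h1 : i ≠ j := fun e => h (Or.inl e)
    by_cases h2 : i ≤ j
    · simp only [pd, h2, if_true, Option.some.injEq] at hp
      subst hp
      have : i < j := by omega
      simp [inn, h1, this]
    · simp only [pd, h2, if_false] at hp
      have h3 : ¬ i < j := by omega
      simp only [inn, h1, h3, if_false]
      exact ih (fun h' => h (Or.inr h')) hp
  | _ => cases hp

theorem firstIn_pd (h : i ∉ In x) (hp : pd i x = some y) : firstIn i x = firstIn i y := by
  induction x with
  | col σ a q _ _ ih =>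
    have h' : i ∉ In q := h
    simp only [firstIn, h', if_false]
    exact ih h hp
  | cons j k t n q _ _ _ ih =>
    by_cases h2 : i ≤ j
    · simp only [pd, h2, if_true, Option.some.injEq] at hp
      subst hp
      simp [firstIn, h2]
    · simp only [pd, h2, if_false] at hp
      simp only [firstIn, h2, if_false]
      exact ih (fun h' => h (Or.inr h')) hp
  | _ => cases hp

theorem firstIn_of_mem (hx : IsDQ x) (h : i ∈ In x) : firstIn i x = some x := by
  obtain ⟨σ, a, j, k, t, n, q, rfl⟩ := hx.exists_eq
  have h' : i ∈ In (cons j k t n q) := h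
  simp only [firstIn, h', if_true]

theorem inn_isOd {C : Dg → Prop} {s κ : Dg} (h : inn i x = some (s, κ)) (hx : IsOd C x) :
    IsOd C s ∧ IsOd C κ := by
  have key : ∀ x, (IsOd C x ∨ (IsSeq x ∧ ∀ y, InQ y x → IsOd C y)) → inn i x = some (s, κ) →
      IsOd C s ∧ IsOd C κ := by
    intro x
    induction x with
    | col σ a q _ _ ih =>
      intro hx h
      have hx := hx.resolve_right (fun h => h.1)
      exact ih (Or.inr ⟨hx.isSeq, fun y hy => hx.comp (Or.inr (Or.inr hy))⟩) h
    | cons j k t n q _ ih1 _ ih =>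
      intro hx h
      obtain ⟨hs, hx⟩ := hx.resolve_left (by intro h; cases h)
      have hk := hx k (inQ_cons.2 (Or.inl rfl))
      have ht := hx t (inQ_cons.2 (Or.inr (Or.inl rfl)))
      have hn := hx n (inQ_cons.2 (Or.inr (Or.inr (Or.inl rfl))))
      simp only [inn] at h
      split_ifs at h with h1 h2
      · cases h
        exact ⟨hn, hk⟩
      · exact ih1 (Or.inl ht) h
      · exact ih (Or.inr ⟨hs, fun y hy => hx y (inQ_cons.2 (Or.inr (Or.inr (Or.inr hy))))⟩) h
    | _ => intro _ h; cases h
  exact key x (Or.inl hx) h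

end

section
variable {N : ℕ} {x y z e κ s : Dg} {i : ℕ}

theorem inn_eq_some : inn i x = some (s, κ) ↔ st i x = some s ∧ rg i x = some κ := by
  unfold st rg
  cases inn i x with
  | none => simp
  | some v => cases v; simp

theorem DN.in_data (hx : DN N x) (hi : i + 2 ≤ N) (h : i ∈ In x) : ∃ p κ s p',
    pd i x = some p ∧ inn i x = some (s, κ) ∧ pd (i + 1) x = some p' ∧ inn i κ = inn i p' ∧
    PrecEqI i κ p' ∧ p ≠ p' ∧ PrecEqI i p κ ∧
    (κ = p ∨ (rg i p = some κ ∧ StLt i x p) ∨ (∃ κ', rg i p = some κ' ∧ PrecI i κ' κ ∧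
      (∀ τ, PrecEqI i κ' τ → PrecI i τ κ → ∃ κ'', rg i τ = some κ'' ∧ PrecEqI i κ'' κ) ∧
      ∃ σ₁, IsSigmaOne i p κ σ₁ ∧ StLt i x σ₁)) := by
  obtain ⟨_, _, _, _, _, _, hd⟩ := hx.exists_eq
  obtain ⟨p, κ, ν, h1, h2, h3, h4, h5, h6, -⟩ := hd i h
  obtain ⟨p', h7, h8, h9, h10⟩ := h4 (by omega)
  exact ⟨p, κ, ν, p', h1, inn_eq_some.2 ⟨h3, h2⟩, h7, h8, h9, h10, h5, h6.imp (fun h => h.1) id⟩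

/-- In 𝒟_π both pd_i and pd_{i+1} are π, whereas i ∈ In requires them to differ. -/
theorem not_mem_in_top {a q : Dg} (hx : DN N (col pi a q)) (hi : i + 2 ≤ N) :
    i ∉ In (col pi a q) := by
  intro h
  obtain ⟨p, κ, s, p', h1, _, h2, _, _, h3, _⟩ := hx.in_data hi h
  exact h3 ((eq_pi_of_precEq (hx.pd_mem h1).1).trans (eq_pi_of_precEq (hx.pd_mem h2).1).symm)

/-- The value π of pd_i is carried upwards to pd_{N-1} = τ_l, and τ_l = π requires σ = π. Here i ∈
In is impossible: p = π forces κ = π, hence pd_{i+1} = π = p. -/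
theorem DN.ix_eq_pi {σ a q : Dg} (hx : DN N (col σ a q)) (hi : i + 1 ≤ N)
    (h : pd i (col σ a q) = some pi) : σ = pi := by
  obtain ⟨k, hk⟩ : ∃ k, i + 1 + k = N := ⟨N - (i + 1), by omega⟩
  induction k generalizing i with
  | zero =>
    obtain ⟨σ', a', q', e, hq, ⟨_, h1, _, _, f, hf, h2, _, _, h3⟩, _⟩ := hx.exists_eq
    cases e
    have h4 : i = f.1 := by omega
    change pd i q = _ at h
    rw [pd_eq_find i hq, h4, find_last h1 hf] at h
    exact h3 (Option.some.inj h)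
  | succ k ih =>
    by_cases hin : i ∈ In (col σ a q)
    · obtain ⟨p, κ, s, p', h1, _, h2, _, h4, h5, h6, _⟩ := hx.in_data (by omega) hin
      rw [h] at h1
      cases h1
      have h7 := eq_pi_of_precEqI h6
      subst h7
      exact (h5 (eq_pi_of_precEqI h4).symm).elim
    · refine ih (i := i + 1) (by omega) ?_ (by omega)
      rw [pd_succ hin, h]

/-- A range π at some i < N-1 would force pd_{i+1} = π and thus a diagram in 𝒟_π, which has no such
i in In. -/
theorem DN.inn_prec (hx : DN N x) (hi : i + 2 ≤ N) (h : inn i x = some (s, κ)) :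
    PrecI i x κ ∧ κ ≠ pi := by
  induction hn : size x using Nat.strong_induction_on generalizing x with
  | _ n ih =>
  by_cases hin : i ∈ In x
  · obtain ⟨p, κ', s', p', h1, h2, h3, h4, h5, h6, h7, _⟩ := hx.in_data hi hin
    rw [h] at h2
    cases h2
    refine ⟨(precI_head h1).2 h7, ?_⟩
    rintro rfl
    have := eq_pi_of_precEqI h5
    subst this
    obtain ⟨σ, a, q, rfl, -⟩ := hx.exists_eq
    have := hx.ix_eq_pi (by omega) h3
    subst this
    exact not_mem_in_top hx hi hin
  · obtain ⟨y, hy⟩ := hx.exists_pd (i := i) (by omega)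
    rw [inn_pd hin hy] at h
    obtain ⟨h1, h2⟩ := hx.pd_prec hy
    rcases h2 with rfl | h2
    · cases h
    · obtain ⟨h3, h4⟩ := ih _ (by have := h1.size_lt; omega) h2 h rfl
      exact ⟨(precI_head hy).2 h3.toEq, h4⟩

/-- At i ∈ In one has pd_i ≼_i rg_i ≼_i pd_{i+1}; elsewhere pd_i and pd_{i+1} coincide. -/
theorem DN.precI_of_succ (hx : DN N x) (hi : i + 2 ≤ N) (h : PrecEqI (i + 1) x y) :
    PrecEqI i x y := by
  induction h with
  | refl => exact .refl
  | @tail b c h1 h2 ih =>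
    refine ih.trans ?_
    have hb := hx.of_precI h1 (.single h2)
    by_cases hin : i ∈ In b
    · obtain ⟨p, κ, s, p', h3, _, h4, _, h5, _, h6, _⟩ := hb.in_data hi hin
      rw [h2] at h4
      cases h4
      exact ((precI_head h3).2 (h6.trans h5)).toEq
    · rw [pd_succ hin] at h2
      exact .single h2

/-! ### The least element with `i ∈ In` -/

theorem DN.firstIn_spec (hx : DN N x) (hi : i + 1 ≤ N) (h : firstIn i x = some e) :
    PrecEqI i x e ∧ i ∈ In e ∧ inn i x = inn i e ∧
      ∀ z, PrecEqI i x z → PrecI i z e → i ∉ In z := by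
  induction hn : size x using Nat.strong_induction_on generalizing x with
  | _ n ih =>
  by_cases hin : i ∈ In x
  · rw [firstIn_of_mem hx.2 hin] at h
    cases h
    exact ⟨.refl, hin, rfl, fun z h1 h2 => ((hx.of_precI h1 h2).precI_asymm h2 h1).elim⟩
  · obtain ⟨y, hy⟩ := hx.exists_pd (i := i) (by omega)
    rw [firstIn_pd hin hy] at h
    rw [inn_pd hin hy]
    obtain ⟨h1, h2⟩ := hx.pd_prec hy
    rcases h2 with rfl | h2
    · cases h
    · obtain ⟨h3, h4, h5, h6⟩ := ih _ (by have := h1.size_lt; omega) h2 h rfl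
      refine ⟨((precI_head hy).2 h3).toEq, h4, h5, fun z hz1 hz2 => ?_⟩
      rcases precEqI_iff.1 hz1 with rfl | hz1
      · exact hin
      · exact h6 z ((precI_head hy).1 hz1) hz2

theorem DN.firstIn_none (hx : DN N x) (hi : i + 1 ≤ N) (h : firstIn i x = none) :
    inn i x = none ∧ ∀ z, PrecEqI i x z → i ∉ In z := by
  induction hn : size x using Nat.strong_induction_on generalizing x with
  | _ n ih =>
  by_cases hin : i ∈ In x
  · rw [firstIn_of_mem hx.2 hin] at h
    cases h
  · obtain ⟨y, hy⟩ := hx.exists_pd (i := i) (by omega)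
    rw [firstIn_pd hin hy] at h
    rw [inn_pd hin hy]
    obtain ⟨h1, h2⟩ := hx.pd_prec hy
    rcases h2 with rfl | h2
    · refine ⟨rfl, fun z hz => ?_⟩
      rcases precEqI_iff.1 hz with rfl | hz
      · exact hin
      · rw [eq_pi_of_precEqI ((precI_head hy).1 hz)]
        exact id
    · obtain ⟨h3, h4⟩ := ih _ (by have := h1.size_lt; omega) h2 h rfl
      refine ⟨h3, fun z hz => ?_⟩
      rcases precEqI_iff.1 hz with rfl | hz
      · exact hin
      · exact h4 z ((precI_head hy).1 hz)

/-- If no `i ∈ In` occurs between `x` and `y`, the least element with `i ∈ In` is the same. -/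
theorem firstIn_congr (h : PrecEqI i x y) (hn : ∀ z, PrecEqI i x z → PrecI i z y → i ∉ In z) :
    firstIn i x = firstIn i y ∧ inn i x = inn i y := by
  induction h using Relation.ReflTransGen.head_induction_on with
  | refl => exact ⟨rfl, rfl⟩
  | @head a b h1 h2 ih =>
    have hin := hn a .refl (Relation.TransGen.head'_iff.2 ⟨b, h1, h2⟩)
    rw [firstIn_pd hin h1, inn_pd hin h1]
    exact ih fun z h3 h4 => hn z (((precI_head h1).2 h3).toEq) h4

/-- `≼_{i+1}` agrees with `≼_i` as long as `i ∉ In`. -/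
theorem precEqI_succ (h : PrecEqI i x y) (hn : ∀ z, PrecEqI i x z → PrecI i z y → i ∉ In z) :
    PrecEqI (i + 1) x y := by
  induction h using Relation.ReflTransGen.head_induction_on with
  | refl => exact .refl
  | @head a b h1 h2 ih =>
    have hin := hn a .refl (Relation.TransGen.head'_iff.2 ⟨b, h1, h2⟩)
    refine Relation.ReflTransGen.head ((pd_succ hin).trans h1) ?_
    exact ih fun z h3 h4 => hn z (((precI_head h1).2 h3).toEq) h4

/-! ### Ranges and stages along `≺_i` -/

/-- Between x and its range κ the ranges do not exceed κ, and where the range is again κ the stages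
do not decrease; they increase strictly on leaving some x with i ∈ In(x). These facts follow by
induction from the alternatives (a), (b), (c) in the definition of Od(Π_N), and make coverings
nested. -/
theorem DN.inn_mono (hx : DN N x) (hi : i + 2 ≤ N) (h : inn i x = some (s, κ))
    (hxy : PrecEqI i x y) (hyκ : PrecI i y κ) : ∃ s' κ', inn i y = some (s', κ') ∧
      PrecEqI i κ' κ ∧ (κ' = κ → le s s' ∧ (i ∈ In x → PrecI i x y → lt s s')) := by
  induction hn : size x using Nat.strong_induction_on generalizing x s κ with
  | _ n ih =>
  rcases precEqI_iff.1 hxy with rfl | hxy'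
  · exact ⟨s, κ, h, .refl, fun _ => ⟨le_refl _, fun _ h => (hx.precI_irrefl h).elim⟩⟩
  by_cases hin : i ∈ In x
  swap
  · obtain ⟨p, hp⟩ := hx.exists_pd (i := i) (by omega)
    have hpy := (precI_head hp).1 hxy'
    have hp' := hx.of_precI (.single hp) (hpy.trans_precI hyκ)
    obtain ⟨s', κ', h1, h2, h3⟩ := ih _ (by have := hx.precI_size (.single hp); omega) hp'
      ((inn_pd hin hp).symm.trans h) hpy hyκ rfl
    exact ⟨s', κ', h1, h2, fun e => ⟨(h3 e).1, fun h => (hin h).elim⟩⟩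
  obtain ⟨p, κ0, s0, p', hp, h2, h3, h4, h5, h6, h7, h8⟩ := hx.in_data hi hin
  rw [h] at h2
  cases h2
  have hpy := (precI_head hp).1 hxy'
  have hp' := hx.of_precI (.single hp) (hpy.trans_precI hyκ)
  have hsz := hx.precI_size (.single hp)
  have ws := (inn_isOd h hx.1).1.wf
  have hy := hx.of_precI hxy hyκ
  rcases h8 with rfl | ⟨h8, s1, s2, e1, e2, hlt⟩ | ⟨κ1, h8, h9, h10, σ1, ⟨⟨h11, h12, h13⟩, h14⟩,
    s1, s2, e1, e2, hlt⟩
  · exact (hp'.precI_irrefl (hpy.trans_precI hyκ)).elim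
  · obtain rfl : s = s1 := by
      rw [(inn_eq_some.1 h).1] at e1
      exact Option.some.inj e1
    have hip := inn_eq_some.2 ⟨e2, h8⟩
    obtain ⟨s', κ', g1, g2, g3⟩ := ih _ (by omega) hp' hip hpy hyκ rfl
    have w2 := (inn_isOd hip hp'.1).1.wf
    have w' := (inn_isOd g1 hy.1).1.wf
    refine ⟨s', κ', g1, g2, fun e => ?_⟩
    have := lt_of_lt_of_le ws w2 w' hlt (g3 e).1
    exact ⟨Or.inl this, fun _ _ => this⟩
  · obtain rfl : s = s1 := by
      rw [(inn_eq_some.1 h).1] at e1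
      exact Option.some.inj e1
    obtain ⟨s3, hip⟩ : ∃ s3, inn i p = some (s3, κ1) := by
      unfold rg at h8
      rw [Option.map_eq_some_iff] at h8
      obtain ⟨⟨s3, κ3⟩, h8, rfl⟩ := h8
      exact ⟨s3, h8⟩
    have hpκ := (hp'.inn_prec hi hip).1
    -- Alternative (c). If y is before the range κ1 of p, the induction continues from p, and
    -- equality of ranges is excluded by κ1 ≺_i κ. Past κ1, the condition on τ in (c) bounds the
    -- range of y.
    rcases precEqI_total hpκ.toEq hpy with g | g
    swap
    · obtain ⟨s', κ', g1, g2, g3⟩ := ih _ (by omega) hp' hip hpy g rfl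
      refine ⟨s', κ', g1, g2.trans h9.toEq, ?_⟩
      rintro rfl
      have hκ' := hp'.of_precI hpκ.toEq h9
      exact (hκ'.precI_asymm h9 g2).elim
    · obtain ⟨κ'', g1, g2⟩ := h10 y g hyκ
      obtain ⟨s', hiy⟩ : ∃ s', inn i y = some (s', κ'') := by
        unfold rg at g1
        rw [Option.map_eq_some_iff] at g1
        obtain ⟨⟨s3, κ3⟩, g1, rfl⟩ := g1
        exact ⟨s3, g1⟩
      refine ⟨s', κ'', hiy, g2, ?_⟩
      rintro rfl
      have hpy' : PrecI i p y := by
        rcases precEqI_iff.1 hpy with rfl | h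
        · rw [h8] at g1
          cases g1
          have hκ' := hp'.of_precI hpκ.toEq h9
          exact (hκ'.precI_irrefl h9).elim
        · exact h
      -- Minimality of σ1 puts σ1 at or before y, so the stages can be compared through σ1.
      have hle := h14 y g1 hpy' hyκ
      have hσy := hp'.precEqI_of_le h12.toEq hpy hle
      have hσ1 := hp'.of_precI h12.toEq h13
      have hiσ := inn_eq_some.2 ⟨e2, h11⟩
      obtain ⟨s4, κ4, g3, _, g5⟩ := ih _ (by have := hp'.precI_size h12; omega) hσ1
        hiσ hσy hyκ rfl
      rw [hiy] at g3
      cases g3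
      have w2 := (inn_isOd hiσ hσ1.1).1.wf
      have w' := (inn_isOd hiy hy.1).1.wf
      have := lt_of_lt_of_le ws w2 w' hlt (g5 rfl).1
      exact ⟨Or.inl this, fun _ _ => this⟩

/-- The least element above `rg_i(x)` with `i ∈ In` lies above `x` in the sense of `≺_{i+1}`. -/
theorem DN.precI_succ_firstIn_rg (hx : DN N x) (hi : i + 2 ≤ N) (hin : i ∈ In x)
    (h : inn i x = some (s, κ)) (he : firstIn i κ = some e) : PrecI (i + 1) x e := by
  obtain ⟨p, κ0, s0, p', hp, h2, h3, h4, h5, h6, h7, h8⟩ := hx.in_data hi hin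
  rw [h] at h2
  cases h2
  obtain ⟨hxκ, hκ⟩ := hx.inn_prec hi h
  have hκ' := (hx.precEqI_prec hxκ.toEq).2.resolve_left hκ
  obtain ⟨g1, g2, g3, g4⟩ := hκ'.firstIn_spec (by omega) he
  rw [precI_head h3]
  -- Were e strictly before p' = pd_{i+1}(x), the stages and ranges of e and p' would coincide,
  -- because in_i(κ) = in_i(p'), while the stage must increase strictly on leaving e.
  have key : PrecEqI i p' e := by
    rcases precEqI_total h5 g1 with g | g
    · exact g
    have hE := hκ'.of_precI g1 g
    obtain ⟨p1, κ1, s1, p1', _, g5, _⟩ := hE.in_data hi g2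
    have g6 : inn i p' = some (s1, κ1) := by rw [← h4, g3, g5]
    have hp' : DN N p' := by
      refine (hκ'.precEqI_prec h5).2.resolve_left ?_
      rintro rfl
      cases g6
    obtain ⟨s', κ', g7, _, g9⟩ := hE.inn_mono hi g5 g.toEq (hp'.inn_prec hi g6).1
    rw [g6] at g7
    cases g7
    exact (lt_irrefl (inn_isOd g5 hE.1).1.wf ((g9 rfl).2 g2 g)).elim
  exact precEqI_succ key fun z h1 h2 => g4 z (h5.trans h1) h2

/-! ### The top of a diagram -/

theorem top_col_pi {a q : Dg} : top (col pi a q) = col pi a q := by simp [top]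

theorem top_col {σ a q : Dg} (h : σ ≠ pi) : top (col σ a q) = top σ := by simp [top, h]

theorem top_of_prec (h : Prec x y) (hy : y ≠ pi) : top x = top y := by
  induction x with
  | col σ a q ih =>
    have hσ : σ ≠ pi := by
      rintro rfl
      exact hy (eq_pi_of_precEq (prec_col.1 h))
    rw [top_col hσ]
    rcases precEq_iff.1 (prec_col.1 h) with rfl | h1
    · rfl
    · exact ih h1
  | _ => obtain ⟨_, _, _, h, _⟩ := h.exists_col; cases h

theorem DN.top_eq (hx : DN N x) (h : PrecEqI i x y) (hy : y ≠ pi) : top x = top y := by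
  rcases precEqI_iff.1 h with rfl | h
  · rfl
  · exact top_of_prec (hx.precI_prec h) hy

theorem DN.top_dn (hx : DN N x) : DN N (top x) ∧ ∃ a q, top x = col pi a q := by
  induction x with
  | col σ a q ih =>
    by_cases h : σ = pi
    · subst h
      rw [top_col_pi]
      exact ⟨hx, a, q, rfl⟩
    · rw [top_col h]
      exact ih ((hx.pd_prec hx.pd_two).2.resolve_left h)
  | _ => exact hx.2.elim

theorem DN.precEqI_top (hx : DN N x) (hi : i + 1 ≤ N) : PrecEqI i x (top x) := by
  induction hn : size x using Nat.strong_induction_on generalizing x with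
  | _ n ih =>
  obtain ⟨y, hy⟩ := hx.exists_pd (i := i) (by omega)
  rcases (hx.pd_prec hy).2 with rfl | h
  · obtain ⟨σ, a, q, rfl, -⟩ := hx.exists_eq
    have := hx.ix_eq_pi hi hy
    subst this
    rw [top_col_pi]
    exact .refl
  · have hs := hx.precI_size (.single hy)
    rw [hx.top_eq (.single hy) h.ne_pi]
    exact ((precI_head hy).2 (ih _ (by omega) h rfl)).toEq

theorem DN.not_mem_in_top (hx : DN N x) (hi : i + 2 ≤ N) : i ∉ In (top x) := by
  obtain ⟨h, a, q, e⟩ := hx.top_dn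
  rw [e] at h ⊢
  exact Dg.not_mem_in_top h hi

theorem DN.not_top_prec (hx : DN N x) (h : PrecI i (top x) y) : y = pi := by
  obtain ⟨h1, a, q, e⟩ := hx.top_dn
  rw [e] at h h1
  exact eq_pi_of_precEq (prec_col.1 (h1.precI_prec h))

end

/-! ## Coverings and resolvents -/

/-- No `z` with `A ≼_i z` satisfies `z ◁_i y`. -/
def Unc (i : ℕ) (A y : Dg) : Prop := ∀ z, PrecEqI i A z → ¬ LhdI i z y

/-- No `z` with `A ≼_i z ≺_i B` has `i ∈ In(z)`. -/
def NoIn (i : ℕ) (A B : Dg) : Prop := ∀ z, PrecEqI i A z → PrecI i z B → i ∉ In z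

section
variable {N : ℕ} {A B D x y z e κ s : Dg} {i n : ℕ}

theorem Unc.mono (h : Unc i A y) (h' : PrecEqI i A B) : Unc i B y :=
  fun z hz => h z (h'.trans hz)

theorem NoIn.mono (h : NoIn i A D) (h1 : PrecEqI i A x) (h2 : PrecEqI i y D) : NoIn i x y :=
  fun z h3 h4 => h z (h1.trans h3) (h4.trans_precEqI h2)

theorem NoIn.unc (h : NoIn i A B) : Unc i A B := fun z h1 h2 => h z h1 h2.2.2.2.1 h2.2.2.1

theorem DN.unc_refl (hA : DN N A) : Unc i A A :=
  fun _ h1 h2 => hA.precI_irrefl (h1.trans_precI h2.2.2.2.1)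

/-- An element covering D is either at or above B, or lies strictly below B and then covers B as
well. -/
theorem DN.unc_trans (hA : DN N A) (hAB : PrecEqI i A B) (hBD : PrecEqI i B D)
    (h1 : Unc i A B) (h2 : Unc i B D) : Unc i A D := by
  rintro z hz ⟨d1, d2, d3, d4, κ, d5, d6⟩
  rcases precEqI_total hAB hz with h | h
  · exact h2 z h ⟨d1, d2, d3, d4, κ, d5, d6⟩
  · have hBκ := hBD.trans_precI d6
    exact h1 z hz ⟨d1, (hA.of_precI hAB hBκ).2, d3, h, κ, d5, hBκ⟩

theorem rg_eq_some (h : rg i x = some κ) : ∃ s, inn i x = some (s, κ) := by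
  unfold rg at h
  rw [Option.map_eq_some_iff] at h
  obtain ⟨⟨s, κ'⟩, h, rfl⟩ := h
  exact ⟨s, h⟩

theorem DN.exists_inn (hx : DN N x) (hi : i + 2 ≤ N) (h : i ∈ In x) :
    ∃ s κ, inn i x = some (s, κ) := by
  obtain ⟨_, κ, s, _, _, h, _⟩ := hx.in_data hi h
  exact ⟨s, κ, h⟩

theorem DN.exists_firstIn (hx : DN N x) (hi : i + 1 ≤ N) (hz : PrecEqI i x z) (h : i ∈ In z) :
    ∃ e, firstIn i x = some e ∧ PrecEqI i e z := by
  cases he : firstIn i x with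
  | none => exact ((hx.firstIn_none hi he).2 z hz h).elim
  | some e =>
    obtain ⟨h1, _, _, h2⟩ := hx.firstIn_spec hi he
    refine ⟨e, rfl, ?_⟩
    rcases precEqI_total h1 hz with h3 | h3
    · exact h3
    · exact (h2 z hz h3 h).elim

/-- An element covering `ξ` but not `η`, where `i ∉ In` between `ξ` and `η`, does not exist. -/
theorem DN.unc_of_noIn (hA : DN N A) (hi : i + 2 ≤ N) (hAx : PrecEqI i A x) (hxy : PrecEqI i x y)
    (hn : NoIn i x y) (hu : Unc i A y) : Unc i A x := by
  rintro z hz ⟨d1, d2, d3, d4, κ, d5, d6⟩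
  obtain ⟨s, hs⟩ := rg_eq_some d5
  have hx := hA.of_dq hAx d2
  have hzN := hA.of_dq hz d1
  have key : PrecEqI i κ y := by
    rcases precEqI_total hxy d6.toEq with h | h
    · rcases precEqI_iff.1 h with rfl | h
      · exact .refl
      · exact (hu z hz ⟨d1, (hA.of_precI (hAx.trans hxy) h).2, d3, d4.trans_precEqI hxy, κ, d5,
          h⟩).elim
    · exact h.toEq
  -- By `key` the covering z has range at or before y. So the range of x is at or before y, hence at
  -- or before e, the first element with i ∈ In. But x and e have the same range, and it lies
  -- strictly above e.
  obtain ⟨s', κ', h1, h2, _⟩ := hzN.inn_mono hi hs d4.toEq d6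
  cases he : firstIn i x with
  | none =>
    rw [(hx.firstIn_none (by omega) he).1] at h1
    cases h1
  | some e =>
    obtain ⟨g1, g2, g3, _⟩ := hx.firstIn_spec (by omega) he
    have hE : DN N e := by
      refine (hx.precEqI_prec g1).2.resolve_left ?_
      rintro rfl
      exact g2
    have hye : PrecEqI i y e := by
      rcases precEqI_total hxy g1 with h | h
      · exact h
      · exact (hn e g1 h g2).elim
    have hκ := (hE.inn_prec hi (g3.symm.trans h1)).1
    exact hE.precI_asymm hκ (h2.trans (key.trans hye))

/-- Nothing covers the next resolvent. -/
theorem DN.unc_next (hE : DN N e) (hi : i + 2 ≤ N) (h : inn i e = some (s, κ))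
    (hκ : PrecEqI i κ y) (hn : NoIn i κ y) : Unc i e y := by
  rintro z hz ⟨d1, d2, d3, d4, κ', d5, d6⟩
  have heκ := (hE.inn_prec hi h).1
  have hzN := hE.of_dq hz d1
  rcases precEqI_total heκ.toEq hz with h1 | h1
  · exact hn z h1 d4 d3
  · obtain ⟨s', hs'⟩ := rg_eq_some d5
    obtain ⟨s2, κ2, h2, h3, _⟩ := hE.inn_mono hi h hz h1
    rw [hs'] at h2
    cases h2
    have hy := hE.of_dq (heκ.toEq.trans hκ) d2
    exact hy.precI_asymm d6 (h3.trans hκ)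

theorem DN.res0_spec (hA : DN N A) (hi : i + 2 ≤ N) :
    PrecEqI i A (res0 i A) ∧ DN N (res0 i A) ∧ NoIn i A (res0 i A) := by
  unfold res0
  cases he : firstIn i A with
  | none => exact ⟨hA.precEqI_top (by omega), hA.top_dn.1, fun z h _ =>
      (hA.firstIn_none (by omega) he).2 z h⟩
  | some e =>
    obtain ⟨g1, g2, _, g3⟩ := hA.firstIn_spec (by omega) he
    refine ⟨g1, (hA.precEqI_prec g1).2.resolve_left ?_, g3⟩
    rintro rfl
    exact g2

theorem DN.res0_congr (hA : DN N A) (hAB : PrecEqI i A B) (hB : IsDQ B)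
    (h : NoIn i A B) : res0 i A = res0 i B ∧ rg i A = rg i B := by
  have h1 := firstIn_congr hAB h
  unfold res0 rg
  rw [h1.1, h1.2, hA.top_eq hAB hB.ne_pi]
  exact ⟨rfl, rfl⟩

theorem res_zero : res i A 0 = some (res0 i A) := rfl

theorem res_succ (h : res i A n = some x) (hx : i ∈ In x) :
    res i A (n + 1) = some (((rg i x).bind (firstIn i)).getD (top A)) := by
  simp [res, h, hx]

theorem res_succ_none (h : res i A n = some x) (hx : i ∉ In x) : res i A (n + 1) = none := by
  simp [res, h, hx]

theorem DN.res_succ_spec (hA : DN N A) (hi : i + 2 ≤ N) (hAx : PrecEqI i A x) (hx : DN N x)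
    (h : inn i x = some (s, κ)) :
    PrecEqI i κ (((rg i x).bind (firstIn i)).getD (top A)) ∧
    NoIn i κ (((rg i x).bind (firstIn i)).getD (top A)) := by
  rw [(inn_eq_some.1 h).2, Option.bind_some]
  obtain ⟨hκ, hκ'⟩ := hx.inn_prec hi h
  have hκN := (hx.precEqI_prec hκ.toEq).2.resolve_left hκ'
  rw [hA.top_eq (hAx.trans hκ.toEq) hκ']
  have := hκN.res0_spec hi
  exact ⟨this.1, this.2.2⟩

/-- No resolvent is covered from A: each passage to the next one stays uncovered by `DN.unc_next`,
and `DN.unc_trans` composes the passages. -/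
theorem DN.res_spec (hA : DN N A) (hi : i + 2 ≤ N) (h : res i A n = some x) :
    PrecEqI i A x ∧ DN N x ∧ Unc i A x := by
  induction n generalizing x with
  | zero =>
    cases h
    obtain ⟨h1, h2, h3⟩ := hA.res0_spec hi
    exact ⟨h1, h2, h3.unc⟩
  | succ n ih =>
    cases h1 : res i A n with
    | none => simp [res, h1] at h
    | some y =>
      obtain ⟨h2, h3, h4⟩ := ih h1
      by_cases hy : i ∈ In y
      · rw [res_succ h1 hy] at h
        obtain ⟨s, κ, hs⟩ := h3.exists_inn hi hy
        obtain ⟨h5, h6⟩ := hA.res_succ_spec hi h2 h3 hs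
        rw [Option.some.inj h] at h5 h6
        obtain ⟨h7, h8⟩ := h3.inn_prec hi hs
        have hyx := h7.toEq.trans h5
        refine ⟨h2.trans hyx, ?_, hA.unc_trans h2 hyx h4 (h3.unc_next hi hs h5 h6)⟩
        have hκN := (h3.precEqI_prec h7.toEq).2.resolve_left h8
        have e := (hκN.res0_spec hi).2.1
        unfold res0 at e
        rw [(inn_eq_some.1 hs).2, Option.bind_some, hA.top_eq (h2.trans h7.toEq) h8] at h
        rwa [Option.some.inj h] at e
      · rw [res_succ_none h1 hy] at h
        cases h

/-- The definition of ≺_i^p tests the resolvents only. This suffices: if z covers y, take the last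
resolvent δ at or before z with i ∈ In(δ). Then z lies before the range of δ, so by `DN.inn_mono`
the range of δ is at or above that of z, and δ covers y too. -/
theorem DN.precP_iff (hA : DN N A) (hi : i + 2 ≤ N) :
    PrecP i A y ↔ PrecI i A y ∧ Unc i A y := by
  constructor
  · rintro ⟨h1, h2⟩
    refine ⟨h1, fun z hz hzy => h2 ?_⟩
    obtain ⟨d1, d2, d3, d4, κ, d5, d6⟩ := hzy
    have key : ∀ k n δ, size δ < k → res i A n = some δ → i ∈ In δ → PrecEqI i δ z →
        ∃ n δ, res i A n = some δ ∧ LhdI i δ y := by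
      intro k
      induction k with
      | zero => intro _ _ h; omega
      | succ k ih =>
        intro n δ hk hδ hin hδz
        rcases precEqI_iff.1 hδz with rfl | hlt
        · exact ⟨n, δ, hδ, d1, d2, d3, d4, κ, d5, d6⟩
        obtain ⟨_, hδN, _⟩ := hA.res_spec hi hδ
        obtain ⟨s, κ', hs⟩ := hδN.exists_inn hi hin
        obtain ⟨h3, h4⟩ := hδN.inn_prec hi hs
        rcases precEqI_total h3.toEq hδz with h5 | h5
        · have hκN := (hδN.precEqI_prec h3.toEq).2.resolve_left h4
          obtain ⟨e, he, hez⟩ := hκN.exists_firstIn (by omega) h5 d3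
          obtain ⟨h6, h7, -⟩ := hκN.firstIn_spec (by omega) he
          refine ih (n + 1) e ?_ ?_ h7 hez
          · have := hδN.precI_size (h3.trans_precEqI h6)
            omega
          · rw [res_succ hδ hin, (inn_eq_some.1 hs).2, Option.bind_some, he]
            rfl
        · obtain ⟨s', κ2, h6, h7, _⟩ := hδN.inn_mono hi hs hδz h5
          rw [(inn_eq_some.1 h6).2] at d5
          cases d5
          exact ⟨n, δ, hδ, hδN.2, d2, hin, hlt.trans d4, κ', (inn_eq_some.1 hs).2,
            d6.trans_precEqI h7⟩
    obtain ⟨e, he, hez⟩ := hA.exists_firstIn (by omega) hz d3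
    obtain ⟨_, h7, -⟩ := hA.firstIn_spec (by omega) he
    exact key _ 0 e (Nat.lt_succ_self _) (by rw [res_zero, res0, he]; rfl) h7 hez
  · rintro ⟨h1, h2⟩
    refine ⟨h1, ?_⟩
    rintro ⟨n, δ, h3, h4⟩
    exact h2 δ (hA.res_spec hi h3).1 h4

end

/-! ## Blocks -/

section
variable {N : ℕ} {A B D x y z e κ s m : Dg} {i j c p : ℕ} {P : Set Dg}

theorem DN.precEqI_mono (hA : DN N A) (hij : i ≤ j) (hj : j + 1 ≤ N) (h : PrecEqI j A B) :
    PrecEqI i A B := by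
  induction j, hij using Nat.le_induction with
  | base => exact h
  | succ j _ ih => exact ih (by omega) (hA.precI_of_succ (by omega) h)

theorem leastOf_eq (hP : ∀ x ∈ P, WF x) (hm : m ∈ P) (h : ∀ y ∈ P, le m y) : leastOf P = m := by
  have h' : ∃ x ∈ P, ∀ y ∈ P, le x y := ⟨m, hm, h⟩
  rw [leastOf, dif_pos h']
  exact le_antisymm (hP _ h'.choose_spec.1) (hP _ hm) (h'.choose_spec.2 _ hm)
    (h _ h'.choose_spec.1)

theorem greatestOf_eq (hP : ∀ x ∈ P, WF x) (hm : m ∈ P) (h : ∀ y ∈ P, le y m) :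
    greatestOf P = m := by
  have h' : ∃ x ∈ P, ∀ y ∈ P, le y x := ⟨m, hm, h⟩
  rw [greatestOf, dif_pos h']
  exact le_antisymm (hP _ h'.choose_spec.1) (hP _ hm) (h _ h'.choose_spec.1)
    (h'.choose_spec.2 _ hm)

/-- On the chain above A size decreases along ≺, so an element of largest size is least; for
greatest elements the size is minimized instead. -/
theorem exists_least (hA : WF A) (hP : ∀ x ∈ P, PrecEq A x) (hne : P.Nonempty) :
    ∃ m ∈ P, ∀ y ∈ P, le m y := by
  obtain ⟨m, hm, h⟩ := (measure fun x => size A - size x).wf.has_min P hne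
  refine ⟨m, hm, fun y hy => ?_⟩
  rcases precEq_total (hP _ hy) (hP _ hm) with h1 | h1
  · exact h1.le (hA.precEq (hP _ hm))
  · have h2 : ¬ size A - size y < size A - size m := h y hy
    have := h1.size_lt
    have := (hP _ hy).size_le
    omega

theorem exists_greatest (hA : WF A) (hP : ∀ x ∈ P, PrecEq A x) (hne : P.Nonempty) :
    ∃ m ∈ P, ∀ y ∈ P, le y m := by
  obtain ⟨m, hm, h⟩ := (measure size).wf.has_min P hne
  refine ⟨m, hm, fun y hy => ?_⟩
  rcases precEq_total (hP _ hm) (hP _ hy) with h1 | h1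
  · exact h1.le (hA.precEq (hP _ hy))
  · have h2 : ¬ size y < size m := h y hy
    have := h1.size_lt
    omega

/-- The condition in the definition of `block`. -/
def BlockCond (c p : ℕ) (A : Dg) : Prop := ∀ i, c ≤ i → i < p →
  lt (res0 p A) (res0 i A) ∧ ∃ κ, rg p A = some κ ∧ le κ (res0 i A)

/-- The set whose least element is `α'` in the definition of `block`. -/
def blockSet (c p : ℕ) (A y : Dg) : Set Dg := {δ | (∃ i, c ≤ i ∧ i < p ∧ δ = res0 i A) ∨ δ = y}

theorem block_of_not_cond (h : ¬ BlockCond c p A) : block c p A = top A := by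
  rw [block]
  exact if_neg h

theorem block_of_none (h : res p A 1 = none) : block c p A = top A := by
  rw [block, h]
  simp

theorem DN.res_one (hA : DN N A) (hp : p + 2 ≤ N) (h : res p A 1 = some x) :
    p ∈ In (res0 p A) ∧ ∃ s κ, inn p (res0 p A) = some (s, κ) ∧ PrecI p (res0 p A) κ ∧
      κ ≠ pi ∧ PrecEqI p κ x ∧ NoIn p κ x := by
  obtain ⟨h1, h2, -⟩ := hA.res0_spec hp
  by_cases hin : p ∈ In (res0 p A)
  · obtain ⟨s, κ, hs⟩ := h2.exists_inn hp hin
    rw [res_succ res_zero hin] at h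
    have h3 := hA.res_succ_spec hp h1 h2 hs
    rw [Option.some.inj h] at h3
    have h4 := h2.inn_prec hp hs
    exact ⟨hin, s, κ, hs, h4.1, h4.2, h3⟩
  · rw [res_succ_none res_zero hin] at h
    cases h

theorem DN.block_some (hA : DN N A) (hcp : c ≤ p) (hp : p + 2 ≤ N) (hc : BlockCond c p A)
    (h : res p A 1 = some x) : ∃ m ∈ blockSet c p A x, (∀ y ∈ blockSet c p A x, le m y) ∧
      PrecI c A m ∧ DN N m ∧ lt (res0 p A) m ∧ block c p A =
        greatestOf {δ | PrecPEq (p + 1) (res0 p A) δ ∧ lt δ (block c p m)} := by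
  obtain ⟨h1, h2, -⟩ := hA.res0_spec hp
  obtain ⟨hin, s, κ, hs, g1, g2, g3, -⟩ := hA.res_one hp h
  obtain ⟨-, hxN, -⟩ := hA.res_spec hp h
  have hset : ∀ y ∈ blockSet c p A x, PrecEqI c A y ∧ DN N y ∧ lt (res0 p A) y := by
    rintro y (⟨i, hi1, hi2, rfl⟩ | rfl)
    · obtain ⟨h3, h4, -⟩ := hA.res0_spec (i := i) (by omega)
      exact ⟨hA.precEqI_mono hi1 (by omega) h3, h4, (hc i hi1 hi2).1⟩
    · have h3 := g1.trans_precEqI g3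
      exact ⟨hA.precEqI_mono hcp (by omega) (h1.trans h3.toEq), hxN, h2.precI_lt h3⟩
  obtain ⟨m, hm, hmin⟩ := exists_least (P := blockSet c p A x) hA.wf
    (fun y hy => (hA.precEqI_prec (hset y hy).1).1) ⟨x, Or.inr rfl⟩
  obtain ⟨h3, h4, h5⟩ := hset m hm
  have h6 : PrecI c A m := by
    rcases precEqI_iff.1 h3 with rfl | h3
    · exact (not_lt_of_le hA.wf h2.wf (hA.precEqI_le h1) h5).elim
    · exact h3
  refine ⟨m, hm, hmin, h6, h4, h5, ?_⟩
  have h7 : leastOf {δ | (∃ i, c ≤ i ∧ i < p ∧ δ = res0 i A) ∨ δ = x} = m :=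
    leastOf_eq (P := blockSet c p A x) (fun y hy => (hset y hy).2.1.wf) hm hmin
  have hc' : ∀ i, c ≤ i → i < p →
    lt (res0 p A) (res0 i A) ∧ ∃ κ, rg p A = some κ ∧ le κ (res0 i A) := hc
  rw [block, if_pos hc', h]
  simp only [h7, hA.precI_size h6, dite_true]

/-- The definition of the block refers to A only through these data; the recursive call is made at
the same α'. -/
theorem block_congr (hA : DN N A) (hB : DN N B) (hcp : c ≤ p) (hp : p + 2 ≤ N)
    (h : ∀ i, c ≤ i → i ≤ p → res0 i A = res0 i B) (h1 : rg p A = rg p B) (h2 : top A = top B) :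
    block c p A = block c p B := by
  have hc : BlockCond c p A ↔ BlockCond c p B := by
    refine forall_congr' fun i => forall_congr' fun hi1 => forall_congr' fun hi2 => ?_
    rw [h p hcp le_rfl, h i hi1 hi2.le, h1]
  have hr : res p A 1 = res p B 1 := by
    simp only [res, h p hcp le_rfl, h2]
  by_cases hcA : BlockCond c p A
  · cases hx : res p A 1 with
    | none => rw [block_of_none hx, block_of_none (hr ▸ hx), h2]
    | some x =>
      obtain ⟨m, hm, hmin, _, hmN, _, e⟩ := hA.block_some hcp hp hcA hx
      obtain ⟨m', hm', hmin', _, hmN', _, e'⟩ := hB.block_some hcp hp (hc.1 hcA) (hr ▸ hx)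
      have hs : blockSet c p A x = blockSet c p B x := by
        ext δ
        refine or_congr (exists_congr fun i => and_congr_right fun hi1 =>
          and_congr_right fun hi2 => ?_) Iff.rfl
        rw [h i hi1 hi2.le]
      have : m = m' := le_antisymm hmN.wf hmN'.wf (hmin _ (hs ▸ hm')) (hmin' _ (hs ▸ hm))
      rw [e, e', this, h p hcp le_rfl]
  · rw [block_of_not_cond hcA, block_of_not_cond (fun h => hcA (hc.2 h)), h2]

theorem PrecPEq.precEqI (h : PrecPEq i x y) : PrecEqI i x y := by
  rcases h with h | rfl
  · exact h.1.toEq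
  · exact .refl

theorem DN.sc {x : Dg} (h : DN N x) : IsSC x := by
  obtain ⟨_, _, _, rfl, _⟩ := h.exists_eq
  trivial

theorem DN.block_greatest (hA : DN N A) (hp : p + 3 ≤ N) (h1 : DN N y)
    (h : lt (res0 p A) y) :
    ∃ g, greatestOf {δ | PrecPEq (p + 1) (res0 p A) δ ∧ lt δ y} = g ∧
      PrecPEq (p + 1) (res0 p A) g ∧ lt g y ∧ DN N g ∧
      ∀ δ, PrecPEq (p + 1) (res0 p A) δ → lt δ y → le δ g := by
  obtain ⟨_, h3, -⟩ := hA.res0_spec (i := p) (by omega)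
  obtain ⟨g, hg, hmax⟩ := exists_greatest
    (P := {δ | PrecPEq (p + 1) (res0 p A) δ ∧ lt δ y}) h3.wf
    (fun x hx => (h3.precEqI_prec hx.1.precEqI).1) ⟨res0 p A, Or.inr rfl, h⟩
  have hgN : DN N g := by
    refine (h3.precEqI_prec hg.1.precEqI).2.resolve_left ?_
    rintro rfl
    exact not_pi_lt_sc h1.sc hg.2
  refine ⟨g, greatestOf_eq (fun x hx => h3.wf_of_precEqI hx.1.precEqI) hg hmax, hg.1, hg.2, hgN,
    fun δ h1 h2 => hmax δ ⟨h1, h2⟩⟩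

/-- By induction the block of α' lies at or above α', and α' > α_p^0. So α_p^0 belongs to the set
whose greatest element is taken, and no default value occurs. -/
theorem DN.block_spec (hA : DN N A) (hcp : c ≤ p) (hp : p + 3 ≤ N) :
    DN N (block c p A) ∧ PrecEqI (p + 1) (res0 p A) (block c p A) := by
  induction hn : size A using Nat.strong_induction_on generalizing A with
  | _ n ih =>
  obtain ⟨h1, h2, -⟩ := hA.res0_spec (i := p) (by omega)
  have htop : DN N (top A) ∧ PrecEqI (p + 1) (res0 p A) (top A) := by
    refine ⟨hA.top_dn.1, ?_⟩
    rw [hA.top_eq h1 h2.ne_pi]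
    exact h2.precEqI_top (by omega)
  by_cases hc : BlockCond c p A
  · cases hx : res p A 1 with
    | none =>
      rw [block_of_none hx]
      exact htop
    | some x =>
      obtain ⟨m, _, _, h3, h4, h5, h6⟩ := hA.block_some hcp (by omega) hc hx
      obtain ⟨h7, h8⟩ := ih _ (by have := hA.precI_size h3; omega) h4 rfl
      obtain ⟨g1, g2, -⟩ := h4.res0_spec (i := p) (by omega)
      have h9 : le m (block c p m) :=
        le_trans h4.wf g2.wf h7.wf (h4.precEqI_le g1) (g2.precEqI_le h8)
      obtain ⟨g, e, k1, k2, k3, -⟩ := hA.block_greatest hp h7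
        (lt_of_lt_of_le h2.wf h4.wf h7.wf h5 h9)
      rw [h6, e]
      exact ⟨k3, k1.precEqI⟩
  · rw [block_of_not_cond hc]
    exact htop

/-- The components before `p` are idle between `A` and `B`. -/
def Zs (c p : ℕ) (A B : Dg) : Prop := ∀ i, c ≤ i → i < p → PrecEqI i A B ∧ NoIn i A B

theorem Zs.mono (h : Zs c p A B) (hA : DN N A) (hx : DN N x) (hy : DN N y) (hp : p + 1 ≤ N)
    (h1 : PrecEqI p A x) (h2 : PrecEqI p x y) (h3 : PrecEqI p y B) : Zs c p x y := by
  intro i hi1 hi2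
  exact ⟨hx.precEqI_mono hi2.le hp h2, (h i hi1 hi2).2.mono (hA.precEqI_mono hi2.le hp h1)
    (hy.precEqI_mono hi2.le hp h3)⟩

theorem zs_self : Zs c c A B := fun _ h1 h2 => by omega

theorem Zs.succ (h : Zs c p A B) (h1 : PrecEqI p A B) (h2 : NoIn p A B) : Zs c (p + 1) A B := by
  intro i hi1 hi2
  rcases Nat.lt_succ_iff_lt_or_eq.1 hi2 with h3 | rfl
  · exact h i hi1 h3
  · exact ⟨h1, h2⟩

/-- Blocks do not change over idle segments. -/
theorem DN.block_eq (hA : DN N A) (hB : DN N B) (hcp : c ≤ p) (hp : p + 2 ≤ N) (hz : Zs c p A B)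
    (h : PrecEqI p A B) (hn : NoIn p A B) : block c p A = block c p B := by
  refine block_congr hA hB hcp hp (fun i hi1 hi2 => ?_) (hA.res0_congr h hB.2 hn).2
    (hA.top_eq h hB.ne_pi)
  rcases Nat.lt_or_eq_of_le hi2 with hi2 | rfl
  · obtain ⟨h1, h2⟩ := hz i hi1 hi2
    exact (hA.res0_congr h1 hB.2 h2).1
  · exact (hA.res0_congr h hB.2 hn).1

theorem DN.res0_res0 (hA : DN N A) (hi : i + 2 ≤ N) : res0 i (res0 i A) = res0 i A := by
  obtain ⟨h1, h2, h3⟩ := hA.res0_spec hi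
  exact ((hA.res0_congr h1 h2.2 h3).1).symm

theorem res0_of_mem (hx : IsDQ x) (h : i ∈ In x) : res0 i x = x := by
  rw [res0, firstIn_of_mem hx h]
  rfl

theorem DN.res0_eq_or (hA : DN N A) (hi : i + 1 ≤ N) :
    (firstIn i A = some (res0 i A) ∧ i ∈ In (res0 i A)) ∨
      (firstIn i A = none ∧ res0 i A = top A) := by
  unfold res0
  cases h : firstIn i A with
  | none => exact Or.inr ⟨rfl, rfl⟩
  | some e => exact Or.inl ⟨rfl, (hA.firstIn_spec hi h).2.1⟩

/-- The recursive description of the block of `A` relative to some `B` above. -/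
theorem DN.block_step (hA : DN N A) (hB : DN N B) (hcp : c ≤ p) (hp : p + 3 ≤ N)
    (hz : Zs c p A B) (hAB : PrecEqI p A B) (hu : Unc p A B) (hn : ¬ NoIn p A B) :
    p ∈ In (res0 p A) ∧ PrecI p (res0 p A) B ∧ ∃ y, DN N y ∧
      (y = B ∨ (PrecI p (res0 p A) y ∧ PrecI p y B ∧ p ∈ In y ∧ Unc p (res0 p A) y)) ∧
      PrecI (p + 1) (res0 p A) (block c p y) ∧ PrecPEq (p + 1) (res0 p A) (block c p A) ∧
      lt (block c p A) (block c p y) ∧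
      ∀ δ, PrecPEq (p + 1) (res0 p A) δ → lt δ (block c p y) → le δ (block c p A) := by
  obtain ⟨h1, hE, h3⟩ := hA.res0_spec (i := p) (by omega)
  unfold NoIn at hn
  push Not at hn
  obtain ⟨z, hz1, hz2, hz3⟩ := hn
  obtain ⟨e, he, hez⟩ := hA.exists_firstIn (by omega) hz1 hz3
  have hee : res0 p A = e := by rw [res0, he]; rfl
  have hin := (hA.firstIn_spec (by omega) he).2.1
  rw [hee] at h1 hE h3 ⊢
  have heB := hez.trans_precI hz2
  refine ⟨hin, heB, ?_⟩
  obtain ⟨s, κ, hs⟩ := hE.exists_inn (i := p) (by omega) hin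
  obtain ⟨heκ, hκ⟩ := hE.inn_prec (by omega) hs
  have hκN := (hE.precEqI_prec heκ.toEq).2.resolve_left hκ
  -- Otherwise B would lie strictly before the range of e, and e would cover B.
  have hκB : PrecEqI p κ B := by
    rcases precEqI_total heκ.toEq heB.toEq with h | h
    · exact h
    · exact (hu e h1 ⟨hE.2, hB.2, hin, heB, κ, (inn_eq_some.1 hs).2, h⟩).elim
  have hres : ∀ i, c ≤ i → i < p → res0 i A = res0 i B := fun i hi1 hi2 =>
    (hA.res0_congr (hz i hi1 hi2).1 hB.2 (hz i hi1 hi2).2).1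
  have hBi : ∀ i, i < p → le B (res0 i B) := fun i hi =>
    hB.precEqI_le (hB.res0_spec (i := i) (by omega)).1
  have hri : ∀ i, i < p → WF (res0 i B) := fun i hi => (hB.res0_spec (i := i) (by omega)).2.1.wf
  have hrg : rg p A = some κ := by
    rw [(hA.res0_congr h1 hE.2 h3).2, (inn_eq_some.1 hs).2]
  have hc : BlockCond c p A := by
    intro i hi1 hi2
    rw [hres i hi1 hi2, hee]
    exact ⟨lt_of_lt_of_le hE.wf hB.wf (hri i hi2) (hE.precI_lt heB) (hBi i hi2), κ, hrg,
      le_trans hκN.wf hB.wf (hri i hi2) (hκN.precEqI_le hκB) (hBi i hi2)⟩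
  have hr1 : res p A 1 = some (res0 p κ) := by
    rw [res_succ res_zero (by rw [hee]; exact hin), hee, (inn_eq_some.1 hs).2, Option.bind_some,
      hA.top_eq (h1.trans heκ.toEq) hκ]
    rfl
  obtain ⟨k1, k2, k3⟩ := hκN.res0_spec (i := p) (by omega)
  obtain ⟨m, hm, hmin, -, hmN, hem, hbl⟩ := hA.block_some hcp (by omega) hc hr1
  rw [hee] at hem hbl
  -- It is enough to find y, either B or the next resolvent, whose block bounds the block of A.
  suffices h : ∃ y, DN N y ∧
      (y = B ∨ (PrecI p e y ∧ PrecI p y B ∧ p ∈ In y ∧ Unc p e y)) ∧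
      PrecI (p + 1) e (res0 p y) ∧ block c p m = block c p y by
    obtain ⟨y, hy, h4, h5, h6⟩ := h
    obtain ⟨h7, h8⟩ := hy.block_spec hcp hp
    have h9 := h5.trans_precEqI h8
    rw [h6, ← hee] at hbl
    obtain ⟨g, eg, j1, j2, j3, j4⟩ := hA.block_greatest hp h7
      (by rw [hee]; exact hE.precI_lt h9)
    rw [eg] at hbl
    rw [hee] at j1 j4
    rw [hbl]
    exact ⟨y, hy, h4, h9, j1, j2, j4⟩
  -- If the next resolvent comes before B, it is α', because the earlier positions contribute only
  -- elements at or above B. If not, it is the first resolvent of B, and the recursive call must be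
  -- compared with the block of B.
  by_cases hy : PrecI p (res0 p κ) B
  · have hin1 : firstIn p κ = some (res0 p κ) ∧ p ∈ In (res0 p κ) := by
      refine (hκN.res0_eq_or (by omega)).resolve_right ?_
      rintro ⟨_, h⟩
      rw [h] at hy
      exact hB.ne_pi (hκN.not_top_prec hy)
    refine ⟨res0 p κ, k2, Or.inr ⟨heκ.trans_precEqI k1, hy, hin1.2,
      hE.unc_next (by omega) hs k1 k3⟩, ?_, ?_⟩
    · rw [hκN.res0_res0 (by omega)]
      exact hE.precI_succ_firstIn_rg (by omega) hin hs hin1.1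
    · have : m = res0 p κ := by
        refine le_antisymm hmN.wf k2.wf (hmin _ (Or.inr rfl)) ?_
        rcases hm with ⟨i, hi1, hi2, rfl⟩ | rfl
        · rw [hres i hi1 hi2]
          exact le_trans k2.wf hB.wf (hri i hi2) (Or.inl (k2.precI_lt hy)) (hBi i hi2)
        · exact le_refl _
      rw [this]
  · have hBr : PrecEqI p B (res0 p κ) := by
      rcases precEqI_total hκB k1 with h | h
      · exact h
      · exact (hy h).elim
    have hrB : res0 p κ = res0 p B :=
      (hκN.res0_congr hκB hB.2 (k3.mono .refl hBr)).1
    refine ⟨B, hB, Or.inl rfl, ?_, ?_⟩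
    · rw [← hrB]
      rcases hκN.res0_eq_or (i := p) (by omega) with h | ⟨_, h⟩
      · exact hE.precI_succ_firstIn_rg (by omega) hin hs h.1
      · rw [h, ← hE.top_eq heκ.toEq hκ]
        rcases precEqI_iff.1 (hE.precEqI_top (i := p + 1) (by omega)) with h' | h'
        · rw [h'] at hin
          exact (hE.not_mem_in_top (by omega) hin).elim
        · exact h'
    · rw [hrB] at hmin hm
      have g0 : ∀ i, i < p → DN N (res0 i B) := fun i hi => (hB.res0_spec (i := i) (by omega)).2.1
      obtain ⟨g1, g2, g3⟩ := hB.res0_spec (i := p) (by omega)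
      -- If an earlier resolvent of B is ≤ its p-th resolvent, the defining condition fails for B as
      -- well as for α' = m, which is then one of these resolvents; both blocks are the default top.
      -- If not, m is the p-th resolvent of B, and B and m have the same data.
      by_cases hj : ∃ j, c ≤ j ∧ j < p ∧ le (res0 j B) (res0 p B)
      · obtain ⟨j, hj1, hj2, hj3⟩ := hj
        have hmj : ∃ j, c ≤ j ∧ j < p ∧ m = res0 j B := by
          rcases hm with ⟨i, hi1, hi2, rfl⟩ | rfl
          · exact ⟨i, hi1, hi2, hres i hi1 hi2⟩
          · refine ⟨j, hj1, hj2, le_antisymm hmN.wf (g0 j hj2).wf ?_ hj3⟩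
            exact hmin _ (Or.inl ⟨j, hj1, hj2, (hres j hj1 hj2).symm⟩)
        obtain ⟨j', hj1', hj2', rfl⟩ := hmj
        obtain ⟨f1, f2, -⟩ := hB.res0_spec (i := j') (by omega)
        rw [block_of_not_cond, block_of_not_cond, hB.top_eq f1 f2.ne_pi]
        · intro h
          exact not_lt_of_le (g0 j hj2).wf g2.wf hj3 (h j hj1 hj2).1
        · intro h
          have h4 := (h j' hj1' hj2').1
          rw [hB.res0_res0 (by omega)] at h4
          have h5 := f2.res0_spec (i := p) (by omega)
          exact not_lt_of_le f2.wf h5.2.1.wf (f2.precEqI_le h5.1) h4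
      · push Not at hj
        have hlt : ∀ i, c ≤ i → i < p → lt (res0 p B) (res0 i B) := by
          intro i hi1 hi2
          rcases le_or_lt (g0 i hi2).wf g2.wf with h | h
          · exact (hj i hi1 hi2 h).elim
          · exact h
        have hmB : m = res0 p B := by
          refine le_antisymm hmN.wf g2.wf (hmin _ (Or.inr rfl)) ?_
          rcases hm with ⟨i, hi1, hi2, rfl⟩ | rfl
          · rw [hres i hi1 hi2]
            exact Or.inl (hlt i hi1 hi2)
          · exact le_refl _
        rw [hmB]
        refine (block_congr hB g2 hcp (by omega) (fun i hi1 hi2 => ?_)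
          (hB.res0_congr g1 g2.2 g3).2 (hB.top_eq g1 g2.ne_pi)).symm
        rcases Nat.lt_or_eq_of_le hi2 with hi2 | rfl
        · obtain ⟨f1, f2, f3⟩ := hB.res0_spec (i := i) (by omega)
          have g1' := hB.precEqI_mono hi2.le (by omega) g1
          exact (hB.res0_congr g1' g2.2 (f3.mono .refl
            (hB.precEqI_of_le g1' f1 (Or.inl (hlt i hi1 hi2))))).1
        · exact (hB.res0_res0 (by omega)).symm

theorem not_noIn_of_mem (h : p ∈ In x) (h' : PrecI p x B) : ¬ NoIn p x B :=
  fun hn => hn x .refl h' h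

/-- Blocks are strictly monotone where `p` occurs in between. -/
theorem DN.block_prec (hA : DN N A) (hB : DN N B) (hcp : c ≤ p) (hp : p + 3 ≤ N)
    (hz : Zs c p A B) (hAB : PrecEqI p A B) (hu : Unc p A B) (hn : ¬ NoIn p A B) :
    PrecI (p + 1) (block c p A) (block c p B) := by
  induction hk : size A using Nat.strong_induction_on generalizing A with
  | _ k ih =>
  obtain ⟨h1, h2, -⟩ := hA.res0_spec (i := p) (by omega)
  obtain ⟨_, _, y, hy, h5, h6, h7, h8, _⟩ := hA.block_step hB hcp hp hz hAB hu hn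
  have h9 := h2.precI_of_lt h7.precEqI h6.toEq h8
  rcases h5 with rfl | ⟨g1, g2, g3, g4⟩
  · exact h9
  · have hAy := h1.trans_precI g1
    refine Relation.TransGen.trans h9 (ih _ ?_ hy (hz.mono hA hy hB (by omega) hAy.toEq g2.toEq
      .refl) g2.toEq (hu.mono hAy.toEq) (not_noIn_of_mem g3 g2) rfl)
    have := hA.precI_size hAy
    omega

/-- An uncovered element between two blocks is a block. -/
theorem DN.block_surj (hA : DN N A) (hB : DN N B) (hcp : c ≤ p) (hp : p + 3 ≤ N)
    (hz : Zs c p A B) (hAB : PrecEqI p A B) (hu : Unc p A B) (hn : ¬ NoIn p A B)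
    (h1 : PrecEqI (p + 1) (block c p A) x) (h2 : PrecI (p + 1) x (block c p B))
    (h3 : Unc (p + 1) (block c p A) x) : ∃ e, DN N e ∧ PrecEqI p A e ∧ PrecI p e B ∧ p ∈ In e ∧
      Unc p A e ∧ block c p e = x := by
  induction hk : size A using Nat.strong_induction_on generalizing A with
  | _ k ih =>
  obtain ⟨k1, k2, k3⟩ := hA.res0_spec (i := p) (by omega)
  obtain ⟨g1, g2, y, hy, h5, h6, h7, h8, h9⟩ := hA.block_step hB hcp hp hz hAB hu hn
  have hbA := (hA.block_spec hcp hp).1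
  have hxN := hbA.of_precI h1 h2
  have hyN := (hy.block_spec hcp hp).1
  rcases le_or_lt hyN.wf hxN.wf with hyx | hyx
  · rcases h5 with rfl | ⟨f1, f2, f3, f4⟩
    · exact (not_lt_of_le hyN.wf hxN.wf hyx (hxN.precI_lt h2)).elim
    · have hAy := k1.trans_precI f1
      have hzy := hz.mono hA hy hB (by omega) hAy.toEq f2.toEq .refl
      have hb : PrecEqI (p + 1) (block c p A) (block c p y) :=
        (k2.precI_of_lt h7.precEqI h6.toEq h8).toEq
      obtain ⟨e, e1, e2, e3, e4, e5, e6⟩ := ih _ (by have := hA.precI_size hAy; omega) hy hzy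
        f2.toEq (hu.mono hAy.toEq) (not_noIn_of_mem f3 f2) (hbA.precEqI_of_le hb h1 hyx)
        (h3.mono hb) rfl
      exact ⟨e, e1, hAy.toEq.trans e2, e3, e4, hA.unc_trans hAy.toEq e2
        (hA.unc_trans k1 f1.toEq k3.unc f4) e5, e6⟩
  -- If x is below the block of y, then x is an uncovered competitor in the maximum defining the
  -- block of A. That block is therefore x, and α_p^0 has the same block.
  · refine ⟨res0 p A, k2, k1, g2, g1, k3.unc, ?_⟩
    rw [← hA.block_eq k2 hcp (by omega) (hz.mono hA hA k2 (by omega) .refl k1 g2.toEq) k1 k3]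
    refine le_antisymm hbA.wf hxN.wf (hbA.precEqI_le h1) (h9 x ?_ hyx)
    by_cases e : res0 p A = x
    · exact Or.inr e
    · left
      rw [k2.precP_iff (by omega)]
      have hb := h7.precEqI
      refine ⟨(precEqI_iff.1 (hb.trans h1)).resolve_left e, ?_⟩
      refine k2.unc_trans hb h1 ?_ h3
      rcases h7 with h7 | h7
      · exact ((k2.precP_iff (by omega)).1 h7).2
      · rw [← h7]
        exact k2.unc_refl

/-- The starting point of a block may be raised to a position whose resolvent is small. -/
theorem DN.block_restart (hA : DN N A) (hci : c ≤ i) (hip : i < p) (hp : p + 2 ≤ N)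
    (h : ∀ j, c ≤ j → j < i → lt (res0 i A) (res0 j A)) : block c p A = block i p A := by
  induction hk : size A using Nat.strong_induction_on generalizing A with
  | _ k ih =>
  obtain ⟨h1, h2, h3⟩ := hA.res0_spec (i := i) (by omega)
  obtain ⟨k1, k2, -⟩ := hA.res0_spec (i := p) (by omega)
  have hj : ∀ j, j < i → WF (res0 j A) := fun j hj => (hA.res0_spec (i := j) (by omega)).2.1.wf
  have hc : BlockCond c p A ↔ BlockCond i p A := by
    refine ⟨fun h j hj1 hj2 => h j (by omega) hj2, fun h' j hj1 hj2 => ?_⟩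
    rcases Nat.lt_or_ge j i with hji | hji
    -- The bounds at position i imply those at each j < i, since the i-th resolvent is below the
    -- j-th. For the same reason the positions j < i do not affect the minimum α'.
    · obtain ⟨g1, κ, g2, g3⟩ := h' i le_rfl hip
      obtain ⟨s, hs⟩ := rg_eq_some g2
      exact ⟨lt_trans k2.wf h2.wf (hj j hji) g1 (h j hj1 hji), κ, g2,
        Or.inl (lt_of_le_of_lt (inn_isOd hs hA.1).2.wf h2.wf (hj j hji) g3 (h j hj1 hji))⟩
    · exact h' j hji hj2
  by_cases hcA : BlockCond i p A
  · cases hx : res p A 1 with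
    | none => rw [block_of_none hx, block_of_none hx]
    | some x =>
      obtain ⟨m, hm, hmin, hAm, hmN, _, e⟩ := hA.block_some (by omega) hp hcA hx
      obtain ⟨m', hm', hmin', _, hmN', _, e'⟩ := hA.block_some (by omega) hp (hc.2 hcA) hx
      have hmi : le m (res0 i A) := hmin _ (Or.inl ⟨i, le_rfl, hip, rfl⟩)
      have : m = m' := by
        refine le_antisymm hmN.wf hmN'.wf ?_ (hmin' _ ?_)
        · rcases hm' with ⟨j, hj1, hj2, rfl⟩ | rfl
          · rcases Nat.lt_or_ge j i with hji | hji
            · exact Or.inl (lt_of_le_of_lt hmN.wf h2.wf (hj j hji) hmi (h j hj1 hji))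
            · exact hmin _ (Or.inl ⟨j, hji, hj2, rfl⟩)
          · exact hmin _ (Or.inr rfl)
        · rcases hm with ⟨j, hj1, hj2, rfl⟩ | rfl
          · exact Or.inl ⟨j, by omega, hj2, rfl⟩
          · exact Or.inr rfl
      subst this
      have hAmi := hA.precEqI_of_le hAm.toEq h1 hmi
      have hri : res0 i A = res0 i m := (hA.res0_congr hAm.toEq hmN.2 (h3.mono .refl hAmi)).1
      have := ih _ (by have := hA.precI_size hAm; omega) hmN (fun j hj1 hj2 => ?_) rfl
      · rw [e, e', this]
      · have h4 := hA.precEqI_mono hj2.le (by omega) hAm.toEq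
        obtain ⟨f1, f2, f3⟩ := hA.res0_spec (i := j) (by omega)
        have h5 : lt m (res0 j A) := lt_of_le_of_lt hmN.wf h2.wf f2.wf hmi (h j hj1 hj2)
        rw [← hri, ← (hA.res0_congr h4 hmN.2
          (f3.mono .refl (hA.precEqI_of_le h4 f1 (Or.inl h5)))).1]
        exact h j hj1 hj2
  · rw [block_of_not_cond hcA, block_of_not_cond (fun h => hcA (hc.1 h))]

end

/-! ## Traces -/

/-- `A` and `B` are related by `≺` along `w`, where the current component starts at `c` and the
current position is `p`. -/
def Tr : ℕ → ℕ → List Bool → Dg → Dg → Prop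
  | _, p, [], A, B => PrecI p A B
  | c, p, false :: w, A, B => PrecI p A B ∧ NoIn p A B ∧ Tr c (p + 1) w A B
  | c, p, true :: w, A, B => PrecI p A B ∧ Unc p A B ∧ ¬ NoIn p A B ∧
      Tr (p + 1) (p + 1) w (block c p A) (block c p B)

section
variable {N : ℕ} {A B D x y z η ξ : Dg} {b : Bool} {i j c p : ℕ} {w t u : List Bool}

theorem Tr.precI (h : Tr c p w A B) : PrecI p A B := by
  cases w with
  | nil => exact h
  | cons b w => cases b <;> exact h.1

theorem DN.precI_of_precI_succ (hA : DN N A) (hi : i + 2 ≤ N) (h : PrecI (i + 1) A B) :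
    PrecI i A B := by
  rcases precEqI_iff.1 (hA.precI_of_succ hi h.toEq) with rfl | h'
  · exact (hA.precI_irrefl h).elim
  · exact h'

theorem precI_succ (hA : DN N A) (h : PrecI i A B) (hn : NoIn i A B) : PrecI (i + 1) A B := by
  rcases precEqI_iff.1 (precEqI_succ h.toEq hn) with rfl | h'
  · exact (hA.precI_irrefl h).elim
  · exact h'

theorem DN.evFrom (hA : DN N A) (hcp : c ≤ p) (hp : p + w.length + 2 ≤ N) :
    DN N (evFrom c p w A) := by
  induction w generalizing c p A with
  | nil => exact hA
  | cons b w ih =>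
    simp only [List.length_cons] at hp
    cases b with
    | false => exact ih hA (by omega) (by omega)
    | true => exact ih (hA.block_spec hcp (by omega)).1 le_rfl (by omega)

theorem Tr.precI_end (h : Tr c p w A B) :
    PrecI (p + w.length) (evFrom c p w A) (evFrom c p w B) := by
  induction w generalizing c p A B with
  | nil => exact h
  | cons b w ih =>
    have e : p + (b :: w).length = p + 1 + w.length := by simp only [List.length_cons]; omega
    rw [e]
    cases b with
    | false => exact ih h.2.2
    | true => exact ih h.2.2.2

/-- On an idle last segment ≺_i becomes ≺_{i+1} for the same pair, and uncoveredness is automatic.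
On a segment with an occurrence the step is `DN.block_prec`, which needs uncoveredness. -/
theorem tr_snoc (hA : DN N A) (hB : DN N B) (hcp : c ≤ p) (hp : p + w.length + 3 ≤ N)
    (hz : Zs c p A B) : Tr c p (w ++ [b]) A B ↔ Tr c p w A B ∧
      Unc (p + w.length) (evFrom c p w A) (evFrom c p w B) ∧
      (b = true ↔ ¬ NoIn (p + w.length) (evFrom c p w A) (evFrom c p w B)) := by
  induction w generalizing c p A B with
  | nil =>
    cases b with
    | false =>
      have : Tr c p [false] A B ↔ PrecI p A B ∧ NoIn p A B ∧ PrecI (p + 1) A B := Iff.rfl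
      simp only [List.nil_append, this, Tr, evFrom, List.length_nil, Nat.add_zero,
        Bool.false_eq_true, false_iff, not_not]
      exact ⟨fun h => ⟨h.1, h.2.1.unc, h.2.1⟩, fun h => ⟨h.1, h.2.2, precI_succ hA h.1 h.2.2⟩⟩
    | true =>
      have : Tr c p [true] A B ↔ PrecI p A B ∧ Unc p A B ∧ ¬ NoIn p A B ∧
        PrecI (p + 1) (block c p A) (block c p B) := Iff.rfl
      simp only [List.nil_append, this, Tr, evFrom, List.length_nil, Nat.add_zero, true_iff]
      exact ⟨fun h => ⟨h.1, h.2.1, h.2.2.1⟩, fun h => ⟨h.1, h.2.1, h.2.2,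
        hA.block_prec hB hcp hp hz h.1.toEq h.2.1 h.2.2⟩⟩
  | cons b' w ih =>
    have e : p + (b' :: w).length = p + 1 + w.length := by simp only [List.length_cons]; omega
    rw [e] at hp ⊢
    cases b' with
    | false =>
      have h1 : ∀ v, Tr c p (false :: v) A B ↔ PrecI p A B ∧ NoIn p A B ∧ Tr c (p + 1) v A B :=
        fun _ => Iff.rfl
      rw [List.cons_append, h1, h1]
      have ih' := fun h => ih hA hB (c := c) (p := p + 1) (by omega) hp h
      simp only [evFrom]
      constructor
      · rintro ⟨h2, h3, h4⟩
        have := (ih' (hz.succ h2.toEq h3)).1 h4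
        exact ⟨⟨h2, h3, this.1⟩, this.2⟩
      · rintro ⟨⟨h2, h3, h4⟩, h5⟩
        exact ⟨h2, h3, (ih' (hz.succ h2.toEq h3)).2 ⟨h4, h5⟩⟩
    | true =>
      have h1 : ∀ v, Tr c p (true :: v) A B ↔ PrecI p A B ∧ Unc p A B ∧ ¬ NoIn p A B ∧
        Tr (p + 1) (p + 1) v (block c p A) (block c p B) := fun _ => Iff.rfl
      rw [List.cons_append, h1, h1]
      simp only [evFrom]
      rw [ih (hA.block_spec hcp (by omega)).1 (hB.block_spec hcp (by omega)).1 le_rfl hp zs_self]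
      tauto

theorem branch_length (n : ℕ) : (branch i A B n).length = n := by
  induction n with
  | zero => rfl
  | succ n ih => simp [branch, ih]

theorem subBranch_snoc : SubBranch i (w ++ [b]) A B ↔ SubBranch i w A B ∧
    (b = true ↔ ¬ NoIn (i + w.length) (ev i w A) (ev i w B)) := by
  have e : ∀ q (x y : Dg), (∃ γ, PrecEqI q x γ ∧ PrecI q γ y ∧ q ∈ In γ) ↔ ¬ NoIn q x y := by
    intro q x y
    unfold NoIn
    push Not
    rfl
  classical
  unfold SubBranch
  rw [List.length_append, List.length_singleton, branch]
  constructor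
  · intro h
    obtain ⟨h1, h2⟩ := List.append_inj' h rfl
    refine ⟨h1, ?_⟩
    rw [← h1] at h2
    have h2 := (List.cons.inj h2).1
    rw [h2, decide_eq_true_iff, e]
  · rintro ⟨h1, h2⟩
    rw [← h1]
    congr 2
    rw [Bool.eq_iff_iff, decide_eq_true_iff, e, h2]

theorem ev_dn (hA : DN N A) (hp : i + w.length + 2 ≤ N) : DN N (ev i w A) :=
  hA.evFrom le_rfl hp

/-- A trace records uncoveredness only at proper initial segments, so the condition at the full w
has to be added. -/
theorem precS_iff (hA : DN N A) (hB : DN N B) (hp : i + w.length + 2 ≤ N) :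
    PrecS i w A B ↔ Tr i i w A B ∧ Unc (i + w.length) (ev i w A) (ev i w B) := by
  induction w using List.reverseRecOn with
  | nil =>
    have e : PrecS i [] A B ↔ PrecP i A B := by
      refine ⟨fun h => h.2.2.2 0 le_rfl, fun h => ⟨hA.2, hB.2, rfl, fun n hn => ?_⟩⟩
      obtain rfl : n = 0 := Nat.le_zero.1 hn
      exact h
    have hp' : i + 2 ≤ N := by simpa using hp
    rw [e, hA.precP_iff hp']
    rfl
  | append_singleton w b ih =>
    rw [List.length_append, List.length_singleton, ← Nat.add_assoc] at hp
    have ih := ih (by omega)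
    have hz : Zs i i A B := zs_self
    have e : PrecS i (w ++ [b]) A B ↔ PrecS i w A B ∧
        (b = true ↔ ¬ NoIn (i + w.length) (ev i w A) (ev i w B)) ∧
        PrecP (i + w.length + 1) (ev i (w ++ [b]) A) (ev i (w ++ [b]) B) := by
      unfold PrecS
      rw [subBranch_snoc]
      constructor
      · rintro ⟨h1, h2, ⟨h3, h4⟩, h5⟩
        refine ⟨⟨h1, h2, h3, fun n hn => ?_⟩, h4, ?_⟩
        · have := h5 n (by rw [List.length_append]; omega)
          rwa [List.take_append_of_le_length hn] at this
        · have := h5 (w.length + 1) (by simp)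
          rwa [List.take_of_length_le (by simp), ← Nat.add_assoc] at this
      · rintro ⟨⟨h1, h2, h3, h5⟩, h4, h6⟩
        refine ⟨h1, h2, ⟨h3, h4⟩, fun n hn => ?_⟩
        rw [List.length_append, List.length_singleton] at hn
        rcases Nat.lt_or_eq_of_le hn with hn | rfl
        · rw [List.take_append_of_le_length (by omega)]
          exact h5 n (by omega)
        · rw [List.take_of_length_le (by simp), ← Nat.add_assoc]
          exact h6
    have hs := tr_snoc (b := b) hA hB le_rfl hp hz
    have hE : DN N (ev i (w ++ [b]) A) := ev_dn hA (by simp; omega)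
    rw [e, ih, hE.precP_iff (by omega), hs]
    have e2 : i + (w ++ [b]).length = i + w.length + 1 := by simp; omega
    constructor
    · rintro ⟨⟨h1, h2⟩, h3, h4, h5⟩
      exact ⟨⟨h1, h2, h3⟩, by rw [e2]; exact h5⟩
    · rintro ⟨⟨h1, h2, h3⟩, h4⟩
      have h5 := (hs.2 ⟨h1, h2, h3⟩).precI_end
      rw [e2] at h4 h5
      exact ⟨⟨h1, h2⟩, h3, h5, h4⟩

theorem lhdS_iff (hA : DN N A) (hB : DN N B) (hp : i + w.length + 2 ≤ N) :
    LhdS i w A B ↔ Tr i i w A B ∧ LhdI (i + w.length) (ev i w A) (ev i w B) := by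
  unfold LhdS
  induction w using List.reverseRecOn with
  | nil => exact ⟨fun h => ⟨h.2.2.2.2.2.2.2.1, h.2.2.2.2⟩, fun h => ⟨hA.2, hB.2, rfl,
      fun h => (h rfl).elim, h.2⟩⟩
  | append_singleton w b _ =>
    have e2 : i + (w ++ [b]).length = i + w.length + 1 := by simp; omega
    rw [e2] at hp ⊢
    have hz : Zs i i A B := zs_self
    rw [tr_snoc hA hB le_rfl hp hz, subBranch_snoc, List.dropLast_concat,
      precS_iff hA hB (by omega)]
    constructor
    · rintro ⟨_, _, ⟨_, h1⟩, h2, h3⟩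
      obtain ⟨h4, h5⟩ := h2 (by simp)
      exact ⟨⟨h4, h5, h1⟩, h3⟩
    · rintro ⟨⟨h1, h2, h3⟩, h4⟩
      refine ⟨hA.2, hB.2, ⟨?_, h3⟩, fun _ => ⟨h1, h2⟩, h4⟩
      exact ((precS_iff hA hB (by omega)).2 ⟨h1, h2⟩).2.2.1

/-! ## Pulling back along a trace -/

/-- Uncovered position above `A` along `t`. -/
def Pos : ℕ → ℕ → List Bool → Dg → Dg → Prop
  | _, p, [], A, η => PrecEqI p A η ∧ Unc p A η
  | c, p, false :: t, A, η => (PrecEqI p A η ∧ Unc p A η) ∧ Pos c (p + 1) t A η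
  | c, p, true :: t, A, η => (PrecEqI p A η ∧ Unc p A η) ∧
      Pos (p + 1) (p + 1) t (block c p A) (block c p η)

theorem Pos.head (h : Pos c p t A η) : PrecEqI p A η ∧ Unc p A η := by
  cases t with
  | nil => exact h
  | cons b t => cases b <;> exact h.1

/-- The chain condition in `◁_s^+`. -/
def Chain (N p : ℕ) (η : Dg) : Prop := ∃ (L : ℕ) (a : ℕ → Dg) (v : ℕ → List Bool),
  a L = η ∧ a 0 = res0 p (a L) ∧ ∀ k < L, InI N p (v k) ∧ LhdS p (v k) (a (k + 1)) (a k)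

/-- The chain conditions along `t`. -/
def Chains (N : ℕ) : ℕ → ℕ → List Bool → Dg → Prop
  | _, _, [], _ => True
  | c, p, false :: t, η => Chains N c (p + 1) t η
  | c, p, true :: t, η => (p ∉ In η → Chain N p η) ∧ Chains N (p + 1) (p + 1) t (block c p η)

theorem chains_iff : Chains N c p t η ↔ ∀ n, t[n]? = some true →
    p + n ∉ In (evFrom c p (t.take n) η) → Chain N (p + n) (evFrom c p (t.take n) η) := by
  induction t generalizing c p η with
  | nil => simp [Chains]
  | cons b t ih =>
    have key : ∀ n, p + (n + 1) = p + 1 + n := fun n => by omega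
    cases b with
    | false =>
      simp only [Chains, ih]
      constructor
      · intro h n hn
        cases n with
        | zero => simp at hn
        | succ n => rw [key]; exact h n (by simpa using hn)
      · intro h n hn
        have := h (n + 1) (by simpa using hn)
        rwa [key] at this
    | true =>
      simp only [Chains, ih]
      constructor
      · rintro ⟨h0, h⟩ n hn
        cases n with
        | zero => exact h0
        | succ n => rw [key]; exact h n (by simpa using hn)
      · intro h
        refine ⟨h 0 rfl, fun n hn => ?_⟩
        have := h (n + 1) (by simpa using hn)
        rwa [key] at this

theorem lhdSPlus_iff : LhdSPlus N i w A B ↔ LhdS i w A B ∧ Chains N i i w A := by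
  rw [chains_iff]
  unfold LhdSPlus
  refine and_congr_right fun _ => forall_congr' fun n => imp_congr_right fun _ =>
    imp_congr_right fun _ => exists_congr fun L => exists_congr fun a => exists_congr fun v => ?_
  rfl

/-- Every uncovered element between A(t) and B(t) has the form η(t): blocks are undone one at a
time, from the last component back to the first, by `DN.block_surj`. -/
theorem exists_pullback (hA : DN N A) (hB : DN N B) (hcp : c ≤ p) (hp : p + t.length + 2 ≤ N)
    (hz : Zs c p A B) (ht : Tr c p t A B)
    (h1 : PrecEqI (p + t.length) (evFrom c p t A) x) (h2 : PrecI (p + t.length) x (evFrom c p t B))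
    (h3 : Unc (p + t.length) (evFrom c p t A) x) :
    ∃ η, DN N η ∧ Pos c p t A η ∧ Tr c p t η B ∧ evFrom c p t η = x ∧ Chains N c p t η := by
  induction t generalizing c p A B with
  | nil => exact ⟨x, hA.of_precI h1 h2, ⟨h1, h3⟩, h2, rfl, trivial⟩
  | cons b t ih =>
    have e : p + (b :: t).length = p + 1 + t.length := by simp only [List.length_cons]; omega
    rw [e] at hp h1 h2 h3
    cases b with
    | false =>
      obtain ⟨g1, g2, g3⟩ := ht
      obtain ⟨η, k1, k2, k3, k4, k5⟩ := ih hA hB (by omega) hp (hz.succ g1.toEq g2) g3 h1 h2 h3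
      have k6 := hA.precI_of_succ (by omega) k2.head.1
      have k7 := k1.precI_of_precI_succ (by omega) k3.precI
      exact ⟨η, k1, ⟨⟨k6, (g2.mono .refl k7.toEq).unc⟩, k2⟩, ⟨k7, g2.mono k6 .refl, k3⟩, k4, k5⟩
    | true =>
      obtain ⟨g1, g2, g3, g4⟩ := ht
      obtain ⟨ζ, k1, k2, k3, k4, k5⟩ := ih (hA.block_spec hcp (by omega)).1
        (hB.block_spec hcp (by omega)).1 le_rfl hp zs_self g4 h1 h2 h3
      -- The preimage has p ∈ In, so the chain condition at p is vacuous.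
      obtain ⟨η, f1, f2, f3, f4, f5, rfl⟩ := hA.block_surj hB hcp (by omega) hz g1.toEq g2 g3
        k2.head.1 k3.precI k2.head.2
      exact ⟨η, f1, ⟨⟨f2, f5⟩, k2⟩, ⟨f3, g2.mono f2, not_noIn_of_mem f4 f3, k3⟩, k4,
        fun h => (h f4).elim, k5⟩

end

section
variable {N : ℕ} {A B D x y z η ξ : Dg} {b : Bool} {i j c c' p : ℕ} {w t u : List Bool}

theorem noIn_trans (hAB : PrecEqI i A B) (h1 : NoIn i A B) (h2 : NoIn i B D) : NoIn i A D := by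
  intro z hz1 hz2
  rcases precEqI_total hAB hz1 with h | h
  · exact h2 z h hz2
  · exact h1 z hz1 h

theorem LhdI.of_between (h : LhdI i x z) (hxy : PrecI i x y) (hyz : PrecEqI i y z)
    (hy : IsDQ y) : LhdI i x y := by
  obtain ⟨h1, _, h3, _, κ, h5, h6⟩ := h
  exact ⟨h1, hy, h3, hxy, κ, h5, hyz.trans_precI h6⟩

/-! ## Changing the starting point of a component -/

theorem evFrom_restart (hp : p + w.length + 2 ≤ N)
    (h : ∀ q, p ≤ q → q + 2 ≤ N → block c q A = block c' q A) :
    evFrom c p w A = evFrom c' p w A := by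
  induction w generalizing p with
  | nil => rfl
  | cons b w ih =>
    simp only [List.length_cons] at hp
    cases b with
    | false => exact ih (by omega) fun q hq => h q (by omega)
    | true => simp only [evFrom, h p le_rfl (by omega)]

theorem tr_restart (hp : p + w.length + 2 ≤ N)
    (h : ∀ q, p ≤ q → q + 2 ≤ N → block c q A = block c' q A)
    (h' : ∀ q, p ≤ q → q + 2 ≤ N → block c q B = block c' q B) (hT : Tr c p w A B) :
    Tr c' p w A B := by
  induction w generalizing p with
  | nil => exact hT
  | cons b w ih =>
    simp only [List.length_cons] at hp
    cases b with
    | false =>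
      exact ⟨hT.1, hT.2.1, ih (by omega) (fun q hq => h q (by omega)) (fun q hq => h' q (by omega))
        hT.2.2⟩
    | true =>
      refine ⟨hT.1, hT.2.1, hT.2.2.1, ?_⟩
      rw [← h p le_rfl (by omega), ← h' p le_rfl (by omega)]
      exact hT.2.2.2

theorem DN.res0_lt (hA : DN N A) (hB : DN N B) (hp : p + 2 ≤ N) (hz : Zs c p A B)
    (hn : ¬ NoIn p A B) (hcj : c ≤ j) (hjp : j < p) : lt (res0 p A) (res0 j A) := by
  unfold NoIn at hn
  push Not at hn
  obtain ⟨z, h1, h2, h3⟩ := hn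
  obtain ⟨e, he, hez⟩ := hA.exists_firstIn (by omega) h1 h3
  have hee : res0 p A = e := by rw [res0, he]; rfl
  obtain ⟨k1, k2, -⟩ := hA.res0_spec hp
  obtain ⟨g1, g2⟩ := hz j hcj hjp
  rw [(hA.res0_congr g1 hB.2 g2).1]
  obtain ⟨f1, f2, -⟩ := hB.res0_spec (i := j) (by omega)
  rw [hee] at k2 ⊢
  exact lt_of_lt_of_le k2.wf hB.wf f2.wf (k2.precI_lt (hez.trans_precI h2)) (hB.precEqI_le f1)

/-- The chains in ◁^+ use functions starting at p, whereas the current component starts at c. Up to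
p everything is idle and p occurs, so the p-th resolvents are below the earlier ones, and
`DN.block_restart` makes the blocks at later positions agree. -/
theorem lhdS_restart (hA : DN N A) (hB : DN N B) (hD : DN N D) (hcp : c ≤ p)
    (hp : p + w.length + 3 ≤ N)
    (hz : Zs c p A D) (hz' : Zs c p B D) (hn : ¬ NoIn p A D) (hn' : ¬ NoIn p B D)
    (hT : Tr c p (false :: w) A B)
    (hE : LhdI (p + (w.length + 1)) (evFrom c p (false :: w) A) (evFrom c p (false :: w) B)) :
    LhdS p (false :: w) A B := by
  have key : ∀ {x : Dg}, DN N x → Zs c p x D → ¬ NoIn p x D →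
      ∀ q, p + 1 ≤ q → q + 2 ≤ N → block c q x = block p q x := fun hx h1 h2 q hq hqN =>
    hx.block_restart hcp hq hqN fun j h3 h4 => hx.res0_lt hD (by omega) h1 h2 h3 h4
  rw [lhdS_iff hA hB (by simp only [List.length_cons]; omega)]
  refine ⟨⟨hT.1, hT.2.1, tr_restart (by omega) (key hA hz hn) (key hB hz' hn') hT.2.2⟩, ?_⟩
  change LhdI (p + (w.length + 1)) (evFrom p (p + 1) w A) (evFrom p (p + 1) w B)
  rwa [← evFrom_restart (N := N) (by omega) (key hA hz hn),
    ← evFrom_restart (N := N) (by omega) (key hB hz' hn')]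

/-- Prolongs the chain of η by ξ. If p ∈ In(η) no chain is given, but then η is the common first
resolvent and a single link suffices. -/
theorem Chain.cons (h : p ∉ In η → Chain N p η) (hr : res0 p ξ = res0 p η) (hw : InI N p w)
    (hl : LhdS p w ξ η) : Chain N p ξ := by
  by_cases hp : p ∈ In η
  · refine ⟨1, fun k => if k = 0 then η else ξ, fun _ => w, rfl, ?_, ?_⟩
    · simp only [if_true, one_ne_zero, if_false]
      rw [hr, res0_of_mem hl.2.1 hp]
    · intro k hk
      obtain rfl : k = 0 := by omega
      exact ⟨hw, hl⟩
  · obtain ⟨L, a, v, h1, h2, h3⟩ := h hp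
    refine ⟨L + 1, fun k => if k = L + 1 then ξ else a k, fun k => if k = L then w else v k,
      if_pos rfl, ?_, ?_⟩
    · beta_reduce
      rw [if_pos rfl, if_neg (by omega), hr, h2, h1]
    · intro k hk
      rcases Nat.lt_succ_iff_lt_or_eq.1 hk with hk | rfl
      · simp only [show ¬ k = L by omega, show ¬ k + 1 = L + 1 by omega,
          show ¬ k = L + 1 by omega, if_false]
        exact h3 k hk
      · simp only [if_true, show ¬ k = k + 1 by omega, if_false, h1]
        exact ⟨hw, hl⟩

/-- An element between the two terms of a `◁` along `w` can replace one of them. -/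
theorem lhd_between (hξ : DN N ξ) (hA : DN N A) (hη : DN N η) (hcp : c ≤ p)
    (hp : p + w.length + 2 ≤ N) (h1 : PrecI p ξ A) (h2 : PrecI p A η) (hz : Zs c p ξ η)
    (hT : Tr c p w ξ η) (hE : LhdI (p + w.length) (evFrom c p w ξ) (evFrom c p w η))
    (H : ∀ u : List Bool, p + u.length + 2 ≤ N → u.count true ≤ w.count true → Tr c p u ξ A →
      Unc (p + u.length) (evFrom c p u ξ) (evFrom c p u A)) :
    (Tr c p w ξ A ∧ LhdI (p + w.length) (evFrom c p w ξ) (evFrom c p w A)) ∨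
      (Tr c p w A η ∧ LhdI (p + w.length) (evFrom c p w A) (evFrom c p w η)) := by
  induction w generalizing c p ξ A η with
  | nil => exact Or.inl ⟨h1, hE.of_between h1 h2.toEq hA.2⟩
  | cons b w ih =>
    have e : ∀ w : List Bool, ∀ b, p + (b :: w).length = p + 1 + w.length := fun w b => by
      simp only [List.length_cons]; omega
    rw [e] at hp hE ⊢
    cases b with
    | false =>
      obtain ⟨g1, g2, g3⟩ := hT
      have n1 := g2.mono .refl h2.toEq
      have n2 := g2.mono h1.toEq .refl
      refine (ih hξ hA hη (by omega) hp (precI_succ hξ h1 n1) (precI_succ hA h2 n2)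
        (hz.succ g1.toEq g2) g3 hE fun u hu1 hu2 hu3 => ?_).imp (fun h => ⟨⟨h1, n1, h.1⟩, h.2⟩)
        (fun h => ⟨⟨h2, n2, h.1⟩, h.2⟩)
      have := H (false :: u) (by rw [e]; exact hu1) (by simpa using hu2) ⟨h1, n1, hu3⟩
      rwa [e] at this
    | true =>
      obtain ⟨g1, g2, g3, g4⟩ := hT
      have u1 : Unc p ξ A := H [] (by simp only [List.length_nil]; omega) (by simp) h1
      have u2 := g2.mono h1.toEq
      have z1 := hz.mono hξ hξ hA (by omega) .refl h1.toEq h2.toEq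
      have z2 := hz.mono hξ hA hη (by omega) h1.toEq h2.toEq .refl
      -- If one side of A is idle at p, then A has the same block as that end and replaces it. If
      -- neither is, the blocks are again strictly ordered and the induction goes on with them.
      by_cases n1 : NoIn p ξ A
      · have hb := hξ.block_eq hA hcp (by omega) z1 h1.toEq n1
        refine Or.inr ⟨⟨h2, u2, fun n2 => g3 (noIn_trans h1.toEq n1 n2), ?_⟩, ?_⟩
        · rwa [← hb]
        · simp only [evFrom] at hE ⊢
          rwa [← hb]
      by_cases n2 : NoIn p A η
      · have hb := hA.block_eq hη hcp (by omega) z2 h2.toEq n2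
        refine Or.inl ⟨⟨h1, u1, n1, ?_⟩, ?_⟩
        · rwa [hb]
        · simp only [evFrom] at hE ⊢
          rwa [hb]
      refine (ih (hξ.block_spec hcp (by omega)).1 (hA.block_spec hcp (by omega)).1
        (hη.block_spec hcp (by omega)).1 le_rfl hp
        (hξ.block_prec hA hcp (by omega) z1 h1.toEq u1 n1)
        (hA.block_prec hη hcp (by omega) z2 h2.toEq u2 n2) zs_self g4 hE
        fun u hu1 hu2 hu3 => ?_).imp (fun h => ⟨⟨h1, u1, n1, h.1⟩, h.2⟩)
        (fun h => ⟨⟨h2, u2, n2, h.1⟩, h.2⟩)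
      have := H (true :: u) (by rw [e]; exact hu1) (by simpa using hu2) ⟨h1, u1, n1, hu3⟩
      rwa [e] at this

end

/-! ### The descent step -/

section
variable {N : ℕ} {A B D x y z η ξ : Dg} {b : Bool} {i j c c' p : ℕ} {w t u : List Bool}

/-- `x ≺_p y`, and a trace from `x` to `y` taking the value `1` less often than `n` is uncovered
at its end. -/
def UncBelow (N n c p : ℕ) (x y : Dg) : Prop := PrecI p x y ∧
  ∀ u : List Bool, p + u.length + 2 ≤ N → u.count true < n → Tr c p u x y →
    Unc (p + u.length) (evFrom c p u x) (evFrom c p u y)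

theorem UncBelow.unc {n : ℕ} (h : UncBelow N n c p x y) (hp : p + 2 ≤ N) (hn : 0 < n) :
    Unc p x y := h.2 [] hp hn h.1

theorem UncBelow.succ {n : ℕ} (h : UncBelow N n c p x y) (hx : DN N x) (hn : NoIn p x y) :
    UncBelow N n c (p + 1) x y := by
  refine ⟨precI_succ hx h.1 hn, fun u h1 h2 h3 => ?_⟩
  have e : p + (false :: u).length = p + 1 + u.length := by simp only [List.length_cons]; omega
  have := h.2 (false :: u) (by rw [e]; exact h1) (by simpa using h2) ⟨h.1, hn, h3⟩
  rwa [e] at this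

theorem UncBelow.block {n : ℕ} (h : UncBelow N (n + 1) c p x y) (hx : DN N x) (hy : DN N y)
    (hcp : c ≤ p) (hp : p + 3 ≤ N) (hz : Zs c p x y) (hn : ¬ NoIn p x y) :
    UncBelow N n (p + 1) (p + 1) (block c p x) (block c p y) := by
  have hu := h.unc (by omega) (by omega)
  refine ⟨hx.block_prec hy hcp hp hz h.1.toEq hu hn, fun u h1 h2 h3 => ?_⟩
  have e : p + (true :: u).length = p + 1 + u.length := by simp only [List.length_cons]; omega
  have := h.2 (true :: u) (by rw [e]; exact h1) (by simpa using h2) ⟨h.1, hu, hn, h3⟩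
  rwa [e] at this

/-- Given `ξ ◁_w η`, where `η` is an uncovered position above `A` and `w` takes the value `1` less
often than `t`, either a position below `η` can replace `η`, or `ξ ◁_w A`. -/
theorem descend (hA : DN N A) (hB : DN N B) (hη : DN N η) (hξ : DN N ξ) (hc : 2 ≤ c) (hcp : c ≤ p)
    (ht : p + t.length + 2 ≤ N) (hw : p + w.length + 2 ≤ N) (hz : Zs c p A B)
    (h1 : Tr c p t A B) (h2 : Pos c p t A η) (h3 : Tr c p t η B) (h4 : Chains N c p t η)
    (gz : Zs c p ξ η) (g1 : Tr c p w ξ η)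
    (g2 : LhdI (p + w.length) (evFrom c p w ξ) (evFrom c p w η))
    (hcnt : w.count true < t.count true)
    (tri : ξ = A ∨ UncBelow N (w.count true) c p A ξ ∨ UncBelow N (w.count true + 1) c p ξ A) :
    (∃ y, DN N y ∧ PrecI p y η ∧ Pos c p t A y ∧ Tr c p t y B ∧ evFrom c p t y = evFrom c p t η ∧
      Chains N c p t y) ∨
    (Tr c p w ξ A ∧ LhdI (p + w.length) (evFrom c p w ξ) (evFrom c p w A)) := by
  have e : ∀ w : List Bool, ∀ b, p + (b :: w).length = p + 1 + w.length := fun w b => by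
    simp only [List.length_cons]; omega
  induction t generalizing c p w A B η ξ with
  | nil => simp at hcnt
  | cons b t ih =>
  obtain ⟨k1, k2⟩ := h2.head
  have kηB := h3.precI
  have kξη := g1.precI
  cases w with
  | nil =>
    -- For empty w the relation is ◁_p itself. If A ≼_p ξ this contradicts uncoveredness of η;
    -- otherwise A lies between ξ and η and is covered too.
    have g2' : LhdI p ξ η := g2
    rcases tri with rfl | tri | tri
    · exact (k2 _ .refl g2').elim
    · exact (k2 _ tri.1.toEq g2').elim
    · exact Or.inr ⟨tri.1, g2'.of_between tri.1 k1 hA.2⟩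
  | cons b' w =>
  have zAη := hz.mono hA hA hη (by omega) .refl k1 kηB.toEq
  have zηB := hz.mono hA hη hB (by omega) k1 kηB.toEq .refl
  cases b with
  | false =>
    obtain ⟨n1, n2, n3⟩ := h1
    have nAη := n2.mono .refl kηB.toEq
    cases b' with
    | true =>
      obtain ⟨q1, q2, q3, q4⟩ := g1
      -- p occurs between ξ and η but not between A and η, so ξ must lie below A; then A and η have
      -- the same block.
      have kξA : UncBelow N ((true :: w).count true + 1) c p ξ A := by
        rcases tri with rfl | tri | tri
        · exact (q3 nAη).elim
        · exact (q3 (nAη.mono tri.1.toEq .refl)).elim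
        · exact tri
      have hb := hA.block_eq hη hcp (by simp only [List.length_cons] at hw; omega) zAη k1 nAη
      refine Or.inr ⟨⟨kξA.1, kξA.unc (by omega) (by omega),
        fun n => q3 (noIn_trans kξA.1.toEq n nAη), ?_⟩, ?_⟩
      · rwa [hb]
      · simp only [evFrom] at g2 ⊢
        rwa [hb]
    | false =>
      obtain ⟨q1, q2, q3⟩ := g1
      rw [e] at ht hw g2
      simp only [List.count_cons_of_ne (show (false : Bool) ≠ true by decide)] at hcnt tri
      have tri' : ξ = A ∨ UncBelow N (w.count true) c (p + 1) A ξ ∨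
          UncBelow N (w.count true + 1) c (p + 1) ξ A := by
        rcases tri with tri | tri | tri
        · exact Or.inl tri
        · exact Or.inr (Or.inl (tri.succ hA (nAη.mono .refl q1.toEq)))
        · exact Or.inr (Or.inr (tri.succ hξ (q2.mono .refl k1)))
      rcases ih hA hB hη hξ hc (by omega) ht hw (hz.succ n1.toEq n2) n3 h2.2 h3.2.2 h4
        (gz.succ q1.toEq q2) q3 g2 hcnt tri' (fun w b => by simp only [List.length_cons]; omega)
        with ⟨y, f1, f2, f3, f4, f5, f6⟩ | ⟨f1, f2⟩
      · have f7 := hA.precI_of_succ (by omega) f3.head.1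
        have f8 := f1.precI_of_precI_succ (by omega) f4.precI
        exact Or.inl ⟨y, f1, f1.precI_of_precI_succ (by omega) f2,
          ⟨⟨f7, (n2.mono .refl f8.toEq).unc⟩, f3⟩, ⟨f8, n2.mono f7 .refl, f4⟩, f5, f6⟩
      · rw [e]
        exact Or.inr ⟨⟨hξ.precI_of_precI_succ (by omega) f1.precI, q2.mono .refl k1, f1⟩, f2⟩
  | true =>
    obtain ⟨n1, n2, n3, n4⟩ := h1
    obtain ⟨m1, m2, m3, m4⟩ := h3
    have hp3 : p + 3 ≤ N := by simp only [List.length_cons] at ht; omega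
    cases b' with
    | false =>
      -- Any such x can replace η: no p ∈ In occurs between x and η, so their blocks agree, and the
      -- chain of η is prolonged by x.
      have key : ∀ x, DN N x → PrecEqI p A x → Tr c p (false :: w) x η →
          LhdI (p + (false :: w).length) (evFrom c p (false :: w) x)
            (evFrom c p (false :: w) η) →
          ∃ y, DN N y ∧ PrecI p y η ∧ Pos c p (true :: t) A y ∧ Tr c p (true :: t) y B ∧
            evFrom c p (true :: t) y = evFrom c p (true :: t) η ∧ Chains N c p (true :: t) y := by
        rintro x hx hAx ⟨l1, l2, l3⟩ l4
        have zxη := hz.mono hA hx hη (by omega) hAx l1.toEq kηB.toEq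
        have zxB := hz.mono hA hx hB (by omega) hAx (l1.trans_precEqI kηB.toEq).toEq .refl
        have hb := hx.block_eq hη hcp (by omega) zxη l1.toEq l2
        have nxB : ¬ NoIn p x B := fun h => m3 (h.mono l1.toEq .refl)
        refine ⟨x, hx, l1, ⟨⟨hAx, hA.unc_of_noIn (by omega) hAx l1.toEq l2 k2⟩, ?_⟩,
          ⟨l1.trans kηB, n2.mono hAx, nxB, ?_⟩, ?_, fun _ => ?_, ?_⟩
        · rw [hb]; exact h2.2
        · rw [hb]; exact m4
        · simp only [evFrom, hb]
        · refine Chain.cons h4.1 (hx.res0_congr l1.toEq hη.2 l2).1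
            ⟨hc.trans hcp, by omega⟩ (lhdS_restart hx hη hB hcp ?_ zxB zηB nxB m3 ⟨l1, l2, l3⟩ l4)
          simp only [List.length_cons] at hw
          omega
        · rw [hb]; exact h4.2
      rcases tri with rfl | tri | tri
      · exact Or.inl (key _ hξ .refl g1 g2)
      · exact Or.inl (key ξ hξ tri.1.toEq g1 g2)
      -- With ξ below A and A below η, `lhd_between` gives either ξ ◁_w A, or A ◁_w η and then A
      -- replaces η.
      · rcases precEqI_iff.1 k1 with rfl | k1'
        · exact Or.inr ⟨g1, g2⟩
        · rcases lhd_between hξ hA hη hcp hw tri.1 k1' gz g1 g2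
            (fun u hu1 hu2 hu3 => tri.2 u hu1 (by omega) hu3) with h | h
          · exact Or.inr h
          · exact Or.inl (key A hA .refl h.1 h.2)
    | true =>
      obtain ⟨q1, q2, q3, q4⟩ := g1
      rw [e] at ht hw g2
      simp only [List.count_cons_self] at hcnt tri
      have bA := (hA.block_spec hcp hp3).1
      have bB := (hB.block_spec hcp hp3).1
      have bη := (hη.block_spec hcp hp3).1
      have bξ := (hξ.block_spec hcp hp3).1
      -- Passing to blocks turns an idle segment between ξ and A into equality; otherwise the order
      -- is kept and the uncovered traces lose one occurrence of the value 1.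
      have tri' : (block c p ξ = block c p A ∧ PrecEqI (p + 1) (block c p A) (block c p ξ)) ∨
          UncBelow N (w.count true) (p + 1) (p + 1) (block c p A) (block c p ξ) ∨
          (UncBelow N (w.count true + 1) (p + 1) (p + 1) (block c p ξ) (block c p A) ∧
            PrecI p ξ A ∧ Unc p ξ A ∧ ¬ NoIn p ξ A) := by
        rcases tri with rfl | tri | tri
        · exact Or.inl ⟨rfl, .refl⟩
        · have z := hz.mono hA hA hξ (by omega) .refl tri.1.toEq (q1.trans_precEqI kηB.toEq).toEq
          by_cases n : NoIn p A ξ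
          · have hb := hA.block_eq hξ hcp (by omega) z tri.1.toEq n
            exact Or.inl ⟨hb.symm, by rw [hb]; exact .refl⟩
          · exact Or.inr (Or.inl (tri.block hA hξ hcp hp3 z n))
        · have z := gz.mono hξ hξ hA (by omega) .refl tri.1.toEq k1
          by_cases n : NoIn p ξ A
          · have hb := hξ.block_eq hA hcp (by omega) z tri.1.toEq n
            exact Or.inl ⟨hb, by rw [hb]; exact .refl⟩
          · exact Or.inr (Or.inr ⟨tri.block hξ hA hcp hp3 z n, tri.1,
              tri.unc (by omega) (by omega), n⟩)
      rcases ih bA bB bη bξ (by omega) le_rfl ht hw zs_self n4 h2.2 m4 h4.2 zs_self q4 g2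
        (by omega) (tri'.imp (fun h => h.1) (fun h => h.imp id fun h => h.1))
        (fun w b => by simp only [List.length_cons]; omega)
        with ⟨y, f1, f2, f3, f4, f5, f6⟩ | ⟨f1, f2⟩
      -- The y found among the blocks is pulled back to a diagram between A and η. This needs p to
      -- occur there, since otherwise A and η would have equal blocks and y no room.
      · have nAη : ¬ NoIn p A η := fun n => by
          have hb := hA.block_eq hη hcp (by omega) zAη k1 n
          rw [← hb] at f2
          exact bA.precI_irrefl (f3.head.1.trans_precI f2)
        obtain ⟨x, l1, l2, l3, l4, l5, rfl⟩ := hA.block_surj hη hcp hp3 zAη k1 k2 nAη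
          f3.head.1 f2 f3.head.2
        exact Or.inl ⟨x, l1, l3, ⟨⟨l2, l5⟩, f3⟩, ⟨l3.trans kηB, n2.mono l2,
          not_noIn_of_mem l4 (l3.trans kηB), f4⟩, f5, fun h => (h l4).elim, f6⟩
      · rw [e]
        rcases tri' with tri' | tri' | tri'
        · exact (bξ.precI_asymm f1.precI tri'.2).elim
        · exact (bξ.precI_asymm f1.precI tri'.1.toEq).elim
        · exact Or.inr ⟨⟨tri'.2.1, tri'.2.2.1, tri'.2.2.2, f1⟩, f2⟩

end

/-! ### Levels of 𝒢 and the operator Γ_N -/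

section
variable {N : ℕ} {X Z : Set Dg} {α γ η ξ : Dg} {i j n r : ℕ} {u w : List Bool}

theorem GLt_succ_subset (hi : 2 ≤ i) : GLt N X (i + 1) ⊆ GLt N X i := by
  obtain ⟨k, rfl⟩ : ∃ k, i = k + 2 := ⟨i - 2, by omega⟩
  exact fun x hx => hx.1

theorem GLt_anti (hi : 2 ≤ i) (hij : i ≤ j) : GLt N X j ⊆ GLt N X i := by
  induction j, hij using Nat.le_induction with
  | base => exact subset_rfl
  | succ j hj ih => exact (GLt_succ_subset (hi.trans hj)).trans ih

theorem G_of_mem_GLt (hi : 2 ≤ i) (h : α ∈ GLt N X i) : α ∈ G (OdN N) X := GLt_anti le_rfl hi h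

theorem not_leBelow (hX : X ⊆ OdN N) (hγ : WF γ) (hη : WF η) (h : ∀ x ∈ X, lt x γ) (hγη : le γ η) :
    ¬ LeBelow X α η := by
  rintro ⟨δ, h1, -, h2⟩
  have wδ := (hX h1).wf
  exact lt_irrefl wδ (lt_of_lt_of_le wδ hγ wδ (h δ h1) (le_trans hγ hη wδ hγη h2))

/-- The witness is taken at the first level that fails, so ξ lies in all the levels preceding it. -/
theorem exists_of_not_mem_GLt (h1 : η ∈ G (OdN N) X) (h2 : η ∉ GLt N X (r + 2)) :
    ∃ w : List Bool, InI N 2 w ∧ w.count true < r ∧ ∃ ξ, LhdSPlus N 2 w ξ η ∧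
      ξ ∈ GLt N X (w.count true + 2) ∧ ¬ LeBelow X η ξ := by
  induction r with
  | zero => exact (h2 h1).elim
  | succ r ih =>
    by_cases h3 : η ∈ GLt N X (r + 2)
    · by_contra! h4
      refine h2 ⟨h3, fun w hw hr ξ h5 h6 => ?_⟩
      obtain rfl : r = w.count true := by omega
      exact h4 w hw (Nat.lt_succ_self _) ξ h5 h6
    · obtain ⟨w, g1, g2, g3⟩ := ih h3
      exact ⟨w, g1, by omega, g3⟩

theorem InI.length_le (hN : 4 ≤ N) (h : InI N 2 w) : 2 + w.length + 2 ≤ N := by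
  have := h.2
  omega

theorem LhdS.precI (hξ : DN N ξ) (hη : DN N η) (hp : 2 + w.length + 2 ≤ N)
    (h : LhdS 2 w ξ η) : PrecI 2 ξ η :=
  ((lhdS_iff hξ hη hp).1 h).1.precI

/-- A trace from `γ` to `α` is uncovered at its end. -/
theorem unc_of_mem_GLt (hN : 4 ≤ N) (hX : X ⊆ OdN N) (hγ : DN N γ) (hα : DN N α)
    (hγG : γ ∈ GLt N X (r + 2)) (hαG : α ∈ GLt N X (r + 3)) (hXγ : ∀ x ∈ X, lt x γ)
    (hu : u.count true ≤ r) (hp : 2 + u.length + 2 ≤ N) (ht : Tr 2 2 u γ α) :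
    Unc (2 + u.length) (ev 2 u γ) (ev 2 u α) := by
  induction r using Nat.strong_induction_on generalizing γ α u with
  | _ r ih =>
  rcases Nat.lt_or_eq_of_le hu with hu | rfl
  · exact ih _ hu hγ hα (GLt_anti (by omega) (by omega) hγG) (GLt_anti (by omega) (by omega) hαG)
      hXγ le_rfl hp ht
  have hz : Zs 2 2 γ α := zs_self
  -- A pulled-back covering element η is refuted by induction on its distance below in the chain
  -- from γ: each replacement lies strictly ≺ η but still at or above γ, so its size grows within
  -- the bound size γ.
  have claim : ∀ m η, size γ - size η = m → DN N η → Pos 2 2 u γ η → Tr 2 2 u η α →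
      LhdI (2 + u.length) (ev 2 u η) (ev 2 u α) → Chains N 2 2 u η → False := by
    intro m
    induction m using Nat.strong_induction_on with
    | _ m ihm =>
    intro η hm hη h1 h2 h3 h4
    have hγη := h1.head.1
    have leγη := hγ.precEqI_le hγη
    have hηα : LhdSPlus N 2 u η α := lhdSPlus_iff.2 ⟨(lhdS_iff hη hα hp).2 ⟨h2, h3⟩, h4⟩
    by_cases hηG : η ∈ GLt N X (u.count true + 2)
    · exact not_leBelow hX hγ.wf hη.wf hXγ leγη
        (hαG.2 u ⟨le_rfl, by omega⟩ (by omega) η hηα hηG)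
    -- η is above γ, hence in 𝒢(X), so it must fail at a level between 2 and 1 + #u.
    have hηG2 := mem_G_of_precEq hX (G_of_mem_GLt (by omega) hγG) hXγ (hγ.precEqI_prec hγη).1
    obtain ⟨w, hwI, hwc, ξ, h5, h6, h7⟩ := exists_of_not_mem_GLt hηG2 hηG
    have hwl := hwI.length_le hN
    have hξG := G_of_mem_GLt (by omega) h6
    have hξ : DN N ξ := ⟨hξG.1, h5.1.1⟩
    -- An x ∈ X with ξ ≤ x satisfies x < γ ≤ η and would bound ξ below η.
    have hXξ : ∀ x ∈ X, lt x ξ := by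
      intro x hx
      have wx := (hX hx).wf
      refine (le_or_lt hξ.wf wx).resolve_left fun h => h7 ⟨x, hx, ?_, h⟩
      exact lt_of_lt_of_le wx hγ.wf hη.wf (hXγ x hx) leγη
    obtain ⟨h8, h9⟩ := lhdSPlus_iff.1 h5
    obtain ⟨h10, h11⟩ := (lhdS_iff hξ hη hwl).1 h8
    -- Both ξ and γ are in 𝒢(X) above X, so they are comparable by ≺. The induction on r makes their
    -- traces uncovered, with one occurrence of 1 more when ξ is the smaller, because γ has more
    -- levels than ξ is known to have.
    have tri : ξ = γ ∨ UncBelow N (w.count true) 2 2 γ ξ ∨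
        UncBelow N (w.count true + 1) 2 2 ξ γ := by
      rcases Dg.tri hξ.wf hγ.wf with h | h | h
      · have hp := prec_of_mem_G hX hξG (G_of_mem_GLt (by omega) hγG) h hXξ
        refine Or.inr (Or.inr ⟨hξ.precI_two_iff.2 hp, fun v hv1 hv2 hv3 => ?_⟩)
        exact ih _ hwc hξ hγ h6 (GLt_anti (by omega) (by omega) hγG) hXξ (by omega) hv1 hv3
      · exact Or.inl h
      · have hp := prec_of_mem_G hX (G_of_mem_GLt (by omega) hγG) hξG h hXγ
        refine Or.inr (Or.inl ⟨hγ.precI_two_iff.2 hp, fun v hv1 hv2 hv3 => ?_⟩)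
        exact ih (w.count true - 1) (by omega) hγ hξ (GLt_anti (by omega) (by omega) hγG)
          (GLt_anti (by omega) (by omega) h6) hXγ (by omega) hv1 hv3
    rcases descend hγ hα hη hξ le_rfl le_rfl hp hwl hz ht h1 h2 h4 zs_self h10 h11 hwc tri with
      ⟨y, f1, f2, f3, f4, f5, f6⟩ | ⟨f1, f2⟩
    · have s1 := f1.precI_size f2
      have s2 := hγ.precEqI_size f3.head.1
      refine ihm _ ?_ y rfl f1 f3 f4 ?_ f6
      · omega
      · unfold ev
        rw [f5]
        exact h3
    -- Here ξ ◁_w^+ γ. As #w < #u, γ has the level 2 + #w, which bounds ξ by X, although X < ξ.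
    · have h12 : LhdSPlus N 2 w ξ γ := lhdSPlus_iff.2 ⟨(lhdS_iff hξ hγ hwl).2 ⟨f1, f2⟩, h9⟩
      have hγw : γ ∈ GLt N X (w.count true + 3) := GLt_anti (by omega) (by omega) hγG
      exact not_leBelow hX hξ.wf hξ.wf hXξ (Or.inr rfl) (hγw.2 w hwI (by omega) ξ h12 h6)
  -- By `DN.precP_iff` only resolvents of γ(u) need to be excluded. These are uncovered themselves,
  -- as the pullback requires.
  have hE := ev_dn (w := u) hγ hp
  refine ((hE.precP_iff hp).1 ⟨ht.precI_end, ?_⟩).2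
  rintro ⟨n, δ, h1, h2⟩
  obtain ⟨g1, g2, g3⟩ := hE.res_spec hp h1
  obtain ⟨η, f1, f2, f3, rfl, f5⟩ := exists_pullback hγ hα le_rfl hp hz ht g1 h2.2.2.2.1 g3
  exact claim _ η rfl f1 f2 f3 h2 f5

theorem GLt_subset : ∀ {i : ℕ}, GLt N X i ⊆ OdN N
  | 0 => subset_rfl
  | 1 => subset_rfl
  | _ + 2 => fun _ hx => (G_of_mem_GLt (by omega) hx).1

/-- Whether `γ` is in `𝒢_{<i}(X)` depends only on the part of `X` below `γ`. -/
theorem mem_GLt_congr (hN : 4 ≤ N) (hX : X ⊆ OdN N) (hZ : Z ⊆ OdN N) : ∀ {i : ℕ} {γ : Dg},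
    (∀ x, lt x γ → (x ∈ X ↔ x ∈ Z)) → (γ ∈ GLt N X i ↔ γ ∈ GLt N Z i)
  | 0, _, _ => Iff.rfl
  | 1, _, _ => Iff.rfl
  | 2, _, h => mem_G_congr h
  | i + 3, γ, h => by
    change (_ ∧ _) ↔ (_ ∧ _)
    rw [← mem_GLt_congr hN hX hZ h]
    refine and_congr_right fun hγ => forall_congr' fun w => forall_congr' fun hw =>
      forall_congr' fun _ => forall_congr' fun δ => forall_congr' fun hδ => ?_
    have hB : LeBelow X γ δ ↔ LeBelow Z γ δ := by
      refine exists_congr fun x => ⟨fun hx => ⟨(h x hx.2.1).1 hx.1, hx.2⟩,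
        fun hx => ⟨(h x hx.2.1).2 hx.1, hx.2⟩⟩
    rw [hB]
    refine imp_congr_left ?_
    have key : δ ∈ OdN N → (δ ∈ GLt N X (i + 2) ↔ δ ∈ GLt N Z (i + 2)) := by
      intro hδN
      have hδ' : DN N δ := ⟨hδN, hδ.1.1⟩
      have hγ' : DN N γ := ⟨GLt_subset hγ, hδ.1.2.1⟩
      have hlt := hδ'.precI_lt (hδ.1.precI hδ' hγ' (hw.length_le hN))
      refine mem_GLt_congr hN hX hZ fun x hx => ?_
      exact ⟨fun h1 => (h x (lt_trans (hX h1).wf hδ'.wf hγ'.wf hx hlt)).1 h1,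
        fun h1 => (h x (lt_trans (hZ h1).wf hδ'.wf hγ'.wf hx hlt)).2 h1⟩
    exact ⟨fun h1 => (key (GLt_subset h1)).1 h1, fun h1 => (key (GLt_subset h1)).2 h1⟩

/-- The trace from `γ` to `α` of greatest length. -/
theorem precS_of_mem_GLt (hN : 4 ≤ N) (hX : X ⊆ OdN N) (hγ : DN N γ) (hα : DN N α)
    (hγG : γ ∈ GLt N X (N - 1)) (hαG : α ∈ GLt N X (N - 1)) (hXγ : ∀ x ∈ X, lt x γ)
    (hp : Prec γ α) : PrecS 2 (branch 2 γ α (N - 4)) γ α := by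
  have hunc : ∀ n ≤ N - 4, Tr 2 2 (branch 2 γ α n) γ α →
      Unc (2 + (branch 2 γ α n).length) (ev 2 (branch 2 γ α n) γ) (ev 2 (branch 2 γ α n) α) := by
    intro n hn h
    have e := branch_length (i := 2) (A := γ) (B := α) n
    -- For this r the level r + 3 is N - 1, exactly what Γ_N supplies, and traces of length at most
    -- N - 4 take the value 1 at most r times.
    refine unc_of_mem_GLt (r := N - 4) hN hX hγ hα (GLt_anti (by omega) (by omega) hγG)
      (GLt_anti (by omega) (by omega) hαG) hXγ ?_ (by omega) h
    exact List.count_le_length.trans (by omega)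
  have htr : ∀ n ≤ N - 4, Tr 2 2 (branch 2 γ α n) γ α := by
    intro n
    induction n with
    | zero => exact fun _ => hγ.precI_two_iff.2 hp
    | succ n ih =>
      intro hn
      have h1 := ih (by omega)
      have e := branch_length (i := 2) (A := γ) (B := α) n
      have hS : SubBranch 2 (branch 2 γ α (n + 1)) γ α := by
        unfold SubBranch
        rw [branch_length]
      have hz : Zs 2 2 γ α := zs_self
      rw [branch] at hS ⊢
      exact (tr_snoc hγ hα le_rfl (by omega) hz).2
        ⟨h1, hunc n (by omega) h1, (subBranch_snoc.1 hS).2⟩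
  have e := branch_length (i := 2) (A := γ) (B := α) (N - 4)
  exact (precS_iff hγ hα (by omega)).2 ⟨htr _ le_rfl, hunc _ le_rfl (htr _ le_rfl)⟩

/-- The premise of `norm_lt_norm` for Γ_N. For γ, α ∈ 𝒟^Q the last clause of Γ_N bounds γ by X as
soon as γ ≺_s α for the full branch s, while X lies below γ. -/
theorem mem_of_mem_GammaN (hN : 4 ≤ N) (hX : X ⊆ OdN N) (hZS : Z ⊆ OdN N) (hXZ : X ⊆ Z)
    (hα : α ∈ GammaN N X) (hγ : γ ∈ GammaN N Z) (hlt : lt γ α) (hZ : ∀ x ∈ Z, lt x α → x ∈ X)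
    (hXγ : ∀ x ∈ X, lt x γ) : γ ∈ X := by
  obtain ⟨hαpi, hαL, hαS, hαP⟩ := hα
  have hαG := G_of_mem_GLt (by omega) hαL
  have wα := hαG.1.wf
  have wγ := (GLt_subset hγ.2.1).wf
  have hγL : γ ∈ GLt N X (N - 1) :=
    (mem_GLt_congr hN hX hZS fun x h => ⟨fun h' => hXZ h', fun h' =>
      hZ x h' (lt_trans (hZS h').wf wγ wα h hlt)⟩).2 hγ.2.1
  have hγG := G_of_mem_GLt (by omega) hγL
  have hp : Prec γ α := prec_of_mem_G hX hγG hαG hlt hXγ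
  rcases hp.cases_dq hγG.1 with ⟨hs, hm⟩ | ⟨hd, h1⟩
  · exact hαS hs γ hm hγG
  have hdα : IsDQ α := by
    rcases h1 with rfl | h1
    · exact (lt_irrefl wα hαpi).elim
    · exact h1
  exact (not_leBelow hX wγ wγ hXγ (Or.inr rfl) (hαP γ hγL
    (precS_of_mem_GLt hN hX ⟨hγG.1, hd⟩ ⟨hαG.1, hdα⟩ hγL hαL hXγ hp))).elim

/-- The norm is strictly increasing on the part of `Od(Π_N)` generated by `Γ_N`. -/
theorem norm_GammaN_lt {β : Dg} (hN : 4 ≤ N) (hα : α ∈ W (GammaN N)) (hβ : β ∈ W (GammaN N))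
    (h : lt α β) : norm (GammaN N) α < norm (GammaN N) β :=
  norm_lt_norm (S := OdN N) (fun _ hx => IsOd.wf hx) (fun _ _ hx => GLt_subset hx.2.1)
    (fun _ _ _ _ hX hZ hXZ hα hγ hlt h1 h2 => mem_of_mem_GammaN hN hX hZ hXZ hα hγ hlt h1 h2)
    hα hβ h

end
end Dg

theorem mainTheorem4 :
    (∀ α β : Dg, α ∈ Dg.W Dg.Gamma32 → β ∈ Dg.W Dg.Gamma32 → Dg.lt α β →
      Dg.norm Dg.Gamma32 α < Dg.norm Dg.Gamma32 β) ∧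
    (∀ N : ℕ, 4 ≤ N →
      ∀ α β : Dg, α ∈ Dg.W (Dg.GammaN N) → β ∈ Dg.W (Dg.GammaN N) → Dg.lt α β →
        Dg.norm (Dg.GammaN N) α < Dg.norm (Dg.GammaN N) β) :=
  ⟨fun _ _ hα hβ h => Dg.norm_Gamma32_lt hα hβ h,
    fun _ hN _ _ hα hβ h => Dg.norm_GammaN_lt hN hα hβ h⟩
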